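/- For a finite set $S$, a function $f:S\to\mathbb{R}$ and $X\subseteq S$ write $f(X)=\sum_{s\in X}f(s)$. Let $M_1=(S,\mathcal{B}_1)$ be a partition matroid with partition classes of size at most $2$ and bound $1$ on every class, that is, $\mathcal{B}_1=\{X\subseteq S : |X\cap S_i|=1 \text{ for } i=1,\dots,q\}$ for a partition $S=S_1\cup\dots\cup S_q$ into nonempty classes with $|S_i|\le 2$, and let $M_2=(S,\mathcal{B}_2)$ be an arbitrary matroid (here $\mathcal{B}_i$ is the family of bases). Let $w_1,w_2:S\to\mathbb{R}$, and assume that there are disjoint bases $B_1\in\mathcal{B}_1$ and $B_2\in\mathcal{B}_2$ with $B_1\cup B_2=S$. Then there is a price vector $p:S\to\mathbb{R}$ such that: 1. every $B_1\in\operatorname{arg\,max}_{X\in\mathcal{B}_1}(w_1(X)-p(X))$ is a maximizer of $w_1(X)+w_2(S\setminus X)$ subject to $X\in\mathcal{B}_1$ and $S\setminus X\in\mathcal{B}_2$; 2. every $B_2\in\operatorname{arg\,max}_{X\in\mathcal{B}_2}(w_2(X)-p(X))$ is a maximizer of $w_1(S\setminus X)+w_2(X)$ subject to $S\setminus X\in\mathcal{B}_1$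 and $X\in\mathcal{B}_2$. Moreover, such a price vector can be computed in polynomial time: there is an algorithm that, given $S=\{0,\dots,n-1\}$, rational weights $w_1,w_2:S\to\mathbb{Q}$ (numerators and denominators in binary) and access to $M_1$ and $M_2$ through independence oracles, outputs for all $M_1,M_2,w_1,w_2$ as above a rational price vector $p$ with properties 1 and 2, and whose number of oracle calls and elementary bit operations is bounded by a polynomial in $n$ and the total bit length of $w_1$ and $w_2$. -/

import Mathlib

/-! ## Markets of two matroids on the same finite ground set -/

namespace Pricing

/-- `f(X) = ∑_{s ∈ X} f(s)`. -/
def total {S : Type*} (f : S → ℝ) (X : Finset S) : ℝ := ∑ s ∈ X, f s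

/-- The members of the family `F` that maximize `f` over `F`. -/
def argmax {S : Type*} (F : Set (Finset S)) (f : Finset S → ℝ) : Set (Finset S) :=
  {X | X ∈ F ∧ ∀ Y ∈ F, f Y ≤ f X}

/-- The base family of a matroid on a finite set. -/
def bases {S : Type*} (M : Matroid S) : Set (Finset S) := {X | M.IsBase (X : Set S)}

variable {S : Type*} [Fintype S] [DecidableEq S]

/-- `M` is the partition matroid on `S` with classes the parts of `P` and bound `k C` on the
class `C`. -/
def IsPartitionMatroid (M : Matroid S) (P : Finpartition (Finset.univ : Finset S))
    (k : Finset S → ℕ) : Prop :=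
  M.E = Set.univ ∧ bases M = {X | ∀ C ∈ P.parts, (X ∩ C).card = k C}

/-- `M₁` is a partition matroid with classes of size at most `2` and all bounds equal to `1`,
`M₂` is an arbitrary matroid, both have ground set `S`, and `S` is the disjoint union of a base of
`M₁` and a base of `M₂`. -/
structure IsMarket (M₁ M₂ : Matroid S) : Prop where
  partition : ∃ P : Finpartition (Finset.univ : Finset S),
    (∀ C ∈ P.parts, C.card ≤ 2) ∧ IsPartitionMatroid M₁ P (fun _ => 1)
  ground : M₂.E = Set.univ
  disjoint_bases : ∃ B₁ ∈ bases M₁, ∃ B₂ ∈ bases M₂, Disjoint B₁ B₂ ∧ B₁ ∪ B₂ = Finset.univ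

/-- The prices `p` lead to optimal social welfare whichever buyer comes first and however ties are
broken. -/
structure IsPriceVector (M₁ M₂ : Matroid S) (w₁ w₂ p : S → ℝ) : Prop where
  first : ∀ B₁ ∈ argmax (bases M₁) (fun X => total w₁ X - total p X),
    B₁ ∈ argmax {X | X ∈ bases M₁ ∧ Xᶜ ∈ bases M₂} (fun X => total w₁ X + total w₂ Xᶜ)
  second : ∀ B₂ ∈ argmax (bases M₂) (fun X => total w₂ X - total p X),
    B₂ ∈ argmax {X | Xᶜ ∈ bases M₁ ∧ X ∈ bases M₂} (fun X => total w₁ Xᶜ + total w₂ X)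

end Pricing

/-! ## A random access machine with oracles and logarithmic cost

Programs are finite pieces of syntax. They work on finitely many named arrays of integers with
arbitrary integer indices. Every operation is charged with the number of bits of the numbers
involved, so the running time is polynomially related to that of an oracle Turing machine. -/

namespace OracleRAM

/-- The contents of the memory: array name, index, value. -/
abbrev Store := ℕ → ℤ → ℤ

/-- The bit length of an integer. -/
def bits (z : ℤ) : ℕ := Nat.size z.natAbs

inductive BinOp
  | add | sub | mul | div | mod | le | eq

def BinOp.eval : BinOp → ℤ → ℤ → ℤ
  | add, x, y => x + y
  | sub, x, y => x - y
  | mul, x, y => x * y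
  | div, x, y => x / y
  | mod, x, y => x % y
  | le, x, y => if x ≤ y then 1 else 0
  | eq, x, y => if x = y then 1 else 0

inductive Exp
  /-- An integer constant. -/
  | const (z : ℤ)
  /-- The entry of array `a` at the index given by `e`. -/
  | get (a : ℕ) (e : Exp)
  | op (o : BinOp) (e₁ e₂ : Exp)

def Exp.eval (σ : Store) : Exp → ℤ
  | const z => z
  | get a e => σ a (e.eval σ)
  | op o e₁ e₂ => o.eval (e₁.eval σ) (e₂.eval σ)

/-- The cost of evaluating an expression: each node costs one plus the bit length of its value. -/
def Exp.cost (σ : Store) : Exp → ℕ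
  | const z => 1 + bits z
  | get a e => e.cost σ + 1 + bits ((get a e).eval σ)
  | op o e₁ e₂ => e₁.cost σ + e₂.cost σ + 1 + bits ((op o e₁ e₂).eval σ)

inductive Prog
  | skip
  /-- `a[i] := e` -/
  | assign (a : ℕ) (i e : Exp)
  /-- `b[0] := 1` if oracle `j` accepts the set of those `s` with `a[s] ≠ 0`, else `b[0] := 0` -/
  | query (j : Fin 2) (a b : ℕ)
  | seq (c₁ c₂ : Prog)
  /-- Run `c₁` if `e ≠ 0`, else `c₂`. -/
  | cond (e : Exp) (c₁ c₂ : Prog)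
  /-- Run `c` as long as `e ≠ 0`. -/
  | loop (e : Exp) (c : Prog)

/-- Writing one memory cell. -/
def Store.set (σ : Store) (a : ℕ) (i v : ℤ) : Store :=
  Function.update σ a (Function.update (σ a) i v)

/-- The subset of `{0, …, n - 1}` whose indicator vector is stored in array `a`. -/
def Store.subset (σ : Store) (n a : ℕ) : Finset (Fin n) :=
  Finset.univ.filter fun s => σ a (s : ℕ) ≠ 0

/-- `Exec O c σ t σ'`: started on memory `σ` with the two oracles `O`, the program `c` halts with
memory `σ'` after time `t`. An oracle call costs `n + 1`. -/
inductive Exec {n : ℕ} (O : Fin 2 → Finset (Fin n) → Prop) : Prog → Store → ℕ → Store → Prop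
  | skip (σ : Store) : Exec O .skip σ 1 σ
  | assign (σ : Store) (a : ℕ) (i e : Exp) :
      Exec O (.assign a i e) σ (i.cost σ + e.cost σ + 1) (σ.set a (i.eval σ) (e.eval σ))
  | query_accept (σ : Store) (j : Fin 2) (a b : ℕ) (h : O j (σ.subset n a)) :
      Exec O (.query j a b) σ (n + 1) (σ.set b 0 1)
  | query_reject (σ : Store) (j : Fin 2) (a b : ℕ) (h : ¬ O j (σ.subset n a)) :
      Exec O (.query j a b) σ (n + 1) (σ.set b 0 0)
  | seq {c₁ c₂ : Prog} {σ σ' σ'' : Store} {t₁ t₂ : ℕ}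
      (h₁ : Exec O c₁ σ t₁ σ') (h₂ : Exec O c₂ σ' t₂ σ'') :
      Exec O (.seq c₁ c₂) σ (t₁ + t₂ + 1) σ''
  | cond_then {e : Exp} {c₁ c₂ : Prog} {σ σ' : Store} {t : ℕ}
      (he : e.eval σ ≠ 0) (h : Exec O c₁ σ t σ') :
      Exec O (.cond e c₁ c₂) σ (e.cost σ + t + 1) σ'
  | cond_else {e : Exp} {c₁ c₂ : Prog} {σ σ' : Store} {t : ℕ}
      (he : e.eval σ = 0) (h : Exec O c₂ σ t σ') :
      Exec O (.cond e c₁ c₂) σ (e.cost σ + t + 1) σ'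
  | loop_done {e : Exp} {c : Prog} {σ : Store} (he : e.eval σ = 0) :
      Exec O (.loop e c) σ (e.cost σ + 1) σ
  | loop_step {e : Exp} {c : Prog} {σ σ' σ'' : Store} {t₁ t₂ : ℕ}
      (he : e.eval σ ≠ 0) (h₁ : Exec O c σ t₁ σ') (h₂ : Exec O (.loop e c) σ' t₂ σ'') :
      Exec O (.loop e c) σ (e.cost σ + t₁ + t₂ + 1) σ''

/-- The array with entries `f 0, …, f (n - 1)` at the indices `0, …, n - 1` and `0` elsewhere. -/
def arrayOf {n : ℕ} (f : Fin n → ℤ) (i : ℤ) : ℤ :=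
  if h : 0 ≤ i ∧ i.toNat < n then f ⟨i.toNat, h.2⟩ else 0

/-- The initial memory: `n` in cell `0` of array `0`, numerators and denominators of the weights
in arrays `1, 2` (for `w₁`) and `3, 4` (for `w₂`), zero elsewhere. -/
def input {n : ℕ} (w₁ w₂ : Fin n → ℚ) : Store
  | 0 => fun i => if i = 0 then (n : ℤ) else 0
  | 1 => arrayOf fun s => (w₁ s).num
  | 2 => arrayOf fun s => ((w₁ s).den : ℤ)
  | 3 => arrayOf fun s => (w₂ s).num
  | 4 => arrayOf fun s => ((w₂ s).den : ℤ)
  | _ => fun _ => 0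

/-- The size of the instance: the number of elements plus the total bit length of the weights. -/
def inputSize {n : ℕ} (w₁ w₂ : Fin n → ℚ) : ℕ :=
  n + ∑ s, (bits (w₁ s).num + bits (w₁ s).den + bits (w₂ s).num + bits (w₂ s).den)

/-- The final memory `σ` holds the rational vector `p`: numerators in array `5`, positive
denominators in array `6`. -/
def Outputs {n : ℕ} (σ : Store) (p : Fin n → ℚ) : Prop :=
  ∀ s : Fin n, 0 < σ 6 (s : ℕ) ∧ p s = (σ 5 (s : ℕ) : ℚ) / (σ 6 (s : ℕ) : ℚ)

/-- The independence oracles of two matroids on `{0, …, n - 1}`. -/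
def indepOracle {n : ℕ} (M₁ M₂ : Matroid (Fin n)) (j : Fin 2) (X : Finset (Fin n)) : Prop :=
  if j = 0 then M₁.Indep (X : Set (Fin n)) else M₂.Indep (X : Set (Fin n))

end OracleRAM

namespace Pricing

/-! ### Exchange properties of independent sets -/

section Exchange

variable {α : Type*} [DecidableEq α] {M : Matroid α}

/-! Let `mate` swap the elements of each two-element class of `M₁` and fix all other elements. An
element of a one-element class must go to the first buyer, so the feasible bundles `X` of the second
buyer are the bases of `M₂` that contain exactly one element of each pair and nothing else. The
welfare is a constant plus `W(X)` with `W = w₂ - w₁`, so this is a weighted matroid intersection. An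
optimum is certified by a weight splitting (`Extreme`): a potential `u` for which `X` is locally
optimal in `M₂`, while in each pair `X` takes an element that maximizes `W - u`. `Extreme.sum_le`
turns such a certificate into optimality.

A splitting alone gives prices with ties. The ties are broken by solving twice and aiming the two
buyers at possibly different optima. Let `T` be optimal for `W`, and let `Y`, with splitting
potential `u`, be optimal for `N * W` plus a bonus of `1` on every element outside `T`; for large
`N` the set `Y` is still optimal for `W`. If `t` lies in both `T` and `Y`, its mate has the bonus
and `t` does not, so the pair inequality at `t` has slack `1` with respect to `N * W`. Now take the
potential `2u` on `Y`, `2u - 1` on paired elements outside `T` and `Y`, `2u - c` on `T \ Y`, and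
`-c` on the one-element classes, with `c` huge. It makes `Y` the unique best base of `M₂`, whereas
the first buyer strictly prefers `mate t` to `t` for every `t ∈ T` and hence takes the complement of
`T`. The prices are `w₂` minus this potential divided by `2 * N` (`isPriceVector_of_extreme`).

Splittings are built pair by pair. The new pair gets potentials so low that no exchange condition is
violated (`Extreme.ready`). Then a search in the manner of Dijkstra starts from its two elements; an
arc from `y` to `z` means that `y` may replace `mate z`, after which `z` has to enter. If a feasible
transversal exists, the completed search reaches an element that can be added to the current set
(`Tree.exists_terminal`). Raising the potentials by truncated distances and exchanging along a
shortest path gives the next splitting (`extreme_augmented`). Preferring the earliest predecessor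
among ties makes the exchanges triangular, which yields independence (`indep_union_of_triangular`).

The algorithm clears denominators by `D`; by integrality `N = (n + 1) * D` is large enough. Each
stage multiplies the bound on the potentials by at most `8 * n + 16`, so all numbers have
polynomially many bits (`bound_le`). Every loop runs at most `n` times, so the time is a polynomial
in `n` times the bit length of the largest number (`pricing_spec`). -/

lemma mem_closure_sdiff {X B : Finset α} (hX : M.Indep (X : Set α)) (hB : B ⊆ X) {y : α}
    (hy : y ∈ M.closure X) (h : ∀ x ∈ B, y ∈ M.closure (X.erase x : Finset α)) :
    y ∈ M.closure (X \ B : Finset α) := by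
  induction B using Finset.induction_on with
  | empty => simpa using hy
  | insert b B hb ih =>
    have h1 := ih (fun z hz => hB (Finset.mem_insert_of_mem hz))
      (fun x hx => h x (Finset.mem_insert_of_mem hx))
    have h2 := h b (Finset.mem_insert_self _ _)
    -- Within an independent set closures commute with intersections, so `b` can be deleted along
    -- with the elements deleted before.
    have hI : M.Indep (((X \ B : Finset α) : Set α) ∪ ((X.erase b : Finset α) : Set α)) :=
      hX.subset (by
        rw [← Finset.coe_union, Finset.coe_subset]
        exact Finset.union_subset Finset.sdiff_subset (Finset.erase_subset _ _))
    have h3 : y ∈ M.closure (((X \ B : Finset α) : Set α) ∩ ((X.erase b : Finset α) : Set α)) := by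
      rw [hI.closure_inter_eq_inter_closure]
      exact ⟨h1, h2⟩
    rw [← Finset.coe_inter] at h3
    convert h3 using 2
    congr 1
    ext z
    simp only [Finset.mem_sdiff, Finset.mem_insert, Finset.mem_inter, Finset.mem_erase]
    tauto

lemma notMem_closure_of_indep_insert {X : Finset α} {y : α} (hy : y ∉ X)
    (h : M.Indep (insert y X : Finset α)) : y ∉ M.closure (X : Set α) := by
  rw [Finset.coe_insert] at h
  have hX : M.Indep (X : Set α) := h.subset (Set.subset_insert _ _)
  have := (hX.insert_indep_iff_of_notMem (e := y) (by simpa using hy)).1 h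
  exact this.2

lemma indep_insert_of_notMem_closure (hE : M.E = Set.univ) {X : Finset α} {y : α}
    (hX : M.Indep (X : Set α)) (h : y ∉ M.closure (X : Set α)) :
    M.Indep (insert y X : Finset α) := by
  rw [Finset.coe_insert]
  exact hX.insert_indep_iff.2 (Or.inl ⟨by simp [hE], h⟩)

lemma mem_closure_of_not_indep_insert (hE : M.E = Set.univ) {X : Finset α} {y : α}
    (hX : M.Indep (X : Set α)) (h : ¬ M.Indep (insert y X : Finset α)) :
    y ∈ M.closure (X : Set α) := by
  by_contra hc
  exact h (indep_insert_of_notMem_closure hE hX hc)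

/-- Symmetric exchange between independent sets of the same size. -/
lemma exists_symmetric_exchange (hE : M.E = Set.univ) {X Y : Finset α}
    (hX : M.Indep (X : Set α)) (hY : M.Indep (Y : Set α)) (hc : X.card = Y.card) {y : α}
    (hyY : y ∈ Y) (hyX : y ∉ X) :
    ∃ x ∈ X, x ∉ Y ∧ M.Indep (insert y (X.erase x) : Finset α) ∧
      M.Indep (insert x (Y.erase y) : Finset α) := by
  classical
  have hY' : M.Indep (Y.erase y : Finset α) := hY.subset (by simp)
  by_cases hy : y ∈ M.closure (X : Set α)
  -- `B` consists of the elements that `y` cannot replace. Deleting all of them keeps `y` in the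
  -- closure, so `X \ B` cannot lie in the closure of `Y` without `y`, and any witness of this is
  -- exchangeable on both sides.
  · set B := X.filter fun x => ¬ M.Indep (insert y (X.erase x) : Finset α) with hB
    have hsub : ∀ x, M.Indep (X.erase x : Finset α) := fun x =>
      hX.subset (by simp)
    have h1 : y ∈ M.closure (X \ B : Finset α) := by
      refine mem_closure_sdiff hX (Finset.filter_subset _ _) hy fun x hx => ?_
      exact mem_closure_of_not_indep_insert hE (hsub x) (Finset.mem_filter.1 hx).2
    have h2 : ∃ x ∈ X \ B, x ∉ M.closure (Y.erase y : Finset α) := by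
      by_contra! hcon
      have h3 : M.closure (X \ B : Finset α) ⊆ M.closure (Y.erase y : Finset α) :=
        M.closure_subset_closure_of_subset_closure fun x hx => hcon x hx
      refine notMem_closure_of_indep_insert (M := M) (Finset.notMem_erase y Y) ?_ (h3 h1)
      rwa [Finset.insert_erase hyY]
    obtain ⟨x, hx, hxc⟩ := h2
    simp only [hB, Finset.mem_sdiff, Finset.mem_filter, not_and, not_not] at hx
    refine ⟨x, hx.1, fun hxY => hxc ?_, hx.2 hx.1, indep_insert_of_notMem_closure hE hY' hxc⟩
    refine M.mem_closure_of_mem (Finset.mem_coe.2 (Finset.mem_erase.2 ⟨?_, hxY⟩)) (by simp [hE])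
    rintro rfl
    exact hyX hx.1
  -- Here `X` together with `y` is independent, so every element of `X` that augments `Y` without
  -- `y` will do.
  · obtain ⟨x, hxX, hxY, hx⟩ := hY'.augment_finset hX (by
      rw [Finset.card_erase_of_mem hyY, hc]
      have := Finset.card_pos.2 ⟨y, hyY⟩
      omega)
    have hxy : x ≠ y := by rintro rfl; exact hyX hxX
    refine ⟨x, hxX, fun h => hxY (Finset.mem_erase.2 ⟨hxy, h⟩), ?_, ?_⟩
    · refine (indep_insert_of_notMem_closure hE hX hy).subset ?_
      simp only [Finset.coe_subset]
      exact Finset.insert_subset_insert _ (Finset.erase_subset _ _)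
    · simpa using hx

lemma sum_insert_erase {R : Type*} [CommRing R] {Y : Finset α} {x y : α} (hy : y ∈ Y)
    (hx : x ∉ Y) (u : α → R) :
    ∑ e ∈ insert x (Y.erase y), u e = ∑ e ∈ Y, u e - u y + u x := by
  rw [Finset.sum_insert (fun h => hx (Finset.mem_of_mem_erase h)),
    ← Finset.add_sum_erase Y u hy]
  ring

variable {R : Type*} [CommRing R] [LinearOrder R] [IsStrictOrderedRing R]

/-- A locally optimal independent set is optimal among independent sets of its size. -/
lemma sum_le_of_locally_optimal (hE : M.E = Set.univ) {X : Finset α} (hX : M.Indep (X : Set α))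
    {u : α → R} (k : ℕ) : ∀ Y : Finset α, (Y \ X).card = k → M.Indep (Y : Set α) →
    X.card = Y.card →
    (∀ x ∈ X, ∀ y ∈ Y, y ∉ X → M.Indep (insert y (X.erase x) : Finset α) → u y ≤ u x) →
    ∑ e ∈ Y, u e ≤ ∑ e ∈ X, u e := by
  induction k with
  | zero =>
    intro Y hk hY hc _
    have h1 : Y ⊆ X := by
      rwa [Finset.card_eq_zero, Finset.sdiff_eq_empty_iff_subset] at hk
    rw [Finset.eq_of_subset_of_card_le h1 hc.le]
  | succ k ih =>
    intro Y hk hY hc hloc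
    obtain ⟨y, hy⟩ := Finset.card_pos.1 (by rw [hk]; omega : 0 < (Y \ X).card)
    obtain ⟨hyY, hyX⟩ := Finset.mem_sdiff.1 hy
    -- Trading `y` for `x` brings `Y` closer to `X` without lowering its weight. The hypothesis
    -- `hloc` passes to the new set because its only new element belongs to `X`.
    obtain ⟨x, hxX, hxY, h1, h2⟩ := exists_symmetric_exchange hE hX hY hc hyY hyX
    have hle := hloc x hxX y hyY hyX h1
    have hxe : x ∉ Y.erase y := fun h => hxY (Finset.mem_of_mem_erase h)
    have hcard : (insert x (Y.erase y)).card = Y.card := by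
      rw [Finset.card_insert_of_notMem hxe, Finset.card_erase_of_mem hyY]
      have := Finset.card_pos.2 ⟨y, hyY⟩
      omega
    have hsd : insert x (Y.erase y) \ X = (Y \ X).erase y := by
      ext z
      simp only [Finset.mem_sdiff, Finset.mem_insert, Finset.mem_erase]
      constructor
      · rintro ⟨rfl | h, h'⟩
        · exact absurd hxX h'
        · exact ⟨h.1, h.2, h'⟩
      · rintro ⟨h, h', h''⟩
        exact ⟨Or.inr ⟨h, h'⟩, h''⟩
    have := ih (insert x (Y.erase y)) (by rw [hsd, Finset.card_erase_of_mem hy, hk]; rfl) h2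
      (by rw [hcard, hc]) (by
        intro x' hx' y' hy' hy'X hI
        rcases Finset.mem_insert.1 hy' with rfl | h
        · exact absurd hxX hy'X
        · exact hloc x' hx' y' (Finset.mem_of_mem_erase h) hy'X hI)
    rw [sum_insert_erase hyY hxY] at this
    linarith

/-- One exchange strictly improves `Y`, and the weak version bounds the improved set by `X`. This
gives uniqueness of the second buyer's favourite bundle. -/
lemma sum_lt_of_strictly_locally_optimal (hE : M.E = Set.univ) {X Y : Finset α}
    (hX : M.Indep (X : Set α)) (hY : M.Indep (Y : Set α)) (hc : X.card = Y.card) (hne : Y ≠ X)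
    {u : α → R}
    (hloc : ∀ x ∈ X, ∀ y, y ∉ X → M.Indep (insert y (X.erase x) : Finset α) → u y < u x) :
    ∑ e ∈ Y, u e < ∑ e ∈ X, u e := by
  have : ∃ y ∈ Y, y ∉ X := by
    by_contra! h
    exact hne (Finset.eq_of_subset_of_card_le h hc.le)
  obtain ⟨y, hyY, hyX⟩ := this
  obtain ⟨x, hxX, hxY, h1, h2⟩ := exists_symmetric_exchange hE hX hY hc hyY hyX
  have hlt := hloc x hxX y hyX h1
  have hcard : (insert x (Y.erase y)).card = Y.card := by
    rw [Finset.card_insert_of_notMem fun h => hxY (Finset.mem_of_mem_erase h),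
      Finset.card_erase_of_mem hyY]
    have := Finset.card_pos.2 ⟨y, hyY⟩
    omega
  have := sum_le_of_locally_optimal hE hX (u := u) _ (insert x (Y.erase y)) rfl h2
    (by rw [hcard, hc]) fun x' hx' y' _ hy' hI => (hloc x' hx' y' hy' hI).le
  rw [sum_insert_erase hyY hxY] at this
  linarith

/-- Simultaneous exchange along a triangular system. -/
lemma indep_union_of_triangular (hE : M.E = Set.univ) {ι β : Type*} [LinearOrder β]
    {X₀ : Finset α} (hX₀ : M.Indep (X₀ : Set α)) {A : ι → Finset α} {y : ι → α} {f : ι → β}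
    (I : Finset ι) (hA : ∀ i ∈ I, X₀ ⊆ A i)
    (hy : ∀ i ∈ I, y i ∉ M.closure (A i : Set α))
    (hf : ∀ i ∈ I, ∀ j ∈ I, i ≠ j → f i = f j → False)
    (htri : ∀ i ∈ I, ∀ l ∈ I, f i < f l → y l ∈ M.closure (A i : Set α)) :
    M.Indep (X₀ ∪ I.image y : Finset α) := by
  induction hk : I.card generalizing I with
  | zero =>
    rw [Finset.card_eq_zero] at hk
    subst hk
    simpa using hX₀
  | succ k ih =>
    classical
    -- The index with the smallest `f` is inserted last: everything inserted before lies in the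
    -- closure of `A i`, but `y i` does not.
    obtain ⟨i, hi, hmin⟩ := I.exists_min_image f (Finset.card_pos.1 (by omega))
    have h1 := ih (I.erase i) (fun j hj => hA j (Finset.mem_of_mem_erase hj))
      (fun j hj => hy j (Finset.mem_of_mem_erase hj))
      (fun j hj l hl => hf j (Finset.mem_of_mem_erase hj) l (Finset.mem_of_mem_erase hl))
      (fun j hj l hl => htri j (Finset.mem_of_mem_erase hj) l (Finset.mem_of_mem_erase hl))
      (by rw [Finset.card_erase_of_mem hi, hk]; rfl)
    have h2 : M.closure (X₀ ∪ (I.erase i).image y : Finset α) ⊆ M.closure (A i : Set α) := by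
      refine M.closure_subset_closure_of_subset_closure fun z hz => ?_
      rcases Finset.mem_union.1 (Finset.mem_coe.1 hz) with h | h
      · exact M.mem_closure_of_mem (Finset.mem_coe.2 (hA i hi h)) (by simp [hE])
      · obtain ⟨l, hl, rfl⟩ := Finset.mem_image.1 h
        have hl' := Finset.mem_erase.1 hl
        refine htri i hi l hl'.2 (lt_of_le_of_ne (hmin l hl'.2) fun h => ?_)
        exact hf i hi l hl'.2 (Ne.symm hl'.1) h
    have h3 := indep_insert_of_notMem_closure hE h1 fun h => hy i hi (h2 h)
    rwa [← Finset.union_insert, ← Finset.image_insert, Finset.insert_erase hi] at h3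

end Exchange

end Pricing

namespace Pricing

/-! ### Optimal transversals of a family of pairs and weight splittings -/

section Search

variable {α : Type*} [DecidableEq α] {R : Type*} [CommRing R] [LinearOrder R]

/-- `X` is an independent set of `M` containing exactly one element of each pair `{e, mate e}` in
`G`, and `u`, `W - u` is a weight splitting that certifies its optimality. -/
structure Extreme (M : Matroid α) (mate : α → α) (W u : α → R) (G X : Finset α) : Prop where
  mate_mem : ∀ e ∈ G, mate e ∈ G
  mate_ne : ∀ e ∈ G, mate e ≠ e
  sub : X ⊆ G
  trans : ∀ e ∈ G, (e ∈ X ↔ mate e ∉ X)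
  indep : M.Indep (X : Set α)
  exch : ∀ x ∈ X, ∀ y ∈ G, y ∉ X → M.Indep (insert y (X.erase x) : Finset α) → u y ≤ u x
  pair : ∀ x ∈ X, u x - u (mate x) ≤ W x - W (mate x)

/-- The same as `Extreme`, except that the pair `{a, mate a}` is not covered yet. -/
structure Ready (M : Matroid α) (mate : α → α) (W u : α → R) (G X : Finset α) (a : α) :
    Prop where
  a_mem : a ∈ G
  mate_mem : ∀ e ∈ G, mate e ∈ G
  mate_ne : ∀ e ∈ G, mate e ≠ e
  sub : X ⊆ G
  a_notMem : a ∉ X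
  b_notMem : mate a ∉ X
  trans : ∀ e ∈ G, e ≠ a → e ≠ mate a → (e ∈ X ↔ mate e ∉ X)
  indep : M.Indep (X : Set α)
  exch : ∀ x ∈ X, ∀ y ∈ G, y ∉ X → M.Indep (insert y (X.erase x) : Finset α) → u y ≤ u x
  pair : ∀ x ∈ X, u x - u (mate x) ≤ W x - W (mate x)
  source : u a - W a = u (mate a) - W (mate a)

/-- `y` may enter in place of `mate z`, whereupon `z` has to enter as well. -/
def Arc (M : Matroid α) (mate : α → α) (X : Finset α) (y z : α) : Prop :=
  mate z ∈ X ∧ M.Indep (insert y (X.erase (mate z)) : Finset α)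

/-- The reduced length of an arc. -/
def len (mate : α → α) (W u : α → R) (y z : α) : R := u z - u y + W (mate z) - W z

/-- A partial shortest path tree rooted at the pair `{a, mate a}`; the nodes are listed by `L` in
the order of their distances `dl`, and `pr` is the first possible predecessor. -/
structure Tree (M : Matroid α) (mate : α → α) (W u : α → R) (G X : Finset α) (a : α)
    (L : ℕ → α) (dl : ℕ → R) (pr : ℕ → ℕ) (cnt : ℕ) : Prop where
  two_le : 2 ≤ cnt
  L_zero : L 0 = a
  L_one : L 1 = mate a
  dl_zero : dl 0 = 0
  dl_one : dl 1 = 0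
  inj : ∀ j < cnt, ∀ k < cnt, L j = L k → j = k
  mem : ∀ k < cnt, L k ∈ G ∧ L k ∉ X
  pr_lt : ∀ k, 2 ≤ k → k < cnt → pr k < k
  pr_arc : ∀ k, 2 ≤ k → k < cnt → Arc M mate X (L (pr k)) (L k)
  pr_eq : ∀ k, 2 ≤ k → k < cnt → dl k = dl (pr k) + len mate W u (L (pr k)) (L k)
  le : ∀ k < cnt, ∀ j < k, ∀ z ∈ G, z ∉ X → (∀ i < k, L i ≠ z) → Arc M mate X (L j) z →
    dl k ≤ dl j + len mate W u (L j) z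
  first : ∀ k, 2 ≤ k → k < cnt → ∀ j < pr k, Arc M mate X (L j) (L k) →
    dl k < dl j + len mate W u (L j) (L k)

/-- No arc leaves the tree. -/
def Closed (M : Matroid α) (mate : α → α) (G X : Finset α) (L : ℕ → α) (cnt : ℕ) : Prop :=
  ∀ j < cnt, ∀ z ∈ G, z ∉ X → Arc M mate X (L j) z → ∃ k < cnt, L k = z

variable {M : Matroid α} {mate : α → α} {W u : α → R} {G X : Finset α} {a : α}
  {L : ℕ → α} {dl : ℕ → R} {pr : ℕ → ℕ} {cnt : ℕ}

/-- One step of Dijkstra's algorithm. The hypothesis `hfirst` records the tie-breaking in favour of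
the earliest predecessor, on which the independence of the augmented set depends. -/
lemma Tree.step (hT : Tree M mate W u G X a L dl pr cnt)
    {j : ℕ} {z : α} (hj : j < cnt) (hzG : z ∈ G) (hzX : z ∉ X) (hz : ∀ i < cnt, L i ≠ z)
    (harc : Arc M mate X (L j) z)
    (hmin : ∀ j' < cnt, ∀ z' ∈ G, z' ∉ X → (∀ i < cnt, L i ≠ z') → Arc M mate X (L j') z' →
      dl j + len mate W u (L j) z ≤ dl j' + len mate W u (L j') z')
    (hfirst : ∀ j' < j, Arc M mate X (L j') z →
      dl j + len mate W u (L j) z < dl j' + len mate W u (L j') z) :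
    Tree M mate W u G X a (Function.update L cnt z)
      (Function.update dl cnt (dl j + len mate W u (L j) z)) (Function.update pr cnt j)
      (cnt + 1) := by
  have h2 := hT.two_le
  have hL : ∀ i, i ≠ cnt → Function.update L cnt z i = L i := fun i hi => by simp [hi]
  have hd : ∀ i, i ≠ cnt →
      Function.update dl cnt (dl j + len mate W u (L j) z) i = dl i := fun i hi => by simp [hi]
  have hp : ∀ i, i ≠ cnt → Function.update pr cnt j i = pr i := fun i hi => by simp [hi]
  refine ⟨by omega, ?_, ?_, ?_, ?_, ?_, ?_, ?_, ?_, ?_, ?_, ?_⟩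
  · rw [hL _ (by omega), hT.L_zero]
  · rw [hL _ (by omega), hT.L_one]
  · rw [hd _ (by omega), hT.dl_zero]
  · rw [hd _ (by omega), hT.dl_one]
  · intro i hi k hk h
    rcases Nat.lt_succ_iff_lt_or_eq.1 hi with hi | rfl <;>
      rcases Nat.lt_succ_iff_lt_or_eq.1 hk with hk | rfl
    · rw [hL _ hi.ne, hL _ hk.ne] at h
      exact hT.inj i hi k hk h
    · rw [hL _ hi.ne, Function.update_self] at h
      exact absurd h (hz i hi)
    · rw [hL _ hk.ne, Function.update_self] at h
      exact absurd h.symm (hz k hk)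
    · rfl
  · intro k hk
    rcases Nat.lt_succ_iff_lt_or_eq.1 hk with hk | rfl
    · rw [hL _ hk.ne]; exact hT.mem k hk
    · rw [Function.update_self]; exact ⟨hzG, hzX⟩
  · intro k hk2 hk
    rcases Nat.lt_succ_iff_lt_or_eq.1 hk with hk | rfl
    · rw [hp _ hk.ne]; exact hT.pr_lt k hk2 hk
    · rw [Function.update_self]; exact hj
  · intro k hk2 hk
    rcases Nat.lt_succ_iff_lt_or_eq.1 hk with hk | rfl
    · have := hT.pr_lt k hk2 hk
      rw [hp _ hk.ne, hL _ hk.ne, hL _ (by omega)]; exact hT.pr_arc k hk2 hk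
    · rw [Function.update_self, Function.update_self, hL _ hj.ne]; exact harc
  · intro k hk2 hk
    rcases Nat.lt_succ_iff_lt_or_eq.1 hk with hk | rfl
    · have := hT.pr_lt k hk2 hk
      rw [hp _ hk.ne, hL _ hk.ne, hL _ (by omega), hd _ hk.ne, hd _ (by omega)]
      exact hT.pr_eq k hk2 hk
    · rw [Function.update_self, Function.update_self, Function.update_self, hL _ hj.ne,
        hd _ hj.ne]
  · intro k hk i hi y hyG hyX hy ha
    rcases Nat.lt_succ_iff_lt_or_eq.1 hk with hk | rfl
    · rw [hL _ (by omega)] at ha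
      rw [hd _ hk.ne, hd _ (by omega), hL _ (by omega)]
      refine hT.le k hk i hi y hyG hyX (fun l hl => ?_) ha
      rw [← hL l (by omega)]
      exact hy l hl
    · rw [hL _ hi.ne] at ha
      rw [Function.update_self, hd _ hi.ne, hL _ hi.ne]
      refine hmin i hi y hyG hyX (fun l hl => ?_) ha
      rw [← hL l hl.ne]
      exact hy l hl
  · intro k hk2 hk i hi ha
    rcases Nat.lt_succ_iff_lt_or_eq.1 hk with hk | rfl
    · have := hT.pr_lt k hk2 hk
      rw [hp _ hk.ne] at hi
      rw [hL _ hk.ne, hL _ (by omega)] at ha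
      rw [hL _ hk.ne, hL _ (by omega), hd _ hk.ne, hd _ (by omega)]
      exact hT.first k hk2 hk i hi ha
    · rw [Function.update_self] at hi
      rw [Function.update_self, hL _ (by omega)] at ha
      rw [Function.update_self, Function.update_self, hL _ (by omega), hd _ (by omega)]
      exact hfirst i hi ha

lemma Tree.two_le_of_mate_mem (hR : Ready M mate W u G X a) (hm : Function.Involutive mate)
    (hT : Tree M mate W u G X a L dl pr cnt) {k : ℕ} (h : mate (L k) ∈ X) : 2 ≤ k := by
  by_contra hlt
  have : k = 0 ∨ k = 1 := by omega
  rcases this with rfl | rfl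
  · rw [hT.L_zero] at h
    exact hR.b_notMem h
  · rw [hT.L_one, hm a] at h
    exact hR.a_notMem h

/-- If the uncovered pair can be covered at all, then a closed tree reaches an element that can be
added to `X`. -/
lemma Tree.exists_terminal (hE : M.E = Set.univ) (hR : Ready M mate W u G X a)
    (hm : Function.Involutive mate) (hT : Tree M mate W u G X a L dl pr cnt)
    (hC : Closed M mate G X L cnt) {T : Finset α} (hTI : M.Indep (T : Set α))
    (hTt : ∀ e ∈ G, (e ∈ T ↔ mate e ∉ T)) :
    ∃ k < cnt, M.Indep (insert (L k) X : Finset α) := by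
  by_contra! hcon
  have h2 := hT.two_le
  set N := (Finset.range cnt).image L with hN
  have hLN : ∀ k < cnt, L k ∈ N := fun k hk => Finset.mem_image.2 ⟨k, Finset.mem_range.2 hk, rfl⟩
  have haN : a ∈ N := by rw [← hT.L_zero]; exact hLN 0 (by omega)
  have hbN : mate a ∈ N := by rw [← hT.L_one]; exact hLN 1 (by omega)
  set Q := X.filter fun x => mate x ∈ N with hQ
  have hQX : Q ⊆ X := Finset.filter_subset _ _
  have hQI : M.Indep (Q : Set α) := hR.indep.subset (by simpa using hQX)
  -- No arc leaves the tree, so a node can replace no element of `X \ Q`. All these elements can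
  -- therefore be deleted from `X` while the node stays in the closure.
  have hcl : ∀ y ∈ N, y ∈ M.closure (Q : Set α) := by
    intro y hy
    obtain ⟨k, hk, rfl⟩ := Finset.mem_image.1 hy
    rw [Finset.mem_range] at hk
    have h1 : L k ∈ M.closure (X \ (X \ Q) : Finset α) := by
      refine mem_closure_sdiff hR.indep Finset.sdiff_subset
        (mem_closure_of_not_indep_insert hE hR.indep (hcon k hk)) fun x hx => ?_
      have hx' := Finset.mem_sdiff.1 hx
      by_contra hx2
      have hxI := indep_insert_of_notMem_closure hE
        (hR.indep.subset (by simp : ((X.erase x : Finset α) : Set α) ⊆ X)) hx2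
      have hxG : x ∈ G := hR.sub hx'.1
      have hmx : mate x ∉ X := by
        refine (hR.trans x hxG ?_ ?_).1 hx'.1
        · rintro rfl; exact hR.a_notMem hx'.1
        · rintro rfl; exact hR.b_notMem hx'.1
      obtain ⟨k', hk', hk'x⟩ := hC k hk (mate x) (hR.mate_mem x hxG) hmx
        ⟨by rw [hm x]; exact hx'.1, by rw [hm x]; exact hxI⟩
      exact hx'.2 (Finset.mem_filter.2 ⟨hx'.1, hk'x ▸ hLN k' hk'⟩)
    rwa [Finset.sdiff_sdiff_eq_self hQX] at h1
  have hle : (T ∩ (N ∪ Q)).card ≤ Q.card := by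
    by_contra! hlt
    obtain ⟨x, hxT, hxQ, hxI⟩ := hQI.augment_finset
      (hTI.subset (by simp) : M.Indep ((T ∩ (N ∪ Q) : Finset α) : Set α)) hlt
    rw [← Finset.coe_insert] at hxI
    have hxN : x ∈ N := by
      rcases Finset.mem_union.1 (Finset.mem_inter.1 hxT).2 with h | h
      · exact h
      · exact absurd h hxQ
    exact notMem_closure_of_indep_insert hxQ hxI (hcl x hxN)
  have haQ : a ∉ Q := fun h => hR.a_notMem (hQX h)
  -- The pair of `a` and the pairs of the elements of `Q` all lie in `N ∪ Q`. They are disjoint and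
  -- `T` meets each of them, so `T` has more elements there than the spanning set `Q` allows.
  have hge : (insert a Q).card ≤ (T ∩ (N ∪ Q)).card := by
    have hG : ∀ e ∈ insert a Q, e ∈ G := by
      intro e he
      rcases Finset.mem_insert.1 he with rfl | he
      · exact hR.a_mem
      · exact hR.sub (hQX he)
    have hno : ∀ e ∈ insert a Q, mate e ∉ insert a Q := by
      intro e he hme
      rcases Finset.mem_insert.1 he with rfl | he
      · rcases Finset.mem_insert.1 hme with h | h
        · exact hR.mate_ne _ hR.a_mem h
        · exact hR.b_notMem (hQX h)
      · rcases Finset.mem_insert.1 hme with h | h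
        · refine hR.b_notMem ?_
          rw [← h, hm e]
          exact hQX he
        · have heG := hR.sub (hQX he)
          exact (hR.trans e heG (fun h' => hR.a_notMem (h' ▸ hQX he))
            (fun h' => hR.b_notMem (h' ▸ hQX he))).1 (hQX he) (hQX h)
    refine Finset.card_le_card_of_injOn (fun e => if e ∈ T then e else mate e) ?_ ?_
    · intro e he
      have heG := hG e he
      have hT' := hTt e heG
      simp only [Finset.coe_inter, Finset.coe_union, Set.mem_inter_iff, Set.mem_union,
        Finset.mem_coe]
      rcases Finset.mem_insert.1 he with rfl | he
      · split_ifs with h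
        · exact ⟨h, Or.inl haN⟩
        · exact ⟨by tauto, Or.inl hbN⟩
      · split_ifs with h
        · exact ⟨h, Or.inr he⟩
        · exact ⟨by tauto, Or.inl (Finset.mem_filter.1 he).2⟩
    · intro e he e' he' h
      have h1 := hno e he
      have h2 := hno e' he'
      simp only at h
      split_ifs at h with h3 h4 h4
      · exact h
      · exact absurd (h ▸ he) h2
      · rw [h] at h1
        exact absurd he' h1
      · exact hm.injective h
  rw [Finset.card_insert_of_notMem haQ] at hge
  omega

variable [IsStrictOrderedRing R]

/-- The length is the sum of two nonnegative terms: the loss `u (mate z) - u y` of the exchange and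
the slack of the pair inequality at `mate z`. -/
lemma Ready.len_nonneg (hR : Ready M mate W u G X a) (hm : Function.Involutive mate) {y z : α}
    (hy : y ∈ G) (hyX : y ∉ X) (h : Arc M mate X y z) : 0 ≤ len mate W u y z := by
  have h1 := hR.exch _ h.1 y hy hyX h.2
  have h2 := hR.pair _ h.1
  rw [hm z] at h2
  unfold len
  linarith

lemma Ready.tree (hR : Ready M mate W u G X a) (hm : Function.Involutive mate)
    (hL0 : L 0 = a) (hL1 : L 1 = mate a) (hd0 : dl 0 = 0) (hd1 : dl 1 = 0) :
    Tree M mate W u G X a L dl pr 2 where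
  two_le := le_rfl
  L_zero := hL0
  L_one := hL1
  dl_zero := hd0
  dl_one := hd1
  inj := by
    have := hR.mate_ne a hR.a_mem
    intro j hj k hk h
    interval_cases j <;> interval_cases k
    · rfl
    · rw [hL0, hL1] at h
      exact absurd h.symm this
    · rw [hL0, hL1] at h
      exact absurd h this
    · rfl
  mem := by
    intro k hk
    interval_cases k
    · rw [hL0]; exact ⟨hR.a_mem, hR.a_notMem⟩
    · rw [hL1]; exact ⟨hR.mate_mem a hR.a_mem, hR.b_notMem⟩
  pr_lt := by intro k h1 h2; omega
  pr_arc := by intro k h1 h2; omega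
  pr_eq := by intro k h1 h2; omega
  le := by
    intro k hk j hj z _ _ _ harc
    have hj0 : j = 0 := by omega
    have hk1 : k = 1 := by omega
    subst hj0 hk1
    rw [hL0] at harc ⊢
    have := hR.len_nonneg hm hR.a_mem hR.a_notMem harc
    rw [hd0, hd1]
    linarith
  first := by intro k h1 h2; omega

/-- If a node is entered from its immediate predecessor in the list, the length of the arc is
nonnegative; if it is entered from an earlier node, the same arc was already available when that
predecessor was chosen as nearest. -/
lemma Tree.dl_mono (hR : Ready M mate W u G X a) (hm : Function.Involutive mate)
    (hT : Tree M mate W u G X a L dl pr cnt) {j k : ℕ} (hjk : j ≤ k) (hk : k < cnt) :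
    dl j ≤ dl k := by
  induction k, hjk using Nat.le_induction with
  | base => exact le_rfl
  | succ k hjk ih =>
    refine (ih (by omega)).trans ?_
    rcases Nat.eq_zero_or_pos k with rfl | hk0
    · rw [hT.dl_zero, zero_add, hT.dl_one]
    · have hp := hT.pr_lt (k + 1) (by omega) hk
      have ha := hT.pr_arc (k + 1) (by omega) hk
      rw [hT.pr_eq (k + 1) (by omega) hk]
      rcases Nat.lt_succ_iff_lt_or_eq.1 hp with hp | hp
      · refine hT.le k (by omega) _ hp _ (hT.mem _ hk).1 (hT.mem _ hk).2 (fun i hi h => ?_) ha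
        have := hT.inj i (by omega) (k + 1) hk h
        omega
      · rw [hp] at ha ⊢
        have := hR.len_nonneg hm (hT.mem k (by omega)).1 (hT.mem k (by omega)).2 ha
        linarith

/-- Forward arcs obey the triangle inequality by the choice of the nearest node, backward arcs
because distances are monotone and lengths nonnegative. -/
lemma Tree.dl_le (hR : Ready M mate W u G X a) (hm : Function.Involutive mate)
    (hT : Tree M mate W u G X a L dl pr cnt) {j k : ℕ} (hj : j < cnt) (hk : k < cnt)
    (ha : Arc M mate X (L j) (L k)) : dl k ≤ dl j + len mate W u (L j) (L k) := by
  rcases lt_or_ge j k with h | h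
  · refine hT.le k hk j h _ (hT.mem k hk).1 (hT.mem k hk).2 (fun i hi h => ?_) ha
    have := hT.inj i (by omega) k hk h
    omega
  · have h1 := hT.dl_mono hR hm h hj
    have h2 := hR.len_nonneg hm (hT.mem j hj).1 (hT.mem j hj).2 ha
    linarith

end Search

end Pricing

namespace Pricing

/-! ### Augmentation along a shortest path and the raised potential -/

section Augment

variable {α : Type*} [DecidableEq α] {R : Type*} [CommRing R] [LinearOrder R]

/-- `u'` arises from `u` by raising the potentials within distance `K` of the root. -/
structure Raised (mate : α → α) (W u : α → R) (G : Finset α) (L : ℕ → α) (dl : ℕ → R) (cnt : ℕ)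
    (K : R) (u' : α → R) : Prop where
  node : ∀ k < cnt, u' (L k) = u (L k) + max (K - dl k) 0
  partner : ∀ k, 2 ≤ k → k < cnt → u' (mate (L k)) =
    u (mate (L k)) + max (K - dl k + (W (mate (L k)) - W (L k) - u (mate (L k)) + u (L k))) 0
  rest : ∀ e ∈ G, (∀ k < cnt, L k ≠ e) → (∀ k, 2 ≤ k → k < cnt → mate (L k) ≠ e) → u' e = u e

/-- `k₀` is the first node that minimizes `dl k - u (L k)` among the nodes that can be added. -/
structure Best (M : Matroid α) (u : α → R) (X : Finset α) (L : ℕ → α) (dl : ℕ → R) (cnt k₀ : ℕ) :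
    Prop where
  lt : k₀ < cnt
  indep : M.Indep (insert (L k₀) X : Finset α)
  le : ∀ k < cnt, M.Indep (insert (L k) X : Finset α) → dl k₀ - u (L k₀) ≤ dl k - u (L k)
  first : ∀ k < k₀, M.Indep (insert (L k) X : Finset α) → dl k₀ - u (L k₀) < dl k - u (L k)

/-- `q 0 = k₀, q 1, …, q m` is the path in the tree from `k₀` back to the root. -/
structure BackPath (pr : ℕ → ℕ) (k₀ : ℕ) (q : ℕ → ℕ) (m : ℕ) : Prop where
  start : q 0 = k₀
  two_le : ∀ j < m, 2 ≤ q j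
  step : ∀ j < m, q (j + 1) = pr (q j)
  last : q m < 2

/-- Exchange along a path. -/
def augmented (mate : α → α) (X : Finset α) (L : ℕ → α) (q : ℕ → ℕ) (m : ℕ) : Finset α :=
  (X \ (Finset.range m).image fun j => mate (L (q j))) ∪
    (Finset.range (m + 1)).image fun j => L (q j)

variable {M : Matroid α} {mate : α → α} {W u : α → R} {G X : Finset α} {a : α}
  {L : ℕ → α} {dl : ℕ → R} {pr : ℕ → ℕ} {cnt : ℕ} {k₀ : ℕ} {q : ℕ → ℕ} {m : ℕ} {K Λ : R}
  {u' : α → R}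

lemma Ready.mate_notMem (hR : Ready M mate W u G X a) {x : α} (hx : x ∈ X) : mate x ∉ X := by
  refine (hR.trans x (hR.sub hx) ?_ ?_).1 hx
  · rintro rfl; exact hR.a_notMem hx
  · rintro rfl; exact hR.b_notMem hx

lemma Tree.mate_mem (hR : Ready M mate W u G X a) (hm : Function.Involutive mate)
    (hT : Tree M mate W u G X a L dl pr cnt) {k : ℕ} (h2 : 2 ≤ k) (hk : k < cnt) :
    mate (L k) ∈ X := by
  have := hT.two_le
  have h := hR.trans (mate (L k)) (hR.mate_mem _ (hT.mem k hk).1) ?_ ?_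
  · rw [h, hm]; exact (hT.mem k hk).2
  · intro h
    have := hT.inj k hk 1 (by omega) (by rw [hT.L_one, ← h, hm])
    omega
  · intro h
    have := hT.inj k hk 0 (by omega) (by rw [hT.L_zero]; exact hm.injective h)
    omega

lemma BackPath.lt (hP : BackPath pr k₀ q m) (hT : Tree M mate W u G X a L dl pr cnt)
    (hk₀ : k₀ < cnt) : ∀ j ≤ m, q j < cnt := by
  intro j
  induction j with
  | zero => intro _; rwa [hP.start]
  | succ j ih =>
    intro hj
    have h1 := ih (by omega)
    rw [hP.step j (by omega)]
    have := hT.pr_lt (q j) (hP.two_le j (by omega)) h1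
    omega

lemma BackPath.anti (hP : BackPath pr k₀ q m) (hT : Tree M mate W u G X a L dl pr cnt)
    (hk₀ : k₀ < cnt) {i j : ℕ} (hij : i < j) (hj : j ≤ m) : q j < q i := by
  induction j, hij using Nat.le_induction with
  | base =>
    rw [hP.step i (by omega)]
    exact hT.pr_lt (q i) (hP.two_le i (by omega)) (hP.lt hT hk₀ i (by omega))
  | succ j hij ih =>
    refine lt_trans ?_ (ih (by omega))
    rw [hP.step j (by omega)]
    exact hT.pr_lt (q j) (hP.two_le j (by omega)) (hP.lt hT hk₀ j (by omega))

variable [IsStrictOrderedRing R]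

/-- If `y` is a node, closedness makes `mate x` a node too, and the triangle inequality compares the
two raises. Otherwise `u` is unchanged at `y` and can only have grown at `x`. -/
lemma Raised.le_of_exch (hR : Ready M mate W u G X a) (hm : Function.Involutive mate)
    (hT : Tree M mate W u G X a L dl pr cnt) (hC : Closed M mate G X L cnt)
    (hU : Raised mate W u G L dl cnt K u') {x y : α} (hx : x ∈ X) (hy : y ∈ G) (hyX : y ∉ X)
    (hI : M.Indep (insert y (X.erase x) : Finset α)) : u' y ≤ u' x := by
  have h1 := hR.exch x hx y hy hyX hI
  have hz : mate x ∉ X := hR.mate_notMem hx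
  by_cases hyL : ∃ j < cnt, L j = y
  · obtain ⟨j, hj, rfl⟩ := hyL
    have harc : Arc M mate X (L j) (mate x) := ⟨by rwa [hm], by rwa [hm]⟩
    obtain ⟨k, hk, hkx⟩ := hC j hj (mate x) (hR.mate_mem x (hR.sub hx)) hz harc
    have hxk : x = mate (L k) := by rw [hkx, hm]
    rw [← hkx] at harc
    have hk2 := hT.two_le_of_mate_mem hR hm (hxk ▸ hx)
    have hd := hT.dl_le hR hm hj hk harc
    rw [hxk] at h1 ⊢
    rw [hU.node j hj, hU.partner k hk2 hk]
    unfold len at hd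
    rcases le_total (K - dl j) 0 with h | h
    · rw [max_eq_right h]
      have := le_max_right (K - dl k + (W (mate (L k)) - W (L k) - u (mate (L k)) + u (L k))) 0
      linarith
    · rw [max_eq_left h]
      have := le_max_left (K - dl k + (W (mate (L k)) - W (L k) - u (mate (L k)) + u (L k))) 0
      linarith
  · push Not at hyL
    have hy' : u' y = u y := by
      refine hU.rest y hy hyL fun k hk2 hk h => hyX ?_
      rw [← h]
      exact hT.mate_mem hR hm hk2 hk
    rw [hy']
    refine h1.trans ?_
    by_cases hxL : ∃ k < cnt, L k = mate x
    · obtain ⟨k, hk, hkx⟩ := hxL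
      have hxk : x = mate (L k) := by rw [hkx, hm]
      have hk2 := hT.two_le_of_mate_mem hR hm (hxk ▸ hx)
      rw [hxk, hU.partner k hk2 hk]
      have := le_max_right (K - dl k + (W (mate (L k)) - W (L k) - u (mate (L k)) + u (L k))) 0
      linarith
    · push Not at hxL
      refine (hU.rest x (hR.sub hx) (fun k hk h => ?_) fun k _ hk h => ?_).ge
      · exact (hT.mem k hk).2 (h ▸ hx)
      · exact hxL k hk (by rw [← h, hm])

/-- The element `x` is raised as if its distance were that of its mate minus the slack of the pair.
Its potential therefore gains at most the slack over that of its mate. -/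
lemma Raised.pair (hR : Ready M mate W u G X a) (hm : Function.Involutive mate)
    (hT : Tree M mate W u G X a L dl pr cnt)
    (hU : Raised mate W u G L dl cnt K u') {x : α} (hx : x ∈ X) :
    u' x - u' (mate x) ≤ W x - W (mate x) := by
  have h1 := hR.pair x hx
  by_cases hxL : ∃ k < cnt, L k = mate x
  · obtain ⟨k, hk, hkx⟩ := hxL
    have hxk : x = mate (L k) := by rw [hkx, hm]
    have hk2 := hT.two_le_of_mate_mem hR hm (hxk ▸ hx)
    rw [hxk, hm] at h1 ⊢
    rw [hU.partner k hk2 hk, hU.node k hk]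
    have h3 := le_max_left (K - dl k) 0
    have h4 := le_max_right (K - dl k) 0
    rcases le_total (K - dl k + (W (mate (L k)) - W (L k) - u (mate (L k)) + u (L k))) 0 with h | h
    · rw [max_eq_right h]; linarith
    · rw [max_eq_left h]; linarith
  · push Not at hxL
    rw [hU.rest x (hR.sub hx), hU.rest (mate x) (hR.mate_mem _ (hR.sub hx)) hxL]
    · exact h1
    · intro k hk2 hk h
      exact (hT.mem k hk).2 (hm.injective h ▸ hx)
    · intro k hk h
      exact (hT.mem k hk).2 (h ▸ hx)
    · intro k _ hk h
      exact hxL k hk (by rw [← h, hm])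

/-- This value of `K` raises the best terminal exactly to `Λ`; since that terminal minimizes `dl -
u`, no other addable element gets above `Λ`. -/
lemma Raised.le_of_indep_insert (hR : Ready M mate W u G X a) (hm : Function.Involutive mate)
    (hT : Tree M mate W u G X a L dl pr cnt) (hB : Best M u X L dl cnt k₀)
    (hΛ : ∀ e ∈ G, u e ≤ Λ) (hK : K = dl k₀ - u (L k₀) + Λ)
    (hU : Raised mate W u G L dl cnt K u') {y : α} (hy : y ∈ G) (hyX : y ∉ X)
    (hI : M.Indep (insert y X : Finset α)) : u' y ≤ Λ := by
  by_cases hyL : ∃ j < cnt, L j = y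
  · obtain ⟨j, hj, rfl⟩ := hyL
    rw [hU.node j hj]
    have h1 := hB.le j hj hI
    have h2 := hΛ _ hy
    rcases le_total (K - dl j) 0 with h | h
    · rw [max_eq_right h]; linarith
    · rw [max_eq_left h]; linarith
  · push Not at hyL
    rw [hU.rest y hy hyL fun k hk2 hk h => hyX (h ▸ hT.mate_mem hR hm hk2 hk)]
    exact hΛ _ hy

/-- Augmenting along a shortest path yields an extreme set with the raised potential. -/
theorem extreme_augmented (hE : M.E = Set.univ) (hR : Ready M mate W u G X a)
    (hm : Function.Involutive mate) (hT : Tree M mate W u G X a L dl pr cnt)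
    (hC : Closed M mate G X L cnt) (hB : Best M u X L dl cnt k₀)
    (hΛ : ∀ e ∈ G, u e ≤ Λ) (hK : K = dl k₀ - u (L k₀) + Λ)
    (hU : Raised mate W u G L dl cnt K u') (hP : BackPath pr k₀ q m) :
    Extreme M mate W u' G (augmented mate X L q m) := by
  have hq := hP.lt hT hB.lt
  have hanti := fun {i j : ℕ} => hP.anti (i := i) (j := j) hT hB.lt
  have hqG : ∀ j ≤ m, L (q j) ∈ G := fun j hj => (hT.mem _ (hq j hj)).1
  have hqX : ∀ j ≤ m, L (q j) ∉ X := fun j hj => (hT.mem _ (hq j hj)).2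
  have hxX : ∀ j < m, mate (L (q j)) ∈ X := fun j hj =>
    hT.mate_mem hR hm (hP.two_le j hj) (hq j hj.le)
  have hqinj : ∀ i ≤ m, ∀ j ≤ m, L (q i) = L (q j) → i = j := by
    intro i hi j hj h
    have := hT.inj _ (hq i hi) _ (hq j hj) h
    rcases lt_trichotomy i j with h' | h' | h'
    · have := hanti h' hj; omega
    · exact h'
    · have := hanti h' hi; omega
  -- On the path the truncation at `0` is never active, so all raises there are exact differences of
  -- distances.
  have hdK : ∀ j ≤ m, dl (q j) ≤ K := by
    intro j hj
    have h1 : dl (q j) ≤ dl k₀ := by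
      refine hT.dl_mono hR hm ?_ hB.lt
      rw [← hP.start]
      rcases Nat.eq_zero_or_pos j with rfl | h
      · exact le_rfl
      · exact (hanti h hj).le
    have h2 := hΛ _ (hT.mem _ hB.lt).1
    rw [hK]; linarith
  have hu'y : ∀ j ≤ m, u' (L (q j)) = u (L (q j)) + (K - dl (q j)) := by
    intro j hj
    rw [hU.node _ (hq j hj), max_eq_left (sub_nonneg.2 (hdK j hj))]
  have hslack : ∀ j < m,
      u' (mate (L (q j))) = W (mate (L (q j))) - W (L (q j)) + u' (L (q j)) := by
    intro j hj
    have h1 := hR.pair _ (hxX j hj)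
    rw [hm] at h1
    have h2 := hdK j hj.le
    rw [hU.partner _ (hP.two_le j hj) (hq j hj.le), hu'y j hj.le, max_eq_left (by linarith)]
    ring
  -- Tree arcs are tight: an entering element has the same raised potential as the element it
  -- replaces.
  have htight : ∀ j < m, u' (L (q (j + 1))) = u' (mate (L (q j))) := by
    intro j hj
    rw [hslack j hj, hu'y _ hj, hu'y _ hj.le, hT.pr_eq _ (hP.two_le j hj) (hq j hj.le),
      hP.step j hj]
    unfold len
    ring
  have hu'0 : u' (L (q 0)) = Λ := by
    rw [hu'y 0 (Nat.zero_le _), hP.start, hK]; ring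
  -- Index `0` is the terminal, which is added to `X` without replacing anything; node `i + 1` of
  -- the path replaces the partner of node `i`.
  set A : ℕ → Finset α := fun i => match i with
    | 0 => X
    | i + 1 => X.erase (mate (L (q i))) with hA
  set X₀ := X \ (Finset.range m).image fun j => mate (L (q j)) with hX₀
  have hX₀I : M.Indep (X₀ : Set α) := hR.indep.subset (by simp [hX₀])
  have hAI : ∀ i, M.Indep (A i : Set α) := by
    rintro (_ | i)
    · exact hR.indep
    · exact hR.indep.subset (by simp [hA])
  have hmate_erase : ∀ l ≤ m, ∀ i, L (q l) ∉ X.erase (mate (L (q i))) := fun l hl i h =>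
    hqX l hl (Finset.mem_of_mem_erase h)
  -- If `L (q l)` were outside the closure, it could make the exchange intended for `L (q i)`. A
  -- larger raised potential contradicts the optimality shown above. An equal one with `l > i` gives
  -- an equally short connection from an earlier node of the list, against the tie-breaking in
  -- `Best.first` and `Tree.first`.
  have hlex : ∀ i ≤ m, ∀ l ≤ m,
      toLex (u' (L (q i)), i) < toLex (u' (L (q l)), l) → L (q l) ∈ M.closure (A i : Set α) := by
    intro i hi l hl hlt
    by_contra hcon
    have hI := indep_insert_of_notMem_closure hE (hAI i) hcon
    rw [Prod.Lex.toLex_lt_toLex] at hlt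
    rcases i with _ | i
    · have h1 : u' (L (q l)) ≤ Λ :=
        Raised.le_of_indep_insert hR hm hT hB hΛ hK hU (hqG l hl) (hqX l hl) hI
      rw [hu'0] at hlt
      rcases hlt with h | ⟨h, h'⟩
      · exact absurd h1 (not_le.2 h)
      · simp only at h h'
        have h2 := hanti h' hl
        rw [hP.start] at h2
        have h3 := hB.first (q l) h2 hI
        rw [hu'y l hl] at h
        linarith
    · have him : i < m := hi
      have h1 := Raised.le_of_exch hR hm hT hC hU (hxX i him) (hqG l hl) (hqX l hl) hI
      rw [htight i him] at hlt
      rcases hlt with h | ⟨h, h'⟩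
      · exact absurd h1 (not_le.2 h)
      · simp only at h h'
        have h2 := hanti h' hl
        rw [hP.step i him] at h2
        have h3 := hT.first (q i) (hP.two_le i him) (hq i him.le) (q l) h2 ⟨hxX i him, hI⟩
        rw [hslack i him, hu'y l hl, hu'y i him.le] at h
        unfold len at h3
        linarith
  have hindep : M.Indep (augmented mate X L q m : Set α) := by
    refine indep_union_of_triangular hE hX₀I (A := A) (y := fun j => L (q j))
      (f := fun j => toLex (u' (L (q j)), j)) _ ?_ ?_ ?_ ?_
    · rintro (_ | i) hi
      · exact Finset.sdiff_subset
      · intro e he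
        have him : i < m := by simpa using hi
        rw [hX₀, Finset.mem_sdiff] at he
        refine Finset.mem_erase.2 ⟨fun h => he.2 ?_, he.1⟩
        exact Finset.mem_image.2 ⟨i, Finset.mem_range.2 him, h.symm⟩
    · rintro (_ | i) hi
      · have := hB.indep
        rw [← hP.start] at this
        exact notMem_closure_of_indep_insert (hqX 0 (Nat.zero_le _)) this
      · have him : i < m := by simpa using hi
        have := (hT.pr_arc (q i) (hP.two_le i him) (hq i him.le)).2
        rw [← hP.step i him] at this
        exact notMem_closure_of_indep_insert (hmate_erase (i + 1) him i) this
    · intro i hi j hj hne h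
      simp only [toLex_inj, Prod.mk.injEq] at h
      exact hne h.2
    · intro i hi l hl h
      exact hlex i (by simpa [Nat.lt_succ_iff] using hi) l (by simpa [Nat.lt_succ_iff] using hl) h
  have hmem : ∀ e, e ∈ augmented mate X L q m ↔
      (e ∈ X ∧ ∀ j < m, mate (L (q j)) ≠ e) ∨ ∃ j ≤ m, L (q j) = e := by
    intro e
    simp [augmented]
  have hsum : ∀ g : α → R, ∑ e ∈ augmented mate X L q m, g e =
      ∑ e ∈ X, g e + g (L k₀) + ∑ j ∈ Finset.range m, (g (L (q (j + 1))) - g (mate (L (q j)))) := by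
    intro g
    have hsub : ((Finset.range m).image fun j => mate (L (q j))) ⊆ X := by
      intro e he
      obtain ⟨j, hj, rfl⟩ := Finset.mem_image.1 he
      exact hxX j (Finset.mem_range.1 hj)
    have h1 := Finset.sum_sdiff hsub (f := g)
    rw [Finset.sum_image (by
      intro i hi j hj h
      exact hqinj i (Finset.mem_range.1 hi).le j (Finset.mem_range.1 hj).le
        (hm.injective h))] at h1
    rw [augmented, Finset.sum_union, Finset.sum_image, Finset.sum_range_succ', hP.start,
      Finset.sum_sub_distrib, ← h1]
    · ring
    · intro i hi j hj h
      exact hqinj i (Nat.lt_succ_iff.1 (Finset.mem_range.1 hi)) j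
        (Nat.lt_succ_iff.1 (Finset.mem_range.1 hj)) h
    · rw [Finset.disjoint_left]
      intro e he he'
      obtain ⟨j, hj, rfl⟩ := Finset.mem_image.1 he'
      exact hqX j (Nat.lt_succ_iff.1 (Finset.mem_range.1 hj)) (Finset.mem_sdiff.1 he).1
  have hkX : L k₀ ∉ X := (hT.mem _ hB.lt).2
  have hcard : (augmented mate X L q m).card = X.card + 1 := by
    have := hsum fun _ => 1
    simp only [Finset.sum_const, sub_self, nsmul_eq_mul, mul_one, mul_zero, add_zero] at this
    exact_mod_cast this
  -- All exchanges are tight, so the new set has the same raised weight as `X` with the terminal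
  -- added.
  have hsum' : ∑ e ∈ augmented mate X L q m, u' e = ∑ e ∈ insert (L k₀) X, u' e := by
    have hz : ∑ j ∈ Finset.range m, (u' (L (q (j + 1))) - u' (mate (L (q j)))) = 0 := by
      refine Finset.sum_eq_zero fun j hj => ?_
      rw [htight j (Finset.mem_range.1 hj), sub_self]
    rw [hsum, hz, Finset.sum_insert hkX]
    ring
  have hends : ∀ k < 2, L k = a ∨ L k = mate a := by
    intro k hk
    interval_cases k
    · exact Or.inl hT.L_zero
    · exact Or.inr hT.L_one
  have hsubG : augmented mate X L q m ⊆ G := by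
    intro e he
    rcases (hmem e).1 he with h | ⟨j, hj, rfl⟩
    · exact hR.sub h.1
    · exact hqG j hj
  have htrX : ∀ x ∈ X, (x ∈ augmented mate X L q m ↔ mate x ∉ augmented mate X L q m) := by
    intro x hx
    have h1 : mate x ∉ X := hR.mate_notMem hx
    rw [hmem, hmem]
    constructor
    · rintro (⟨_, h⟩ | ⟨j, hj, rfl⟩)
      · rintro (h' | ⟨j, hj, h'⟩)
        · exact h1 h'.1
        · rcases hj.lt_or_eq with hj | rfl
          · exact h j hj (by rw [h', hm])
          · rcases hends _ hP.last with h2 | h2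
            · exact hR.b_notMem (by rw [← h2, h', hm]; exact hx)
            · rw [h2] at h'
              exact hR.a_notMem (hm.injective h' ▸ hx)
      · exact absurd hx (hqX j hj)
    · intro h
      refine Or.inl ⟨hx, fun j hj h' => h (Or.inr ⟨j, hj.le, ?_⟩)⟩
      rw [← h', hm]
  refine ⟨hR.mate_mem, hR.mate_ne, hsubG, ?_, hindep, ?_, ?_⟩
  · intro e he
    by_cases hea : e = a ∨ e = mate a
    · have haX : a ∉ X := hR.a_notMem
      have hbX : mate a ∉ X := hR.b_notMem
      have hab := hR.mate_ne a hR.a_mem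
      have h2 := hT.two_le
      -- Nodes `0` and `1` are the two elements of the new pair. Only the last node of the path is
      -- one of them, so exactly one of the pair enters.
      have key : ∀ k < 2, (L k ∈ augmented mate X L q m ↔ q m = k) := by
        intro k hk
        rw [hmem]
        constructor
        · rintro (⟨h, _⟩ | ⟨j, hj, h⟩)
          · rcases hends k hk with h' | h' <;> rw [h'] at h
            · exact absurd h haX
            · exact absurd h hbX
          · have h3 := hT.inj _ (hq j hj) k (by omega) h
            rcases hj.lt_or_eq with hj | rfl
            · have := hP.two_le j hj
              omega
            · exact h3
        · intro h
          exact Or.inr ⟨m, le_rfl, by rw [h]⟩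
      have k0 := key 0 (by omega)
      have k1 := key 1 (by omega)
      have hl := hP.last
      rw [hT.L_zero] at k0
      rw [hT.L_one] at k1
      rcases hea with rfl | rfl
      · rw [k0, k1]; omega
      · rw [hm, k0, k1]; omega
    · push Not at hea
      by_cases heX : e ∈ X
      · exact htrX e heX
      · have h1 := hR.trans e he hea.1 hea.2
        have h2 := htrX (mate e) (by tauto)
        rw [hm] at h2
        tauto
  -- An improving exchange would beat `X` with the terminal added. That set is locally optimal:
  -- replacing the terminal is controlled by `Λ`, and every other exchange restricts to an exchange
  -- in `X`.
  · intro x hx y hy hyX hI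
    have hle := sum_le_of_locally_optimal hE hB.indep (u := u') _
      (insert y ((augmented mate X L q m).erase x)) rfl hI ?_ ?_
    · rw [sum_insert_erase hx hyX, ← hsum'] at hle
      linarith
    · rw [Finset.card_insert_of_notMem hkX,
        Finset.card_insert_of_notMem fun h => hyX (Finset.mem_of_mem_erase h),
        Finset.card_erase_of_mem hx, hcard]
      rfl
    · intro x₁ hx₁ y₁ hy₁ hy₁X hI₁
      have hy₁G : y₁ ∈ G := by
        rcases Finset.mem_insert.1 hy₁ with rfl | h
        · exact hy
        · exact hsubG (Finset.mem_of_mem_erase h)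
      have hy₁X' : y₁ ∉ X := fun h => hy₁X (Finset.mem_insert_of_mem h)
      rcases Finset.mem_insert.1 hx₁ with rfl | h
      · rw [Finset.erase_insert hkX] at hI₁
        rw [← hP.start, hu'0]
        exact Raised.le_of_indep_insert hR hm hT hB hΛ hK hU hy₁G hy₁X' hI₁
      · refine Raised.le_of_exch hR hm hT hC hU h hy₁G hy₁X' (hI₁.subset ?_)
        rw [Finset.coe_subset]
        exact Finset.insert_subset_insert _ (Finset.erase_subset_erase _
          (Finset.subset_insert _ _))
  · intro x hx
    rcases (hmem x).1 hx with h | ⟨j, hj, rfl⟩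
    · exact hU.pair hR hm hT h.1
    · rcases hj.lt_or_eq with hj | rfl
      · rw [hslack j hj]; linarith
      -- Both roots have distance `0` and are raised equally, so the equality `source` survives and
      -- makes the new pair tight.
      · have h2 := hT.two_le
        have h0 := hU.node 0 (by omega)
        have h1 := hU.node 1 (by omega)
        have hs := hR.source
        rw [hT.L_zero, hT.dl_zero] at h0
        rw [hT.L_one, hT.dl_one] at h1
        rcases hends _ hP.last with h | h
        · rw [h]; linarith
        · rw [h, hm]; linarith

end Augment

end Pricing

namespace Pricing

/-! ### Existence of weight splittings -/

section Existence

variable {α : Type*} [DecidableEq α] {R : Type*} [CommRing R] [LinearOrder R]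
  {M : Matroid α} {mate : α → α} {W u : α → R} {G X : Finset α} {a : α}
  {L : ℕ → α} {dl : ℕ → R} {pr : ℕ → ℕ} {cnt : ℕ} {k₀ : ℕ} {K : R}

/-- Potentials below all those on `X` make every exchange that brings in `a` or its mate harmless.
Subtracting the same `c` from both weights gives the equality `source`. -/
lemma Extreme.ready (hX : Extreme M mate W u G X) (hm : Function.Involutive mate) (ha : a ∉ G)
    (hab : mate a ≠ a) {u' : α → R} {c : R} (hu : ∀ e ∈ G, u' e = u e)
    (hua : u' a = W a - c) (hub : u' (mate a) = W (mate a) - c)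
    (hca : ∀ x ∈ X, W a - c ≤ u x) (hcb : ∀ x ∈ X, W (mate a) - c ≤ u x) :
    Ready M mate W u' (insert a (insert (mate a) G)) X a := by
  have hb : mate a ∉ G := fun h => ha (hm a ▸ hX.mate_mem _ h)
  refine ⟨Finset.mem_insert_self _ _, ?_, ?_, ?_, fun h => ha (hX.sub h),
    fun h => hb (hX.sub h), ?_, hX.indep, ?_, ?_, ?_⟩
  · intro e he
    simp only [Finset.mem_insert] at he ⊢
    rcases he with rfl | rfl | he
    · simp
    · simp [hm a]
    · exact Or.inr (Or.inr (hX.mate_mem e he))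
  · intro e he
    simp only [Finset.mem_insert] at he
    rcases he with rfl | rfl | he
    · exact hab
    · rw [hm]; exact hab.symm
    · exact hX.mate_ne e he
  · exact fun x hx => Finset.mem_insert_of_mem (Finset.mem_insert_of_mem (hX.sub hx))
  · intro e he h1 h2
    simp only [Finset.mem_insert, h1, h2, false_or] at he
    exact hX.trans e he
  · intro x hx y hy hyX hI
    rw [hu x (hX.sub hx)]
    simp only [Finset.mem_insert] at hy
    rcases hy with rfl | rfl | hy
    · rw [hua]; exact hca x hx
    · rw [hub]; exact hcb x hx
    · rw [hu y hy]; exact hX.exch x hx y hy hyX hI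
  · intro x hx
    rw [hu x (hX.sub hx), hu _ (hX.mate_mem x (hX.sub hx))]
    exact hX.pair x hx
  · rw [hua, hub]; ring

lemma exists_backPath (h : ∀ k, 2 ≤ k → k < cnt → pr k < k) (k : ℕ) (hk : k < cnt) :
    ∃ q m, BackPath pr k q m := by
  induction k using Nat.strong_induction_on with
  | _ k ih =>
    rcases lt_or_ge k 2 with h2 | h2
    · exact ⟨fun _ => k, 0, rfl, by simp, by simp, h2⟩
    · have hp := h k h2 hk
      obtain ⟨q, m, hq⟩ := ih (pr k) hp (by omega)
      refine ⟨fun j => Nat.casesOn j k q, m + 1, rfl, ?_, ?_, hq.last⟩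
      · rintro (_ | j) hj
        · exact h2
        · exact hq.two_le j (by omega)
      · rintro (_ | j) hj
        · exact hq.start
        · exact hq.step j (by omega)

lemma BackPath.length_lt {q : ℕ → ℕ} {m : ℕ} (h : ∀ k, 2 ≤ k → k < cnt → pr k < k)
    (hk₀ : k₀ < cnt) (hP : BackPath pr k₀ q m) : m < cnt := by
  have : ∀ j ≤ m, q j + j ≤ k₀ := by
    intro j
    induction j with
    | zero => intro _; rw [hP.start]; omega
    | succ j ih =>
      intro hj
      have h1 := ih (by omega)
      have h2 := h (q j) (hP.two_le j (by omega)) (by omega)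
      rw [hP.step j (by omega)]
      omega
  have := this m le_rfl
  omega

lemma exists_best (h : ∃ k < cnt, M.Indep (insert (L k) X : Finset α)) :
    ∃ k₀, Best M u X L dl cnt k₀ := by
  classical
  obtain ⟨k, hk, hI⟩ := h
  obtain ⟨k₀, h₀, hmin⟩ := ((Finset.range cnt).filter fun k =>
    M.Indep (insert (L k) X : Finset α)).exists_min_image
    (fun k => toLex (dl k - u (L k), k)) ⟨k, by simpa using ⟨hk, by simpa using hI⟩⟩
  simp only [Finset.mem_filter, Finset.mem_range] at h₀ hmin
  refine ⟨k₀, h₀.1, h₀.2, fun k hk hI => ?_, fun k hk hI => ?_⟩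
  · have := hmin k ⟨hk, hI⟩
    rw [Prod.Lex.toLex_le_toLex] at this
    rcases this with h | h
    · exact h.le
    · exact h.1.le
  · have := hmin k ⟨hk.trans h₀.1, hI⟩
    rw [Prod.Lex.toLex_le_toLex] at this
    rcases this with h | h
    · exact h
    · simp only at h
      omega

/-- Minimizing the pair (distance, predecessor index) lexicographically supplies both the nearest
new node and its earliest predecessor. -/
lemma Tree.exists_step (hT : Tree M mate W u G X a L dl pr cnt)
    (hC : ¬ Closed M mate G X L cnt) :
    ∃ L' dl' pr', Tree M mate W u G X a L' dl' pr' (cnt + 1) := by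
  classical
  unfold Closed at hC
  push Not at hC
  obtain ⟨j₁, hj₁, z₁, hz₁G, hz₁X, harc₁, hne₁⟩ := hC
  obtain ⟨⟨j, z⟩, hjz, hmin⟩ := ((Finset.range cnt ×ˢ G).filter fun p : ℕ × α =>
    p.2 ∉ X ∧ (∀ i < cnt, L i ≠ p.2) ∧ Arc M mate X (L p.1) p.2).exists_min_image
    (fun p => toLex (dl p.1 + len mate W u (L p.1) p.2, p.1)) ⟨(j₁, z₁), by
      simp only [Finset.mem_filter, Finset.mem_product, Finset.mem_range]
      exact ⟨⟨hj₁, hz₁G⟩, hz₁X, hne₁, harc₁⟩⟩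
  simp only [Finset.mem_filter, Finset.mem_product, Finset.mem_range] at hjz
  obtain ⟨⟨hj, hzG⟩, hzX, hz, harc⟩ := hjz
  have hmin' : ∀ j' < cnt, ∀ z' ∈ G, z' ∉ X → (∀ i < cnt, L i ≠ z') → Arc M mate X (L j') z' →
      toLex (dl j + len mate W u (L j) z, j) ≤ toLex (dl j' + len mate W u (L j') z', j') := by
    intro j' hj' z' hz'G hz'X hz' ha
    refine hmin (j', z') ?_
    simp only [Finset.mem_filter, Finset.mem_product, Finset.mem_range]
    exact ⟨⟨hj', hz'G⟩, hz'X, hz', ha⟩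
  refine ⟨_, _, _, hT.step hj hzG hzX hz harc ?_ ?_⟩
  · intro j' hj' z' hz'G hz'X hz' ha
    have := hmin' j' hj' z' hz'G hz'X hz' ha
    rw [Prod.Lex.toLex_le_toLex] at this
    rcases this with h | h
    · exact h.le
    · exact h.1.le
  · intro j' hj' ha
    have := hmin' j' (hj'.trans hj) z hzG hzX hz ha
    rw [Prod.Lex.toLex_le_toLex] at this
    rcases this with h | h
    · exact h
    · simp only at h
      omega

lemma Tree.cnt_le [Fintype α] (hT : Tree M mate W u G X a L dl pr cnt) :
    cnt ≤ Fintype.card α := by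
  have := Finset.card_le_card_of_injOn (s := Finset.range cnt) (t := Finset.univ) L
    (fun _ _ => Finset.mem_coe.2 (Finset.mem_univ _))
    (fun i hi j hj h => hT.inj i (by simpa using hi) j (by simpa using hj) h)
  simpa using this

/-- Nodes lie outside `X` and partners inside, and both enumerations are injective, so the
prescribed values do not conflict. -/
lemma Tree.raised_exists [IsStrictOrderedRing R] (hR : Ready M mate W u G X a)
    (hm : Function.Involutive mate) (hT : Tree M mate W u G X a L dl pr cnt) :
    ∃ u', Raised mate W u G L dl cnt K u' := by
  classical
  refine ⟨fun e => if h : ∃ k < cnt, L k = e then u e + max (K - dl h.choose) 0 else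
    if h : ∃ k, 2 ≤ k ∧ k < cnt ∧ mate (L k) = e then u e + max (K - dl h.choose +
      (W e - W (mate e) - u e + u (mate e))) 0 else u e, ?_, ?_, ?_⟩
  · intro k hk
    have h : ∃ k' < cnt, L k' = L k := ⟨k, hk, rfl⟩
    have hc := hT.inj _ h.choose_spec.1 k hk h.choose_spec.2
    simp only [dif_pos h, hc]
  · intro k hk2 hk
    have h1 : ¬ ∃ k' < cnt, L k' = mate (L k) := by
      rintro ⟨k', hk', h⟩
      exact (hT.mem k' hk').2 (h ▸ hT.mate_mem hR hm hk2 hk)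
    have h : ∃ k', 2 ≤ k' ∧ k' < cnt ∧ mate (L k') = mate (L k) := ⟨k, hk2, hk, rfl⟩
    have hc := hT.inj _ h.choose_spec.2.1 k hk (hm.injective h.choose_spec.2.2)
    simp only [dif_neg h1, dif_pos h, hc, hm (L k)]
  · intro e _ h1 h2
    have h1' : ¬ ∃ k < cnt, L k = e := by rintro ⟨k, hk, h⟩; exact h1 k hk h
    have h2' : ¬ ∃ k, 2 ≤ k ∧ k < cnt ∧ mate (L k) = e := by
      rintro ⟨k, hk2, hk, h⟩; exact h2 k hk2 hk h
    simp only [dif_neg h1', dif_neg h2']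

variable [IsStrictOrderedRing R]

lemma Ready.exists_extreme [Fintype α] (hE : M.E = Set.univ) (hR : Ready M mate W u G X a)
    (hm : Function.Involutive mate) {T : Finset α} (hTI : M.Indep (T : Set α))
    (hTt : ∀ e ∈ G, (e ∈ T ↔ mate e ∉ T)) : ∃ u' X', Extreme M mate W u' G X' := by
  have htree : ∃ L dl pr cnt, Tree M mate W u G X a L dl pr cnt ∧ Closed M mate G X L cnt := by
    -- A tree that could always be extended would have more nodes than `α` has elements.
    by_contra! hcon
    have : ∀ k, ∃ L dl pr, Tree M mate W u G X a L dl pr (k + 2) := by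
      intro k
      induction k with
      | zero =>
        exact ⟨fun i => Nat.casesOn i a fun _ => mate a, fun _ => 0, fun _ => 0,
          hR.tree hm rfl rfl rfl rfl⟩
      | succ k ih =>
        obtain ⟨L, dl, pr, hT⟩ := ih
        exact hT.exists_step (hcon _ _ _ _ hT)
    obtain ⟨L, dl, pr, hT⟩ := this (Fintype.card α)
    have := hT.cnt_le
    omega
  obtain ⟨L, dl, pr, cnt, hT, hC⟩ := htree
  obtain ⟨k₀, hB⟩ := exists_best (u := u) (dl := dl) (hT.exists_terminal hE hR hm hC hTI hTt)
  obtain ⟨q, m, hP⟩ := exists_backPath hT.pr_lt k₀ hB.lt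
  obtain ⟨Λ, hΛ⟩ : ∃ Λ, ∀ e ∈ G, u e ≤ Λ := by
    obtain ⟨e, _, he⟩ := G.exists_max_image u ⟨a, hR.a_mem⟩
    exact ⟨u e, he⟩
  obtain ⟨u', hU⟩ := hT.raised_exists (K := dl k₀ - u (L k₀) + Λ) hR hm
  exact ⟨u', _, extreme_augmented hE hR hm hT hC hB hΛ rfl hU hP⟩

/-- Weight splitting: there is an optimal transversal together with a certificate. -/
theorem exists_extreme [Fintype α] (hE : M.E = Set.univ) (hm : Function.Involutive mate)
    (W : α → R) {T : Finset α} (hTI : M.Indep (T : Set α)) (k : ℕ) :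
    ∀ G : Finset α, G.card = k → (∀ e ∈ G, mate e ∈ G) → (∀ e ∈ G, mate e ≠ e) →
    (∀ e ∈ G, (e ∈ T ↔ mate e ∉ T)) → ∃ u X, Extreme M mate W u G X := by
  induction k using Nat.strong_induction_on with
  | _ k ih =>
    intro G hk h1 h2 h3
    rcases G.eq_empty_or_nonempty with rfl | ⟨a, ha⟩
    · exact ⟨fun _ => 0, ∅, by simp, by simp, by simp, by simp, by simp, by simp, by simp⟩
    · have hab := h2 a ha
      have hG : insert a (insert (mate a) ((G.erase (mate a)).erase a)) = G := by
        rw [Finset.insert_comm, Finset.insert_erase (Finset.mem_erase.2 ⟨hab.symm, ha⟩),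
          Finset.insert_erase (h1 a ha)]
      have hlt : ((G.erase (mate a)).erase a).card < k := by
        rw [← hk]
        exact (Finset.card_erase_lt_of_mem (Finset.mem_erase.2 ⟨hab.symm, ha⟩)).trans_le
          (Finset.card_le_card (Finset.erase_subset _ _))
      have hsub : ∀ e ∈ (G.erase (mate a)).erase a, e ∈ G := fun e he =>
        Finset.mem_of_mem_erase (Finset.mem_of_mem_erase he)
      obtain ⟨u, X, hX⟩ := ih _ hlt _ rfl (fun e he => by
          simp only [Finset.mem_erase] at he ⊢
          exact ⟨fun h => he.2.1 (by rw [← h, hm]), fun h => he.1 (hm.injective h),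
            h1 e he.2.2⟩)
        (fun e he => h2 e (hsub e he)) (fun e he => h3 e (hsub e he))
      obtain ⟨c, hc⟩ : ∃ c, ∀ x ∈ X, W a - c ≤ u x ∧ W (mate a) - c ≤ u x := by
        rcases X.eq_empty_or_nonempty with rfl | hne
        · exact ⟨0, by simp⟩
        · obtain ⟨x, _, hx⟩ := X.exists_min_image u hne
          refine ⟨max (W a) (W (mate a)) - u x, fun x' hx' => ?_⟩
          have h1 := hx x' hx'
          have h2 := le_max_left (W a) (W (mate a))
          have h3 := le_max_right (W a) (W (mate a))
          constructor <;> linarith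
      have hR := hX.ready hm (a := a) (by simp) hab
        (u' := Function.update (Function.update u a (W a - c)) (mate a) (W (mate a) - c)) (c := c)
        (fun e he => by
          simp only [Finset.mem_erase] at he
          rw [Function.update_of_ne he.2.1, Function.update_of_ne he.1])
        (by rw [Function.update_of_ne hab.symm, Function.update_self]) (by simp)
        (fun x hx => (hc x hx).1) (fun x hx => (hc x hx).2)
      rw [hG] at hR
      exact hR.exists_extreme hE hm hTI h3

/-- Two transversals correspond pair by pair. This yields equal sizes and the comparison of `W - u`;
the comparison of `u` is local optimality in the matroid. -/
lemma Extreme.sum_le (hE : M.E = Set.univ) (hm : Function.Involutive mate)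
    (hX : Extreme M mate W u G X) {Y : Finset α} (hYG : Y ⊆ G) (hYI : M.Indep (Y : Set α))
    (hYt : ∀ e ∈ G, (e ∈ Y ↔ mate e ∉ Y)) : X.card = Y.card ∧ ∑ e ∈ Y, W e ≤ ∑ e ∈ X, W e := by
  have hbij : ∀ g : α → R, ∑ e ∈ Y, g e = ∑ e ∈ X, g (if e ∈ Y then e else mate e) := by
    intro g
    refine Finset.sum_bij (fun e _ => if e ∈ X then e else mate e) ?_ ?_ ?_ ?_
    · intro e he
      have := hX.trans e (hYG he)
      split_ifs with h
      · exact h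
      · tauto
    · intro e he e' he' h
      have h1 := (hYt e (hYG he)).1 he
      have h2 := (hYt e' (hYG he')).1 he'
      split_ifs at h
      · exact h
      · exact absurd (h ▸ he) h2
      · exact absurd (h ▸ he') h1
      · exact hm.injective h
    · intro e he
      have h1 := hX.trans e (hX.sub he)
      have h2 := hYt e (hX.sub he)
      by_cases h : e ∈ Y
      · exact ⟨e, h, by simp [he]⟩
      · exact ⟨mate e, by tauto, by rw [if_neg (h1.1 he), hm]⟩
    · intro e he
      have h2 := (hYt e (hYG he)).1 he
      by_cases h : e ∈ X
      · simp [h, he]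
      · simp [h, h2, hm e]
  have hcard : X.card = Y.card := by
    have := hbij fun _ => 1
    simp only [Finset.sum_const, nsmul_eq_mul, mul_one] at this
    exact_mod_cast this.symm
  refine ⟨hcard, ?_⟩
  have h1 : ∑ e ∈ Y, u e ≤ ∑ e ∈ X, u e :=
    sum_le_of_locally_optimal hE hX.indep _ Y rfl hYI hcard fun x hx y hy hyX hI =>
      hX.exch x hx y (hYG hy) hyX hI
  have h2 : ∑ e ∈ Y, (W e - u e) ≤ ∑ e ∈ X, (W e - u e) := by
    rw [hbij]
    refine Finset.sum_le_sum fun x hx => ?_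
    split_ifs
    · exact le_rfl
    · have := hX.pair x hx
      linarith
  rw [Finset.sum_sub_distrib, Finset.sum_sub_distrib] at h2
  linarith

end Existence

end Pricing

namespace Pricing

/-! ### From weight splittings to tie-free prices -/

section Prices

lemma card_inter_eq_one_iff_of_pair {S : Type*} [DecidableEq S] {X C : Finset S} {e f : S}
    (hef : f ≠ e) (he : e ∈ C)
    (hf : f ∈ C) (hC : C.card ≤ 2) : (X ∩ C).card = 1 ↔ (e ∈ X ↔ f ∉ X) := by
  have hCe : C = {e, f} := by
    refine (Finset.eq_of_subset_of_card_le ?_ ?_).symm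
    · intro z hz
      rcases Finset.mem_insert.1 hz with rfl | hz
      · exact he
      · rwa [Finset.mem_singleton.1 hz]
    · rwa [Finset.card_pair hef.symm]
  by_cases h1 : e ∈ X <;> by_cases h2 : f ∈ X
  · have : X ∩ C = {e, f} := by rw [hCe]; ext z; simp; rintro (rfl | rfl) <;> assumption
    rw [this, Finset.card_pair hef.symm]; simp [h1, h2]
  · have : X ∩ C = {e} := by
      rw [hCe]; ext z; simp; constructor
      · rintro ⟨h, rfl | rfl⟩
        · rfl
        · exact absurd h h2
      · rintro rfl; exact ⟨h1, Or.inl rfl⟩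
    rw [this]; simp [h1, h2]
  · have : X ∩ C = {f} := by
      rw [hCe]; ext z; simp; constructor
      · rintro ⟨h, rfl | rfl⟩
        · exact absurd h h1
        · rfl
      · rintro rfl; exact ⟨h2, Or.inr rfl⟩
    rw [this]; simp [h1, h2]
  · have : X ∩ C = ∅ := by
      rw [hCe]; ext z; simp; rintro h
      exact ⟨fun h' => h1 (h' ▸ h), fun h' => h2 (h' ▸ h)⟩
    rw [this]; simp [h1, h2]

lemma card_eq_of_mem_bases {S : Type*} {M₂ : Matroid S} {X Y : Finset S} (hX : X ∈ bases M₂)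
    (hY : Y ∈ bases M₂) :
    X.card = Y.card := by
  have := Matroid.IsBase.ncard_eq_ncard_of_isBase hX hY
  simpa using this

lemma mem_bases_of_indep_of_card {S : Type*} [Fintype S] {M₂ : Matroid S} {X Y : Finset S}
    (hX : M₂.Indep (X : Set S))
    (hY : Y ∈ bases M₂) (hc : X.card = Y.card) : X ∈ bases M₂ := by
  obtain ⟨B, hB, hsub⟩ := hX.exists_isBase_superset
  have h1 := Matroid.IsBase.ncard_eq_ncard_of_isBase hB hY
  have h2 : (X : Set S) = B := by
    refine Set.eq_of_subset_of_ncard_le hsub ?_ (Set.toFinite _)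
    rw [h1]
    simp [hc]
  change M₂.IsBase (X : Set S)
  rwa [h2]

variable {S : Type*} [Fintype S] [DecidableEq S]

/-- `mate` exchanges the elements of the two-element classes of the partition matroid `M₁` and fixes
the elements of the one-element classes. -/
structure IsMate (M₁ : Matroid S) (mate : S → S) : Prop where
  invol : Function.Involutive mate
  mem_bases : ∀ X, X ∈ bases M₁ ↔
    ∀ e, (mate e = e → e ∈ X) ∧ (mate e ≠ e → (e ∈ X ↔ mate e ∉ X))

lemma exists_isMate {M₁ : Matroid S} {P : Finpartition (Finset.univ : Finset S)}
    (hP : ∀ C ∈ P.parts, C.card ≤ 2) (h : IsPartitionMatroid M₁ P fun _ => 1) :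
    ∃ mate, IsMate M₁ mate := by
  classical
  have hpart : ∀ e, e ∈ P.part e := fun e => P.mem_part (Finset.mem_univ e)
  have hparts : ∀ e, P.part e ∈ P.parts := fun e => P.part_mem.2 (Finset.mem_univ e)
  have heq : ∀ e f, f ∈ P.part e → P.part f = P.part e := fun e f hf =>
    P.part_eq_of_mem (hparts e) hf
  have huniq : ∀ e f g, f ∈ P.part e → g ∈ P.part e → f ≠ e → g ≠ e → f = g := by
    intro e f g hf hg hfe hge
    by_contra hfg
    have : ({e, f, g} : Finset S) ⊆ P.part e := by
      intro z hz
      simp only [Finset.mem_insert, Finset.mem_singleton] at hz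
      rcases hz with rfl | rfl | rfl
      · exact hpart z
      · exact hf
      · exact hg
    have h1 := Finset.card_le_card this
    rw [Finset.card_eq_three.2 ⟨e, f, g, hfe.symm, hge.symm, hfg, rfl⟩] at h1
    have := hP _ (hparts e)
    omega
  set mate : S → S := fun e => if h : ∃ f ∈ P.part e, f ≠ e then h.choose else e with hmate
  have hm1 : ∀ e, mate e ∈ P.part e := by
    intro e
    simp only [hmate]
    split_ifs with h
    · exact h.choose_spec.1
    · exact hpart e
  have hm2 : ∀ e f, f ∈ P.part e → f ≠ e → mate e = f := by
    intro e f hf hfe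
    have h : ∃ f ∈ P.part e, f ≠ e := ⟨f, hf, hfe⟩
    have : mate e = h.choose := by simp only [hmate, dif_pos h]
    rw [this]
    exact huniq e _ _ h.choose_spec.1 hf h.choose_spec.2 hfe
  refine ⟨mate, ?_, ?_⟩
  · intro e
    by_cases he : mate e = e
    · rw [he, he]
    · refine hm2 (mate e) e ?_ (Ne.symm he)
      rw [heq e _ (hm1 e)]
      exact hpart e
  · intro X
    rw [h.2]
    simp only [Set.mem_ofPred_eq]
    have key : ∀ e, (X ∩ P.part e).card = 1 ↔
        (mate e = e → e ∈ X) ∧ (mate e ≠ e → (e ∈ X ↔ mate e ∉ X)) := by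
      intro e
      by_cases he : mate e = e
      · have : P.part e = {e} := by
          ext f
          rw [Finset.mem_singleton]
          constructor
          · intro hf
            by_contra hfe
            exact hfe ((hm2 e f hf hfe).symm.trans he)
          · rintro rfl; exact hpart _
        rw [this]
        by_cases heX : e ∈ X
        · simp [he, heX, Finset.inter_singleton_of_mem]
        · simp [he, heX, Finset.inter_singleton_of_notMem]
      · rw [card_inter_eq_one_iff_of_pair he (hpart e) (hm1 e) (hP _ (hparts e))]
        simp [he]
    constructor
    · intro hX e
      exact (key e).1 (hX _ (hparts e))
    · intro hX C hC
      obtain ⟨e, he⟩ := P.nonempty_of_mem_parts hC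
      rw [← P.part_eq_of_mem hC he]
      exact (key e).2 (hX e)

variable {M₁ M₂ : Matroid S} {mate : S → S}

/-- This is how the classes of `M₁` are recognized by an independence oracle. If `s` and `t` lie in
different classes, any base can be switched in these two classes so as to contain both. -/
lemma IsMate.indep_pair_iff (h : IsMate M₁ mate) {s t : S} (hst : s ≠ t) :
    M₁.Indep ({s, t} : Finset S) ↔ mate s ≠ t := by
  classical
  constructor
  · rintro hI rfl
    obtain ⟨B, hB, hsub⟩ := hI.exists_isBase_superset
    have hb : B.toFinset ∈ bases M₁ := by simpa [bases] using hB
    have h1 := ((h.mem_bases _).1 hb s).2 hst.symm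
    have h2 : s ∈ B := hsub (by simp)
    have h3 : mate s ∈ B := hsub (by simp)
    simp only [Set.mem_toFinset] at h1
    tauto
  · intro hne
    obtain ⟨B, hB⟩ := M₁.exists_isBase
    have hb : B.toFinset ∈ bases M₁ := by simpa [bases] using hB
    have hne' : mate t ≠ s := fun h' => hne (by rw [← h', h.invol])
    set X : Finset S := Finset.univ.filter fun e =>
      e = s ∨ e = t ∨ (mate e ≠ s ∧ mate e ≠ t ∧ e ∈ B) with hX
    have hXb : X ∈ bases M₁ := by
      rw [h.mem_bases]
      intro e
      have h1 := (h.mem_bases _).1 hb e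
      simp only [Set.mem_toFinset] at h1
      simp only [hX, Finset.mem_filter, Finset.mem_univ, true_and]
      rw [h.invol e]
      constructor
      · intro he
        rw [he]
        have := h1.1 he
        tauto
      · intro he
        have h2 := h1.2 he
        by_cases hes : e = s
        · subst hes; simp [he, hne]
        · by_cases het : e = t
          · subst het; simp [he, hne']
          · simp only [hes, het, false_or, not_or, not_and]
            tauto
    exact Matroid.IsBase.indep hXb |>.subset (by intro z; simp [hX]; tauto)

/-- The elements of the two-element classes. -/
def paired (mate : S → S) : Finset S := Finset.univ.filter fun e => mate e ≠ e

lemma mem_paired {e : S} : e ∈ paired mate ↔ mate e ≠ e := by simp [paired]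

lemma IsMate.mate_mem_paired (h : IsMate M₁ mate) {e : S} (he : e ∈ paired mate) :
    mate e ∈ paired mate := by
  rw [mem_paired] at he ⊢
  rw [h.invol e]
  exact he.symm

lemma IsMate.compl_mem_bases (h : IsMate M₁ mate) {T : Finset S} :
    Tᶜ ∈ bases M₁ ↔ T ⊆ paired mate ∧ ∀ e ∈ paired mate, (e ∈ T ↔ mate e ∉ T) := by
  rw [h.mem_bases]
  simp only [Finset.mem_compl, Finset.subset_iff, mem_paired]
  constructor
  · intro H
    refine ⟨fun e he h' => (H e).1 h' he, fun e he => ?_⟩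
    have := (H e).2 he
    tauto
  · rintro ⟨H1, H2⟩ e
    refine ⟨fun he he' => H1 he' he, fun he => ?_⟩
    have := H2 e he
    tauto

/-- Up to a constant, the welfare depends on the second buyer's bundle only through `w₂ - w₁`. -/
lemma total_compl_add (w₁ w₂ : S → ℝ) (X : Finset S) :
    total w₁ Xᶜ + total w₂ X = total w₁ Finset.univ + ∑ e ∈ X, (w₂ e - w₁ e) := by
  have := Finset.sum_compl_add_sum X w₁
  simp only [total, Finset.sum_sub_distrib]
  linarith

/-- `T` is a possible bundle of the second buyer that maximizes the social welfare. -/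
structure IsOptimal (M₁ M₂ : Matroid S) (W : S → ℝ) (T : Finset S) : Prop where
  compl_mem : Tᶜ ∈ bases M₁
  mem : T ∈ bases M₂
  le : ∀ Z : Finset S, Zᶜ ∈ bases M₁ → Z ∈ bases M₂ → ∑ e ∈ Z, W e ≤ ∑ e ∈ T, W e

/-- Prices under which both buyers have a unique, welfare-maximizing favourite bundle. -/
theorem isPriceVector_of_strict (h : IsMate M₁ mate) (hE : M₂.E = Set.univ) {w₁ w₂ v : S → ℝ}
    {T Y : Finset S} (hT : IsOptimal M₁ M₂ (fun e => w₂ e - w₁ e) T)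
    (hY : IsOptimal M₁ M₂ (fun e => w₂ e - w₁ e) Y)
    (h2 : ∀ s ∈ Y, ∀ t, t ∉ Y → M₂.Indep (insert t (Y.erase s) : Finset S) → v t < v s)
    (h1 : ∀ t ∈ T, v t - (w₂ t - w₁ t) < v (mate t) - (w₂ (mate t) - w₁ (mate t))) :
    IsPriceVector M₁ M₂ w₁ w₂ fun e => w₂ e - v e := by
  constructor
  · rintro B ⟨hB, hmax⟩
    have hTc := h.compl_mem_bases.1 hT.compl_mem
    have hBm := (h.mem_bases B).1 hB
    -- The first buyer decides each pair separately: replacing `t` by its mate keeps a base and is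
    -- strictly better.
    have hdisj : ∀ t ∈ T, t ∉ B := by
      intro t ht htB
      have hp := mem_paired.1 (hTc.1 ht)
      have htB' := ((hBm t).2 hp).1 htB
      have hB' : insert (mate t) (B.erase t) ∈ bases M₁ := by
        rw [h.mem_bases]
        intro e
        have he := hBm e
        simp only [Finset.mem_insert, Finset.mem_erase]
        by_cases het : e = t
        · subst het
          simp [hp, Ne.symm hp]
        · by_cases hem : e = mate t
          · subst hem
            rw [h.invol t]
            simp [hp, Ne.symm hp]
          · have h3 : mate e ≠ mate t := fun h' => het (h.invol.injective h')
            have h4 : mate e ≠ t := fun h' => hem (by rw [← h', h.invol])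
            simp only [hem, h3, false_or, ne_eq, het, h4, not_false_eq_true, true_and]
            exact he
      have := hmax _ hB'
      simp only [total, sum_insert_erase htB htB'] at this
      have := h1 t ht
      linarith
    have hBT : B = Tᶜ := by
      ext e
      rw [Finset.mem_compl]
      constructor
      · exact fun he he' => hdisj e he' he
      · intro he
        by_cases hp : mate e = e
        · exact (hBm e).1 hp
        · rw [(hBm e).2 hp]
          refine hdisj _ ?_
          have := hTc.2 e (mem_paired.2 hp)
          tauto
    subst hBT
    refine ⟨⟨hB, by simpa using hT.mem⟩, ?_⟩
    rintro Z ⟨hZ1, hZ2⟩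
    have h3 := total_compl_add w₁ w₂ Zᶜ
    have h4 := total_compl_add w₁ w₂ T
    have h5 := hT.le Zᶜ (by simpa using hZ1) hZ2
    simp only [compl_compl] at h3 ⊢
    linarith
  · rintro B ⟨hB, hmax⟩
    have hval : ∀ Z : Finset S, total w₂ Z - total (fun e => w₂ e - v e) Z = ∑ e ∈ Z, v e := by
      intro Z
      simp [total, Finset.sum_sub_distrib]
    have hBY : B = Y := by
      by_contra hne
      have h3 := sum_lt_of_strictly_locally_optimal hE (Matroid.IsBase.indep hY.mem)
        (Matroid.IsBase.indep hB) (card_eq_of_mem_bases hY.mem hB) hne h2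
      have h4 := hmax Y hY.mem
      simp only [hval] at h4
      linarith
    subst hBY
    refine ⟨⟨hY.compl_mem, hB⟩, ?_⟩
    rintro Z ⟨hZ1, hZ2⟩
    have h3 := total_compl_add w₁ w₂ Z
    have h4 := total_compl_add w₁ w₂ B
    have h5 := hY.le Z hZ1 hZ2
    linarith

/-- The potential that separates the favourite bundles of the two buyers. -/
def separated (mate : S → S) (T Y : Finset S) (u : S → ℝ) (c : ℝ) (e : S) : ℝ :=
  if e ∈ Y then 2 * u e else if mate e = e then -c else if e ∈ T then 2 * u e - c else 2 * u e - 1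

lemma Extreme.mem_bases {R : Type*} [CommRing R] [LinearOrder R] [IsStrictOrderedRing R]
    {W u : S → R} {Y Z : Finset S} (h : IsMate M₁ mate)
    (hE : M₂.E = Set.univ) (hY : Extreme M₂ mate W u (paired mate) Y) (hZ1 : Zᶜ ∈ bases M₁)
    (hZ2 : Z ∈ bases M₂) : Yᶜ ∈ bases M₁ ∧ Y ∈ bases M₂ ∧ ∑ e ∈ Z, W e ≤ ∑ e ∈ Y, W e := by
  have hZ := h.compl_mem_bases.1 hZ1
  have := hY.sum_le hE h.invol hZ.1 (Matroid.IsBase.indep hZ2) hZ.2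
  exact ⟨h.compl_mem_bases.2 ⟨hY.sub, hY.trans⟩,
    mem_bases_of_indep_of_card hY.indep hZ2 this.1, this.2⟩

/-- The first buyer is steered to the complement of `T`, the second to `Y`. Doubling `u` turns the
slack `1` gained from the bonus into `2`, of which the penalty `1` outside `Y` uses only half, so
both preferences become strict. The bounds on `c` dispose of the one-element classes and of `T \ Y`.
-/
theorem isPriceVector_of_extreme (h : IsMate M₁ mate) (hE : M₂.E = Set.univ) {w₁ w₂ u : S → ℝ}
    {T Y : Finset S} (hT : IsOptimal M₁ M₂ (fun e => w₂ e - w₁ e) T) {N c : ℝ} (hN : 0 < N)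
    (hgap : ∀ Z : Finset S, ∑ e ∈ Z, (w₂ e - w₁ e) < ∑ e ∈ T, (w₂ e - w₁ e) →
      (Fintype.card S : ℝ) < N * (∑ e ∈ T, (w₂ e - w₁ e) - ∑ e ∈ Z, (w₂ e - w₁ e)))
    (hY : Extreme M₂ mate (fun e => N * (w₂ e - w₁ e) + if e ∈ T then 0 else 1) u
      (paired mate) Y)
    (hc1 : ∀ e ∈ paired mate, -c < 2 * u e)
    (hc2 : ∀ e ∈ paired mate, 2 * u e - 2 * u (mate e) -
      2 * (N * (w₂ e - w₁ e) - N * (w₂ (mate e) - w₁ (mate e))) < c) :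
    IsPriceVector M₁ M₂ w₁ w₂ fun e => w₂ e - separated mate T Y u c e / (2 * N) := by
  obtain ⟨hY1, hY2, hle⟩ := hY.mem_bases h hE hT.compl_mem hT.mem
  have hYopt : IsOptimal M₁ M₂ (fun e => w₂ e - w₁ e) Y := by
    refine ⟨hY1, hY2, fun Z hZ1 hZ2 => (hT.le Z hZ1 hZ2).trans ?_⟩
    -- `T` receives no bonus and `Y` at most `Fintype.card S`, which cannot make up for the loss
    -- that `hgap` assigns to a suboptimal set.
    by_contra! hlt
    have h1 := hgap Y hlt
    rw [Finset.sum_add_distrib, Finset.sum_add_distrib, ← Finset.mul_sum, ← Finset.mul_sum,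
      Finset.sum_eq_zero (s := T) (f := fun e => if e ∈ T then (0 : ℝ) else 1)
        (fun e he => if_pos he)] at hle
    have h2 : ∑ e ∈ Y, (if e ∈ T then (0 : ℝ) else 1) ≤ Fintype.card S := by
      calc ∑ e ∈ Y, (if e ∈ T then (0 : ℝ) else 1) ≤ ∑ e ∈ Y, (1 : ℝ) :=
            Finset.sum_le_sum fun e _ => by split_ifs <;> norm_num
        _ = Y.card := by simp
        _ ≤ _ := by exact_mod_cast Finset.card_le_univ Y
    rw [mul_sub] at h1
    linarith
  have hYc := h.compl_mem_bases.1 hY1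
  have hTc := h.compl_mem_bases.1 hT.compl_mem
  refine isPriceVector_of_strict h hE hT hYopt ?_ ?_
  · intro s hs t ht hI
    have : separated mate T Y u c t < separated mate T Y u c s := by
      simp only [separated, if_pos hs, if_neg ht]
      have hsp := hYc.1 hs
      have h1 := hc1 s hsp
      by_cases hp : mate t = t
      · rw [if_pos hp]; exact h1
      · rw [if_neg hp]
        have h2 := hY.exch s hs t (mem_paired.2 hp) ht hI
        have h3 := hc1 t (mem_paired.2 hp)
        split_ifs with htT
        -- Adding the bounds for `t` and for its mate gives `0 < c`.
        · have h4 := hc2 t (mem_paired.2 hp)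
          have h5 := hc2 (mate t) (h.mate_mem_paired (mem_paired.2 hp))
          rw [h.invol] at h5
          linarith
        · linarith
    exact div_lt_div_of_pos_right this (by positivity)
  · intro t ht
    have hp := hTc.1 ht
    have hp' := mem_paired.1 hp
    have hmp := h.mate_mem_paired hp
    have hmT : mate t ∉ T := (hTc.2 t hp).1 ht
    have key : separated mate T Y u c t - 2 * N * (w₂ t - w₁ t) <
        separated mate T Y u c (mate t) - 2 * N * (w₂ (mate t) - w₁ (mate t)) := by
      simp only [separated, h.invol t, if_neg hp', if_neg hp'.symm, if_pos ht, if_neg hmT]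
      -- If `t` stays in `Y` although only its mate has the bonus, the pair inequality is strict for
      -- `N * (w₂ - w₁)`. If it does not, the large penalty `c` decides.
      by_cases htY : t ∈ Y
      · have hmY := (hYc.2 t hp).1 htY
        rw [if_pos htY, if_neg hmY]
        have := hY.pair t htY
        simp only [if_pos ht, if_neg hmT] at this
        linarith
      · have hmY : mate t ∈ Y := by
          have := hYc.2 t hp
          tauto
        rw [if_neg htY, if_pos hmY]
        have := hc2 t hp
        linarith
    have h2N : (0 : ℝ) < 2 * N := by positivity
    rw [← sub_pos] at key ⊢
    have : separated mate T Y u c (mate t) / (2 * N) - (w₂ (mate t) - w₁ (mate t)) -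
        (separated mate T Y u c t / (2 * N) - (w₂ t - w₁ t)) =
        (separated mate T Y u c (mate t) - 2 * N * (w₂ (mate t) - w₁ (mate t)) -
        (separated mate T Y u c t - 2 * N * (w₂ t - w₁ t))) / (2 * N) := by
      field_simp
    rw [this]
    exact div_pos key h2N

theorem exists_isPriceVector {M₁ M₂ : Matroid S} (w₁ w₂ : S → ℝ) (hM : IsMarket M₁ M₂) :
    ∃ p : S → ℝ, IsPriceVector M₁ M₂ w₁ w₂ p := by
  obtain ⟨⟨P, hP, hPM⟩, hE, B₁, hB₁, B₂, hB₂, hd, hU⟩ := hM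
  obtain ⟨mate, h⟩ := exists_isMate hP hPM
  have hB₂c : B₂ᶜ = B₁ := by
    rw [compl_eq_comm]
    exact (IsCompl.compl_eq ⟨hd, codisjoint_iff.2 hU⟩)
  have hB₂1 : B₂ᶜ ∈ bases M₁ := by rwa [hB₂c]
  have hext : ∀ W : S → ℝ, ∃ u X, Extreme M₂ mate W u (paired mate) X := fun W =>
    exists_extreme hE h.invol W (Matroid.IsBase.indep hB₂) _ _ rfl (fun e => h.mate_mem_paired)
      (fun e => mem_paired.1) (h.compl_mem_bases.1 hB₂1).2
  obtain ⟨u₀, T, hT₀⟩ := hext fun e => w₂ e - w₁ e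
  obtain ⟨hT1, hT2, _⟩ := hT₀.mem_bases h hE hB₂1 hB₂
  have hT : IsOptimal M₁ M₂ (fun e => w₂ e - w₁ e) T :=
    ⟨hT1, hT2, fun Z hZ1 hZ2 => (hT₀.mem_bases h hE hZ1 hZ2).2.2⟩
  -- There are only finitely many sets, so one large `N` serves all of them.
  obtain ⟨N, hN, hgap⟩ : ∃ N : ℝ, 0 < N ∧
      ∀ Z : Finset S, ∑ e ∈ Z, (w₂ e - w₁ e) < ∑ e ∈ T, (w₂ e - w₁ e) →
      (Fintype.card S : ℝ) < N * (∑ e ∈ T, (w₂ e - w₁ e) - ∑ e ∈ Z, (w₂ e - w₁ e)) := by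
    have : ∀ᶠ N : ℝ in Filter.atTop, ∀ Z : Finset S,
        ∑ e ∈ Z, (w₂ e - w₁ e) < ∑ e ∈ T, (w₂ e - w₁ e) →
        (Fintype.card S : ℝ) < N * (∑ e ∈ T, (w₂ e - w₁ e) - ∑ e ∈ Z, (w₂ e - w₁ e)) := by
      rw [Filter.eventually_all]
      intro Z
      by_cases hZ : ∑ e ∈ Z, (w₂ e - w₁ e) < ∑ e ∈ T, (w₂ e - w₁ e)
      · have := (Filter.tendsto_id.atTop_mul_const (sub_pos.2 hZ)).eventually_gt_atTop
          (Fintype.card S : ℝ)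
        exact this.mono fun N hN _ => hN
      · exact Filter.Eventually.of_forall fun N hN => absurd hN hZ
    exact ((Filter.eventually_gt_atTop 0).and this).exists
  obtain ⟨u, Y, hY⟩ := hext fun e => N * (w₂ e - w₁ e) + if e ∈ T then 0 else 1
  obtain ⟨c, hc⟩ : ∃ c : ℝ, ∀ e, -c < 2 * u e ∧ 2 * u e - 2 * u (mate e) -
      2 * (N * (w₂ e - w₁ e) - N * (w₂ (mate e) - w₁ (mate e))) < c := by
    have : ∀ᶠ c : ℝ in Filter.atTop, ∀ e, -c < 2 * u e ∧ 2 * u e - 2 * u (mate e) -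
        2 * (N * (w₂ e - w₁ e) - N * (w₂ (mate e) - w₁ (mate e))) < c := by
      rw [Filter.eventually_all]
      intro e
      filter_upwards [Filter.eventually_gt_atTop (-(2 * u e)), Filter.eventually_gt_atTop
        (2 * u e - 2 * u (mate e) -
          2 * (N * (w₂ e - w₁ e) - N * (w₂ (mate e) - w₁ (mate e))))] with c h1 h2
      exact ⟨by linarith, h2⟩
    exact this.exists
  exact ⟨_, isPriceVector_of_extreme h hE hT hN hgap hY (fun e _ => (hc e).1)
    (fun e _ => (hc e).2)⟩

end Prices

end Pricing

namespace OracleRAM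

/-! ### Bit lengths and the cost of expressions -/

lemma bits_le_bits {x y : ℤ} (h : |x| ≤ |y|) : bits x ≤ bits y :=
  Nat.size_le_size (by rwa [Int.abs_eq_natAbs, Int.abs_eq_natAbs, Int.ofNat_le] at h)

lemma bits_le_iff {x : ℤ} {b : ℕ} : bits x ≤ b ↔ |x| < 2 ^ b := by
  rw [bits, Nat.size_le, ← Int.natCast_natAbs]
  exact_mod_cast Iff.rfl

lemma abs_lt_two_pow_bits (x : ℤ) : |x| < 2 ^ bits x := bits_le_iff.1 le_rfl

lemma bits_mul_le (x y : ℤ) : bits (x * y) ≤ bits x + bits y := by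
  rw [bits_le_iff, abs_mul, pow_add]
  exact mul_lt_mul'' (abs_lt_two_pow_bits x) (abs_lt_two_pow_bits y) (abs_nonneg _) (abs_nonneg _)

lemma bits_le_of_abs_le_add {x y z : ℤ} (h : |z| ≤ |x| + |y|) : bits z ≤ bits x + bits y + 1 := by
  rw [bits_le_iff]
  have h1 := abs_lt_two_pow_bits x
  have h2 := abs_lt_two_pow_bits y
  have h3 : (2 : ℤ) ^ bits x ≤ 2 ^ (bits x + bits y) := pow_le_pow_right₀ (by norm_num) (by omega)
  have h4 : (2 : ℤ) ^ bits y ≤ 2 ^ (bits x + bits y) := pow_le_pow_right₀ (by norm_num) (by omega)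
  rw [pow_succ]
  linarith

lemma BinOp.bits_eval_le (o : BinOp) (x y : ℤ) : bits (o.eval x y) ≤ bits x + bits y + 1 := by
  have hone : ∀ p : Prop, [Decidable p] → bits (if p then 1 else 0) ≤ 1 := by
    intro p _
    split_ifs <;> simp [bits]
  cases o with
  | add => exact bits_le_of_abs_le_add (abs_add_le x y)
  | sub => exact bits_le_of_abs_le_add (abs_sub x y)
  | mul => exact (bits_mul_le x y).trans (Nat.le_succ _)
  | div =>
    have : bits (x / y) ≤ bits x := bits_le_bits (Int.abs_ediv_le_abs x y)
    change bits (x / y) ≤ _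
    omega
  | mod =>
    refine bits_le_of_abs_le_add ?_
    change |x % y| ≤ _
    -- For modulus zero the remainder is `x` itself.
    rcases eq_or_ne y 0 with rfl | hy
    · simp
    · rw [abs_of_nonneg (Int.emod_nonneg x hy)]
      have := Int.emod_lt_abs x hy
      have := abs_nonneg x
      linarith
  | le => exact (hone _).trans (by omega)
  | eq => exact (hone _).trans (by omega)

/-- Every cell holds a number of absolute value at most `Z`. -/
def Bdd (Z : ℤ) (σ : Store) : Prop := ∀ a i, |σ a i| ≤ Z

/-- Bounds the bit length of the value relative to that of the memory cells. -/
def Exp.wt : Exp → ℕ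
  | const z => bits z + 1
  | get _ _ => 1
  | op _ e₁ e₂ => e₁.wt + e₂.wt + 1

/-- Bounds the cost relative to the bit length of the memory cells. -/
def Exp.tm : Exp → ℕ
  | const z => 1 + bits z
  | get _ e => e.tm + 1
  | op o e₁ e₂ => e₁.tm + e₂.tm + 1 + (op o e₁ e₂).wt

lemma Bdd.nonneg {Z : ℤ} {σ : Store} (h : Bdd Z σ) : 0 ≤ Z := (abs_nonneg _).trans (h 0 0)

lemma Bdd.bits_le {Z : ℤ} {σ : Store} (h : Bdd Z σ) (a : ℕ) (i : ℤ) : bits (σ a i) ≤ bits Z :=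
  bits_le_bits ((h a i).trans (le_abs_self Z))

/-- Each operation, multiplication included, at most adds the bit lengths of its operands plus one.
So the values inside a fixed expression have bit length linear in that of the memory cells. -/
lemma Exp.bits_eval_le {Z : ℤ} {σ : Store} (h : Bdd Z σ) (e : Exp) :
    bits (e.eval σ) ≤ e.wt * (bits Z + 1) := by
  induction e with
  | const z =>
    simp only [Exp.eval, Exp.wt]
    nlinarith
  | get a e _ =>
    simp only [Exp.eval, Exp.wt]
    have := h.bits_le a (e.eval σ)
    omega
  | op o e₁ e₂ ih₁ ih₂ =>
    simp only [Exp.eval, Exp.wt]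
    have := o.bits_eval_le (e₁.eval σ) (e₂.eval σ)
    nlinarith

lemma Exp.cost_le {Z : ℤ} {σ : Store} (h : Bdd Z σ) (e : Exp) :
    e.cost σ ≤ e.tm * (bits Z + 1) := by
  induction e with
  | const z =>
    simp only [Exp.cost, Exp.tm]
    nlinarith
  | get a e ih =>
    simp only [Exp.cost, Exp.tm, Exp.eval]
    have := h.bits_le a (e.eval σ)
    linarith
  | op o e₁ e₂ ih₁ ih₂ =>
    have := Exp.bits_eval_le h (op o e₁ e₂)
    simp only [Exp.cost, Exp.tm]
    nlinarith

/-! ### Total correctness with time bounds -/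

/-- The running time relative to the bit length of the memory cells, if all loops are executed at
most `n` times. -/
def Prog.tm (n : ℕ) : Prog → ℕ
  | skip => 1
  | assign _ i e => i.tm + e.tm + 1
  | query _ _ _ => n + 1
  | seq c₁ c₂ => c₁.tm n + c₂.tm n + 1
  | cond e c₁ c₂ => e.tm + c₁.tm n + c₂.tm n + 1
  | loop e c => (n + 1) * (e.tm + c.tm n + 1)

/-- The arrays that a program may write to. -/
def Prog.mods : Prog → List ℕ
  | skip => []
  | assign a _ _ => [a]
  | query _ _ b => [b]
  | seq c₁ c₂ => c₁.mods ++ c₂.mods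
  | cond _ c₁ c₂ => c₁.mods ++ c₂.mods
  | loop _ c => c.mods

section

variable {n : ℕ} {O : Fin 2 → Finset (Fin n) → Prop} {Z : ℤ} {Q Q' : Store → Prop} {σ : Store}

lemma Store.set_self (σ : Store) (a : ℕ) (i v : ℤ) :
    σ.set a i v a = Function.update (σ a) i v := by
  simp [Store.set]

lemma Store.set_of_ne (σ : Store) {a b : ℕ} (h : b ≠ a) (i v : ℤ) : σ.set a i v b = σ b := by
  simp [Store.set, h]

lemma Exec.frame {c : Prog} {σ σ' : Store} {t : ℕ} (h : Exec O c σ t σ') :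
    ∀ a, a ∉ c.mods → σ' a = σ a := by
  induction h with
  | skip => exact fun _ _ => rfl
  | assign σ a i e => exact fun b hb => σ.set_of_ne (by simpa [Prog.mods] using hb) _ _
  | query_accept σ j a b _ => exact fun c hc => σ.set_of_ne (by simpa [Prog.mods] using hc) _ _
  | query_reject σ j a b _ => exact fun c hc => σ.set_of_ne (by simpa [Prog.mods] using hc) _ _
  | seq _ _ ih₁ ih₂ =>
    intro a ha
    simp only [Prog.mods, List.mem_append, not_or] at ha
    rw [ih₂ a ha.2, ih₁ a ha.1]
  | cond_then _ _ ih =>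
    intro a ha
    simp only [Prog.mods, List.mem_append, not_or] at ha
    exact ih a ha.1
  | cond_else _ _ ih =>
    intro a ha
    simp only [Prog.mods, List.mem_append, not_or] at ha
    exact ih a ha.2
  | loop_done => exact fun _ _ => rfl
  | loop_step _ _ _ ih₁ ih₂ =>
    intro a ha
    rw [ih₂ a ha, ih₁ a ha]

/-- Started on `σ`, the program halts in time and with cells bounded by `Z`, and `Q` holds for the
final memory, if the cells are bounded by `Z` initially. -/
def WP (O : Fin 2 → Finset (Fin n) → Prop) (Z : ℤ) (c : Prog) (Q : Store → Prop) (σ : Store) :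
    Prop :=
  Bdd Z σ → ∃ t σ', Exec O c σ t σ' ∧ t ≤ c.tm n * (bits Z + 1) ∧ Bdd Z σ' ∧ Q σ'

lemma Bdd.set (h : Bdd Z σ) {a : ℕ} {i v : ℤ} (hv : |v| ≤ Z) : Bdd Z (σ.set a i v) := by
  intro b j
  by_cases hb : b = a
  · subst hb
    rw [Store.set_self]
    by_cases hj : j = i
    · subst hj; simpa using hv
    · simpa [hj] using h b j
  · rw [Store.set_of_ne _ hb]
    exact h b j

/-- The consequence rule has the frame property built in: the new postcondition may use that
unwritten arrays are unchanged. For a concrete program, membership in `Prog.mods` is settled by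
`decide`. -/
lemma WP.mono {c : Prog} (h : WP O Z c Q σ)
    (hQ : ∀ σ', (∀ a, a ∉ c.mods → σ' a = σ a) → Q σ' → Q' σ') : WP O Z c Q' σ := by
  intro hb
  obtain ⟨t, σ', hE, ht, hb', hq⟩ := h hb
  exact ⟨t, σ', hE, ht, hb', hQ σ' hE.frame hq⟩

lemma WP.skip (h : Q σ) : WP O Z .skip Q σ := fun hb =>
  ⟨1, σ, .skip σ, by simp [Prog.tm], hb, h⟩

lemma WP.assign {a : ℕ} {i e : Exp} (hv : |e.eval σ| ≤ Z)
    (h : Q (σ.set a (i.eval σ) (e.eval σ))) : WP O Z (.assign a i e) Q σ := fun hb =>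
  ⟨_, _, .assign σ a i e, by
    have h1 := Exp.cost_le hb i
    have h2 := Exp.cost_le hb e
    simp only [Prog.tm]
    nlinarith, hb.set hv, h⟩

open Classical in
lemma WP.query {j : Fin 2} {a b : ℕ} (hZ : 1 ≤ Z)
    (h : Q (σ.set b 0 (if O j (σ.subset n a) then 1 else 0))) : WP O Z (.query j a b) Q σ := by
  intro hb
  have ht : n + 1 ≤ (Prog.query j a b).tm n * (bits Z + 1) := by
    simp only [Prog.tm]
    nlinarith
  by_cases hO : O j (σ.subset n a)
  · rw [if_pos hO] at h
    exact ⟨_, _, .query_accept σ j a b hO, ht, hb.set (by simpa using hZ), h⟩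
  · rw [if_neg hO] at h
    exact ⟨_, _, .query_reject σ j a b hO, ht, hb.set (by simpa using hb.nonneg), h⟩

lemma WP.seq {c₁ c₂ : Prog} (h : WP O Z c₁ (WP O Z c₂ Q) σ) : WP O Z (.seq c₁ c₂) Q σ := by
  intro hb
  obtain ⟨t₁, σ₁, hE₁, ht₁, hb₁, h₁⟩ := h hb
  obtain ⟨t₂, σ₂, hE₂, ht₂, hb₂, h₂⟩ := h₁ hb₁
  refine ⟨_, _, hE₁.seq hE₂, ?_, hb₂, h₂⟩
  simp only [Prog.tm]
  nlinarith

lemma WP.cond {e : Exp} {c₁ c₂ : Prog} (h₁ : e.eval σ ≠ 0 → WP O Z c₁ Q σ)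
    (h₂ : e.eval σ = 0 → WP O Z c₂ Q σ) : WP O Z (.cond e c₁ c₂) Q σ := by
  intro hb
  have he := Exp.cost_le hb e
  by_cases h0 : e.eval σ = 0
  · obtain ⟨t, σ', hE, ht, hb', h⟩ := h₂ h0 hb
    refine ⟨_, _, .cond_else h0 hE, ?_, hb', h⟩
    simp only [Prog.tm]
    nlinarith
  · obtain ⟨t, σ', hE, ht, hb', h⟩ := h₁ h0 hb
    refine ⟨_, _, .cond_then h0 hE, ?_, hb', h⟩
    simp only [Prog.tm]
    nlinarith

/-- A loop that is executed exactly `m ≤ n` times. -/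
lemma WP.loop {e : Exp} {c : Prog} (I : ℕ → Store → Prop) {m : ℕ} (hm : m ≤ n)
    (hstep : ∀ k < m, ∀ σ', I k σ' → e.eval σ' ≠ 0 ∧ WP O Z c (I (k + 1)) σ')
    (hdone : ∀ σ', I m σ' → e.eval σ' = 0 ∧ Q σ') (h0 : I 0 σ) : WP O Z (.loop e c) Q σ := by
  -- Induction on the number `j` of remaining rounds; the extra `1` pays for the final test of the
  -- condition.
  have key : ∀ j ≤ m, ∀ σ, Bdd Z σ → I (m - j) σ → ∃ t σ', Exec O (.loop e c) σ t σ' ∧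
      t ≤ (j + 1) * (e.tm + c.tm n + 1) * (bits Z + 1) ∧ Bdd Z σ' ∧ Q σ' := by
    intro j
    induction j with
    | zero =>
      intro _ σ hb hI
      obtain ⟨he, hq⟩ := hdone σ hI
      refine ⟨_, _, .loop_done he, ?_, hb, hq⟩
      have := Exp.cost_le hb e
      nlinarith
    | succ j ih =>
      intro hj σ hb hI
      obtain ⟨he, hc⟩ := hstep (m - (j + 1)) (by omega) σ hI
      obtain ⟨t₁, σ₁, hE₁, ht₁, hb₁, h₁⟩ := hc hb
      rw [show m - (j + 1) + 1 = m - j by omega] at h₁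
      obtain ⟨t₂, σ₂, hE₂, ht₂, hb₂, h₂⟩ := ih (by omega) σ₁ hb₁ h₁
      refine ⟨_, _, .loop_step he hE₁ hE₂, ?_, hb₂, h₂⟩
      have := Exp.cost_le hb e
      nlinarith
  intro hb
  obtain ⟨t, σ', hE, ht, hb', h⟩ := key m le_rfl σ hb (by simpa using h0)
  refine ⟨t, σ', hE, ht.trans ?_, hb', h⟩
  simp only [Prog.tm]
  gcongr

/-- Cell `0` of an array, used as a variable. -/
abbrev var (a : ℕ) : Exp := .get a (.const 0)

/-- Run `c` with the variable `i` running through `0, …, n - 1`. -/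
def forN (i : ℕ) (c : Prog) : Prog :=
  .seq (.assign i (.const 0) (.const 0))
    (.loop (.op .le (.op .add (var i) (.const 1)) (var 0))
      (.seq c (.assign i (.const 0) (.op .add (var i) (.const 1)))))

/-- The rule itself maintains the counter and the frame, so `I` has to be insensitive to the counter
(`hI`) and the body must write neither to it nor to array `0`. -/
lemma WP.forN {i : ℕ} {c : Prog} (I : ℕ → Store → Prop) (hi : i ≠ 0) (hic : i ∉ c.mods)
    (h0c : 0 ∉ c.mods) (hσ : σ 0 0 = n) (hZ : (n : ℤ) ≤ Z) (hI : ∀ k σ v, I k σ → I k (σ.set i 0 v))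
    (h0 : I 0 σ)
    (hstep : ∀ k < n, ∀ σ' : Store, (∀ a, a ∉ i :: c.mods → σ' a = σ a) → σ' i 0 = (k : ℤ) →
      I k σ' →
      WP O Z c (I (k + 1)) σ') :
    WP O Z (OracleRAM.forN i c) (fun σ' => I n σ') σ := by
  have hn0 : (0 : ℤ) ≤ n := Int.natCast_nonneg n
  refine WP.seq (WP.assign (by simpa [Exp.eval] using hn0.trans hZ) ?_)
  have hfr : ∀ (σ' : Store), (∀ a, a ∉ i :: c.mods → σ' a = σ a) → σ' 0 0 = n := by
    intro σ' h
    rw [h 0 (by simp [hi.symm, h0c]), hσ]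
  refine WP.loop (fun k σ' => I k σ' ∧ σ' i 0 = k ∧ ∀ a, a ∉ i :: c.mods → σ' a = σ a)
    (m := n) le_rfl ?_ ?_ ?_
  · rintro k hk σ' ⟨hI', hk', hf⟩
    refine ⟨?_, ?_⟩
    · simp only [Exp.eval, BinOp.eval, hk', hfr σ' hf]
      rw [if_pos (by omega)]
      exact one_ne_zero
    · refine WP.seq ((hstep k hk σ' hf hk' hI').mono fun σ'' hf' hI'' => ?_)
      have hk'' : σ'' i 0 = k := by rw [hf' i hic, hk']
      refine WP.assign ?_ ⟨?_, ?_, ?_⟩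
      · simp only [Exp.eval, BinOp.eval, hk'']
        rw [abs_of_nonneg (by omega)]
        omega
      · exact hI _ _ _ hI''
      · simp [Exp.eval, BinOp.eval, hk'', Store.set_self]
      · intro a ha
        have ha' := ha
        simp only [List.mem_cons, not_or] at ha'
        rw [Store.set_of_ne _ ha'.1, hf' a ha'.2, hf a ha]
  · rintro σ' ⟨hI', hk', hf⟩
    refine ⟨?_, hI'⟩
    simp only [Exp.eval, BinOp.eval, hk', hfr σ' hf]
    rw [if_neg (by omega)]
  · refine ⟨hI _ _ _ h0, by simp [Exp.eval, Store.set_self], fun a ha => ?_⟩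
    simp only [List.mem_cons, not_or] at ha
    exact Store.set_of_ne _ ha.1 _ _

/-! ### Arrays indexed by the ground set -/

lemma arrayOf_apply {n : ℕ} (f : Fin n → ℤ) (e : Fin n) : arrayOf f ((e : ℕ) : ℤ) = f e := by
  simp [arrayOf]

lemma update_arrayOf {n : ℕ} (f : Fin n → ℤ) (e : Fin n) (v : ℤ) :
    Function.update (arrayOf f) ((e : ℕ) : ℤ) v = arrayOf (Function.update f e v) := by
  funext i
  by_cases hi : i = ((e : ℕ) : ℤ)
  · subst hi
    rw [Function.update_self, arrayOf_apply, Function.update_self]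
  · rw [Function.update_of_ne hi]
    unfold arrayOf
    split_ifs with h
    · rw [Function.update_of_ne]
      rintro rfl
      apply hi
      simp [h.1]
    · rfl

/-- The indicator array of a set. -/
def ind {n : ℕ} (X : Finset (Fin n)) : ℤ → ℤ := arrayOf fun e => if e ∈ X then 1 else 0

lemma ind_apply {n : ℕ} (X : Finset (Fin n)) (e : Fin n) :
    ind X ((e : ℕ) : ℤ) = if e ∈ X then 1 else 0 := arrayOf_apply _ e

lemma update_ind_one {n : ℕ} (X : Finset (Fin n)) (e : Fin n) :
    Function.update (ind X) ((e : ℕ) : ℤ) 1 = ind (insert e X) := by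
  rw [ind, update_arrayOf, ind]
  congr 1
  funext f
  by_cases h : f = e
  · subst h; simp
  · simp [h]

lemma update_ind_zero {n : ℕ} (X : Finset (Fin n)) (e : Fin n) :
    Function.update (ind X) ((e : ℕ) : ℤ) 0 = ind (X.erase e) := by
  rw [ind, update_arrayOf, ind]
  congr 1
  funext f
  by_cases h : f = e
  · subst h; simp
  · simp [h]

lemma subset_eq {n : ℕ} {σ : Store} {a : ℕ} {X : Finset (Fin n)} (h : σ a = ind X) :
    σ.subset n a = X := by
  ext e
  simp [Store.subset, h, ind_apply]

end

end OracleRAM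

namespace OracleRAM

/-! ### The program

Arrays `7` common denominator, `8` integral weights, `9` mates, `10` covered elements, `11` current
set, `12` potential, `13`–`16`, `18` search tree (nodes, distances, predecessors, indicator of the
nodes, number of nodes), `17` bound on the potential, `24`–`27` current minimum, `28` raise, `29`
position on the path, `30` first optimum; `19`, `31`, `34` auxiliary; `20`–`23`, `32`, `33` loop
counters. -/

instance : Add Exp := ⟨.op .add⟩
instance : Sub Exp := ⟨.op .sub⟩
instance : Mul Exp := ⟨.op .mul⟩
instance : Div Exp := ⟨.op .div⟩

section

variable (σ : Store)

lemma eval_add (e₁ e₂ : Exp) : (e₁ + e₂).eval σ = e₁.eval σ + e₂.eval σ := rfl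
lemma eval_sub (e₁ e₂ : Exp) : (e₁ - e₂).eval σ = e₁.eval σ - e₂.eval σ := rfl
lemma eval_mul (e₁ e₂ : Exp) : (e₁ * e₂).eval σ = e₁.eval σ * e₂.eval σ := rfl
lemma eval_div (e₁ e₂ : Exp) : (e₁ / e₂).eval σ = e₁.eval σ / e₂.eval σ := rfl
lemma eval_le (e₁ e₂ : Exp) :
    (Exp.op .le e₁ e₂).eval σ = if e₁.eval σ ≤ e₂.eval σ then 1 else 0 := rfl
lemma eval_eq (e₁ e₂ : Exp) :
    (Exp.op .eq e₁ e₂).eval σ = if e₁.eval σ = e₂.eval σ then 1 else 0 := rfl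
lemma eval_get (a : ℕ) (e : Exp) : (Exp.get a e).eval σ = σ a (e.eval σ) := rfl
lemma eval_const (z : ℤ) : (Exp.const z).eval σ = z := rfl

end

infixr:60 "⨟" => Prog.seq

/-- Assign to a variable. -/
abbrev setVar (a : ℕ) (e : Exp) : Prog := .assign a (.const 0) e

/-- Compute the product of all denominators. -/
def progDen : Prog :=
  setVar 7 (.const 1) ⨟ forN 32 (setVar 7 (var 7 * (.get 2 (var 32) * .get 4 (var 32))))

/-- Compute the integral weights. -/
def progWeights : Prog :=
  forN 32 (.assign 8 (var 32)
    (.get 3 (var 32) * (var 7 / .get 4 (var 32)) - .get 1 (var 32) * (var 7 / .get 2 (var 32))))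

/-- Ask whether `s` and `t` form an independent pair. -/
def progProbePair : Prog :=
  .assign 31 (var 32) (.const 1) ⨟ .assign 31 (var 33) (.const 1) ⨟ .query 0 31 19 ⨟
  .assign 31 (var 32) (.const 0) ⨟ .assign 31 (var 33) (.const 0)

/-- Store `t` as the mate of `s` if it is. -/
def progTestPair : Prog :=
  .cond (.op .eq (var 32) (var 33)) .skip
    (progProbePair ⨟ .cond (var 19) .skip (.assign 9 (var 32) (var 33)))

/-- Compute the mates. -/
def progMates : Prog :=
  forN 32 (.assign 9 (var 32) (var 32) ⨟ forN 33 progTestPair)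

/-- Start with the empty set. -/
def progReset : Prog :=
  forN 32 (.assign 10 (var 32) (.const 0) ⨟ .assign 11 (var 32) (.const 0))

/-- Compute a bound on the weights. -/
def progBound : Prog :=
  setVar 17 (.const 1) ⨟ forN 32 (setVar 17 (var 17 + .get 8 (var 32) * .get 8 (var 32)))

/-- Choose a low potential for the new pair. -/
def progInitPot : Prog :=
  .assign 12 (var 20) (.get 8 (var 20) - .const 2 * var 17) ⨟
  .assign 12 (.get 9 (var 20)) (.get 8 (.get 9 (var 20)) - .const 2 * var 17)

/-- Start the search tree with the new pair. -/
def progInitTree : Prog :=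
  .assign 13 (.const 0) (var 20) ⨟ .assign 13 (.const 1) (.get 9 (var 20)) ⨟
  .assign 14 (.const 0) (.const 0) ⨟ .assign 14 (.const 1) (.const 0) ⨟ setVar 18 (.const 2)

/-- Mark the new pair. -/
def progInitMarks : Prog :=
  forN 32 (.assign 16 (var 32) (.const 0)) ⨟
  .assign 16 (var 20) (.const 1) ⨟ .assign 16 (.get 9 (var 20)) (.const 1) ⨟
  .assign 10 (var 20) (.const 1) ⨟ .assign 10 (.get 9 (var 20)) (.const 1)

/-- Start the search at the new pair. -/
def progInit : Prog := progInitPot ⨟ progInitTree ⨟ progInitMarks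

/-- The node number `k`. -/
abbrev node (k : Exp) : Exp := .get 13 k

/-- The condition under which the current minimum is replaced by variable `34`. -/
abbrev better : Exp := (.const 1 - var 24) + .op .le (var 34 + .const 1) (var 25)

/-- Ask whether there is an arc from node number `k` to `y`. -/
def progProbeArc : Prog :=
  .assign 11 (.get 9 (var 23)) (.const 0) ⨟ .assign 11 (node (var 22)) (.const 1) ⨟
  .query 1 11 19 ⨟
  .assign 11 (node (var 22)) (.const 0) ⨟ .assign 11 (.get 9 (var 23)) (.const 1)

/-- Compare one arc with the best arc found so far. -/
def progTestArc : Prog :=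
  progProbeArc ⨟
  .cond (var 19)
    (setVar 34 (.get 14 (var 22) + (.get 12 (var 23) - .get 12 (node (var 22)) +
        .get 8 (.get 9 (var 23)) - .get 8 (var 23))) ⨟
      .cond better
        (setVar 24 (.const 1) ⨟ setVar 25 (var 34) ⨟ setVar 26 (var 22) ⨟ setVar 27 (var 23))
        .skip)
    .skip

/-- Compare all arcs from node number `k`. -/
def progScanNode : Prog :=
  forN 23 (.cond (.get 10 (var 23) - .get 11 (var 23) - .get 16 (var 23)) progTestArc .skip)

/-- Find the best arc leaving the tree. -/
def progScan : Prog :=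
  setVar 24 (.const 0) ⨟
  forN 22 (.cond (.op .le (var 22 + .const 1) (var 18)) progScanNode .skip)

/-- Append the arc found to the tree. -/
def progAppend : Prog :=
  .assign 13 (var 18) (var 27) ⨟ .assign 14 (var 18) (var 25) ⨟ .assign 15 (var 18) (var 26) ⨟
  .assign 16 (var 27) (.const 1) ⨟ setVar 18 (var 18 + .const 1)

/-- Grow the tree as far as possible. -/
def progSearch : Prog := forN 21 (progScan ⨟ .cond (var 24) progAppend .skip)

/-- Ask whether node number `k` is a terminal. -/
def progProbeTerminal : Prog :=
  .assign 11 (node (var 22)) (.const 1) ⨟ .query 1 11 19 ⨟ .assign 11 (node (var 22)) (.const 0)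

/-- Compare one terminal with the best one found so far. -/
def progTestTerminal : Prog :=
  progProbeTerminal ⨟
  .cond (var 19)
    (setVar 34 (.get 14 (var 22) - .get 12 (node (var 22))) ⨟
      .cond better (setVar 24 (.const 1) ⨟ setVar 25 (var 34) ⨟ setVar 26 (var 22)) .skip)
    .skip

/-- Find the best terminal. -/
def progTerminal : Prog :=
  setVar 24 (.const 0) ⨟
  forN 22 (.cond (.op .le (var 22 + .const 1) (var 18)) progTestTerminal .skip) ⨟
  setVar 28 (var 25 + var 17)

/-- Raise the potential at node number `k` and its mate. -/
def progRaiseNode : Prog :=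
  -- The mate is treated before the node because its raise refers to the old potential of the node.
  -- Nodes `0` and `1` have no partner in the current set.
  .cond (.op .le (.const 2) (var 22))
    (setVar 34 (var 28 - .get 14 (var 22) + (.get 8 (.get 9 (node (var 22))) -
        .get 8 (node (var 22)) - .get 12 (.get 9 (node (var 22))) + .get 12 (node (var 22)))) ⨟
      .cond (.op .le (.const 1) (var 34))
        (.assign 12 (.get 9 (node (var 22))) (.get 12 (.get 9 (node (var 22))) + var 34)) .skip)
    .skip ⨟
  .cond (.op .le (.get 14 (var 22) + .const 1) (var 28))
    (.assign 12 (node (var 22)) (.get 12 (node (var 22)) + (var 28 - .get 14 (var 22)))) .skip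

/-- Raise the potential. -/
def progRaise : Prog :=
  forN 22 (.cond (.op .le (var 22 + .const 1) (var 18)) progRaiseNode .skip)

/-- Exchange along the path. -/
def progFlip : Prog :=
  setVar 29 (var 26) ⨟
  forN 22 (.cond (.op .le (.const 0) (var 29))
    (.assign 11 (node (var 29)) (.const 1) ⨟
      .cond (.op .le (.const 2) (var 29))
        (.assign 11 (.get 9 (node (var 29))) (.const 0) ⨟ setVar 29 (.get 15 (var 29)))
        -- The value `-1` marks that the root has been processed; the remaining rounds then do
        -- nothing.
        (setVar 29 (.const (-1))))
    .skip)

/-- Cover the pair of `a` if `a` is its first element. -/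
def progStage : Prog :=
  .cond (.op .le (var 20 + .const 1) (.get 9 (var 20)))
    (progInit ⨟ progSearch ⨟ progTerminal ⨟ progRaise ⨟ progFlip ⨟
      setVar 17 (var 17 * (.const 8 * var 0 + .const 16)))
    .skip

/-- Find an optimal transversal and a weight splitting. -/
def progIntersect : Prog := progReset ⨟ progBound ⨟ forN 20 progStage

/-- Store the optimum and modify the weights. -/
def progModify : Prog :=
  forN 32 (.assign 30 (var 32) (.get 11 (var 32)) ⨟
    .assign 8 (var 32)
      ((var 0 + .const 1) * .get 8 (var 32) + (.const 1 - .get 11 (var 32))))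

/-- Compute the separating potential of one element. -/
def progSeparate : Prog :=
  .cond (.get 11 (var 32)) (setVar 34 (.const 2 * .get 12 (var 32)))
    (.cond (.op .eq (.get 9 (var 32)) (var 32)) (setVar 34 (.const 0 - .const 16 * var 17))
      (.cond (.get 30 (var 32))
        (setVar 34 (.const 2 * .get 12 (var 32) - .const 16 * var 17))
        (setVar 34 (.const 2 * .get 12 (var 32) - .const 1))))

/-- Compute the prices. -/
def progOutput : Prog :=
  forN 32 (progSeparate ⨟
    .assign 5 (var 32) (.get 3 (var 32) * (var 7 / .get 4 (var 32)) *
      (.const 2 * (var 0 + .const 1)) - var 34) ⨟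
    .assign 6 (var 32) (var 7 * (.const 2 * (var 0 + .const 1))))

/-- Compute the integral weights and the mates. -/
def progPrepare : Prog := progDen ⨟ progWeights ⨟ progMates

/-- Find an optimum and then an optimum for the modified weights. -/
def progSolve : Prog := progIntersect ⨟ progModify ⨟ progIntersect

/-- The pricing algorithm. -/
def progPricing : Prog := progPrepare ⨟ progSolve ⨟ progOutput

end OracleRAM

namespace OracleRAM

open Pricing

/-! ### Growing the tree -/

/-- The registers hold the minimum of `val` over `C`; among the minimizers, the rank of the recorded
one is minimal. -/
def Argmin {ι : Type*} (C : ι → Prop) (val : ι → ℤ) (rk : ι → ℕ) (found best : ℤ)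
    (R : ι → Prop) : Prop :=
  (found = 0 ∧ ∀ i, ¬ C i) ∨ (found = 1 ∧ ∃ i, C i ∧ best = val i ∧ R i ∧
    ∀ i', C i' → val i ≤ val i' ∧ (rk i' < rk i → val i < val i'))

section Argmin

variable {ι : Type*} {C C' : ι → Prop} {val : ι → ℤ} {rk : ι → ℕ} {found best : ℤ}
  {R R' : ι → Prop}

lemma Argmin.congr (h : Argmin C val rk found best R) (hC : ∀ i, C' i ↔ C i) :
    Argmin C' val rk found best R := by
  have : C' = C := funext fun i => propext (hC i)
  rwa [this]

lemma Argmin.better_iff (h : Argmin C val rk found best R) (v : ℤ) :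
    1 - found + (if v + 1 ≤ best then 1 else 0) ≠ 0 ↔ found = 0 ∨ v < best := by
  have : found = 0 ∨ found = 1 := h.imp And.left And.left
  rcases this with h | h <;> subst h <;> split_ifs with h1 <;> constructor <;> intro h2 <;>
    omega

lemma Argmin.replace (h : Argmin C val rk found best R) {i₀ : ι}
    (hb : found = 0 ∨ val i₀ < best) (hR : R' i₀) (hC : ∀ i, C' i ↔ C i ∨ i = i₀) :
    Argmin C' val rk 1 (val i₀) R' := by
  refine Or.inr ⟨rfl, i₀, (hC _).2 (Or.inr rfl), rfl, hR, fun i hi => ?_⟩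
  rcases (hC i).1 hi with hi | rfl
  · rcases h with ⟨_, h⟩ | ⟨h1, j, hj, hbj, _, hmin⟩
    · exact absurd hi (h i)
    · have hlt : val i₀ < best := by
        rcases hb with hb | hb
        · omega
        · exact hb
      have := (hmin i hi).1
      exact ⟨by omega, fun _ => by omega⟩
  · exact ⟨le_rfl, fun h => absurd h (lt_irrefl _)⟩

/-- Candidates arrive in order of nondecreasing rank, so keeping the old one on a tie preserves
minimality of the rank. -/
lemma Argmin.keep (h : Argmin C val rk found best R) {i₀ : ι}
    (hb : ¬ (found = 0 ∨ val i₀ < best)) (hrk : ∀ i, C i → rk i ≤ rk i₀)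
    (hC : ∀ i, C' i ↔ C i ∨ i = i₀) : Argmin C' val rk found best R := by
  push Not at hb
  rcases h with ⟨h, _⟩ | ⟨h1, j, hj, hbj, hRj, hmin⟩
  · exact absurd h hb.1
  · refine Or.inr ⟨h1, j, (hC _).2 (Or.inl hj), hbj, hRj, fun i hi => ?_⟩
    rcases (hC i).1 hi with hi | rfl
    · exact hmin i hi
    · refine ⟨by omega, fun h => ?_⟩
      have := hrk j hj
      omega

end Argmin

/-- The memory holds the instance: mates and weights. -/
structure Inst {n : ℕ} (mate : Fin n → Fin n) (W : Fin n → ℤ) (σ : Store) : Prop where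
  size : σ 0 0 = n
  weights : σ 8 = arrayOf W
  mates : σ 9 = arrayOf fun e => ((mate e : ℕ) : ℤ)

/-- The memory holds the sets `G`, `X` and the potential `u`. -/
structure Cur {n : ℕ} (G X : Finset (Fin n)) (u : Fin n → ℤ) (σ : Store) : Prop where
  ground : σ 10 = ind G
  cur : σ 11 = ind X
  pot : σ 12 = arrayOf u

/-- The memory holds a tree. -/
structure TreeRep {n : ℕ} (L : ℕ → Fin n) (dl : ℕ → ℤ) (pr : ℕ → ℕ) (cnt : ℕ) (σ : Store) :
    Prop where
  size : σ 18 0 = cnt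
  node : ∀ k < cnt, σ 13 k = ((L k : ℕ) : ℤ)
  dist : ∀ k < cnt, σ 14 k = dl k
  pred : ∀ k, 2 ≤ k → k < cnt → σ 15 k = pr k
  nodes : σ 16 = ind ((Finset.range cnt).image L)

lemma Inst.frame {n : ℕ} {mate : Fin n → Fin n} {W : Fin n → ℤ} {σ σ' : Store}
    (h : Inst mate W σ) (h0 : σ' 0 = σ 0) (h8 : σ' 8 = σ 8) (h9 : σ' 9 = σ 9) :
    Inst mate W σ' :=
  ⟨by rw [h0, h.size], by rw [h8, h.weights], by rw [h9, h.mates]⟩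

lemma TreeRep.frame {n : ℕ} {L : ℕ → Fin n} {dl : ℕ → ℤ} {pr : ℕ → ℕ} {cnt : ℕ} {σ σ' : Store}
    (h : TreeRep L dl pr cnt σ) (h13 : σ' 13 = σ 13) (h14 : σ' 14 = σ 14) (h15 : σ' 15 = σ 15)
    (h16 : σ' 16 = σ 16) (h18 : σ' 18 = σ 18) : TreeRep L dl pr cnt σ' :=
  ⟨by rw [h18, h.size], by rw [h13]; exact h.node, by rw [h14]; exact h.dist,
    by rw [h15]; exact h.pred, by rw [h16, h.nodes]⟩

section Search

variable {n : ℕ} {O : Fin 2 → Finset (Fin n) → Prop} {Z : ℤ} {σ : Store} {M : Matroid (Fin n)}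
  {mate : Fin n → Fin n} {W u : Fin n → ℤ} {G X : Finset (Fin n)} {a : Fin n} {L : ℕ → Fin n}
  {dl : ℕ → ℤ} {pr : ℕ → ℕ} {cnt : ℕ}

open Classical in
lemma probeArc_spec (hO : ∀ Y : Finset (Fin n), O 1 Y ↔ M.Indep (Y : Set (Fin n))) (hZ : 1 ≤ Z)
    (hI : Inst mate W σ) (hX : σ 11 = ind X) (hT : TreeRep L dl pr cnt σ) {k : ℕ} {y : Fin n}
    (hk : k < cnt) (hk' : σ 22 0 = k) (hy : σ 23 0 = ((y : ℕ) : ℤ)) (hLk : L k ∉ X)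
    (hmy : mate y ∈ X) :
    WP O Z progProbeArc (fun σ' => σ' 11 = ind X ∧
      σ' 19 0 = if Arc M mate X (L k) y then 1 else 0) σ := by
  have e1 : (Exp.get 9 (var 23)).eval σ = ((mate y : ℕ) : ℤ) := by
    simp only [eval_get, eval_const, hy, hI.mates, arrayOf_apply]
  have e2 : (node (var 22)).eval σ = ((L k : ℕ) : ℤ) := by
    simp only [eval_get, eval_const, hk', hT.node k hk]
  have hz : |(0 : ℤ)| ≤ Z := by simp; omega
  have h1 : |(1 : ℤ)| ≤ Z := by simpa using hZ
  have hne : L k ≠ mate y := by rintro h; exact hLk (h ▸ hmy)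
  refine WP.seq (WP.assign hz (WP.seq (WP.assign h1 (WP.seq (WP.query hZ ?_)))))
  refine WP.seq (WP.assign hz (WP.assign h1 ?_))
  set σ₂ := (σ.set 11 ((Exp.get 9 (var 23)).eval σ) 0).set 11 ((node (var 22)).eval σ) 1 with hσ₂
  have h11 : σ₂ 11 = ind (insert (L k) (X.erase (mate y))) := by
    rw [hσ₂, Store.set_self, Store.set_self, hX, e1, e2, update_ind_zero, update_ind_one]
  constructor
  · change Function.update (Function.update (σ₂ 11) ((node (var 22)).eval σ) 0)
      ((Exp.get 9 (var 23)).eval σ) 1 = _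
    rw [h11, e1, e2, update_ind_zero, update_ind_one,
      Finset.erase_insert (fun h => hLk (Finset.mem_of_mem_erase h)), Finset.insert_erase hmy]
  · change (if O 1 (σ₂.subset n 11) then (1 : ℤ) else 0) = _
    rw [subset_eq h11]
    refine if_congr ?_ rfl rfl
    rw [hO, Arc]
    exact ⟨fun h => ⟨hmy, h⟩, fun h => h.2⟩

/-- An arc leaving the tree. -/
def Cand (M : Matroid (Fin n)) (mate : Fin n → Fin n) (G X : Finset (Fin n)) (L : ℕ → Fin n)
    (cnt : ℕ) (p : ℕ × Fin n) : Prop :=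
  p.1 < cnt ∧ p.2 ∈ G ∧ p.2 ∉ X ∧ (∀ i < cnt, L i ≠ p.2) ∧ Arc M mate X (L p.1) p.2

/-- The distance via an arc leaving the tree. -/
def candVal (mate : Fin n → Fin n) (W u : Fin n → ℤ) (L : ℕ → Fin n) (dl : ℕ → ℤ)
    (p : ℕ × Fin n) : ℤ := dl p.1 + len mate W u (L p.1) p.2

/-- The registers hold the best of the arcs satisfying `P`. -/
def ScanInv (M : Matroid (Fin n)) (mate : Fin n → Fin n) (W u : Fin n → ℤ) (G X : Finset (Fin n))
    (L : ℕ → Fin n) (dl : ℕ → ℤ) (cnt : ℕ) (P : ℕ × Fin n → Prop) (σ : Store) : Prop :=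
  σ 11 = ind X ∧ Argmin (fun p => P p ∧ Cand M mate G X L cnt p) (candVal mate W u L dl) Prod.fst
    (σ 24 0) (σ 25 0) fun p => σ 26 0 = p.1 ∧ σ 27 0 = ((p.2 : ℕ) : ℤ)

lemma ScanInv.congr {P P' : ℕ × Fin n → Prop} (h : ScanInv M mate W u G X L dl cnt P σ)
    (hP : ∀ p, Cand M mate G X L cnt p → (P' p ↔ P p)) :
    ScanInv M mate W u G X L dl cnt P' σ :=
  ⟨h.1, h.2.congr fun p => ⟨fun hp => ⟨(hP p hp.2).1 hp.1, hp.2⟩,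
    fun hp => ⟨(hP p hp.2).2 hp.1, hp.2⟩⟩⟩

lemma testArc_spec (hO : ∀ Y : Finset (Fin n), O 1 Y ↔ M.Indep (Y : Set (Fin n))) (hZ : (n : ℤ) ≤ Z)
    (hI : Inst mate W σ) (hu : σ 12 = arrayOf u) (hR : TreeRep L dl pr cnt σ)
    {k : ℕ} {y : Fin n} (hk : k < cnt) (hkn : k < n)
    (hk' : σ 22 0 = k) (hy : σ 23 0 = ((y : ℕ) : ℤ)) (hLk : L k ∉ X) (hyG : y ∈ G) (hyX : y ∉ X)
    (hyL : ∀ i < cnt, L i ≠ y) (hmy : mate y ∈ X) (hval : |candVal mate W u L dl (k, y)| ≤ Z)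
    {P P' : ℕ × Fin n → Prop} (hS : ScanInv M mate W u G X L dl cnt P σ)
    (hPk : ∀ p, P p → p.1 ≤ k) (hP' : ∀ p, P' p ↔ P p ∨ p = (k, y)) :
    WP O Z progTestArc (ScanInv M mate W u G X L dl cnt P') σ := by
  have hyn := y.isLt
  have hZ1 : 1 ≤ Z := by omega
  refine WP.seq ((probeArc_spec hO hZ1 hI hS.1 hR hk hk' hy hLk hmy).mono ?_)
  rintro τ hf ⟨h11, h19⟩
  have hS' : ScanInv M mate W u G X L dl cnt P τ := by
    refine ⟨h11, ?_⟩
    rw [hf 24 (by decide), hf 25 (by decide), hf 26 (by decide), hf 27 (by decide)]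
    exact hS.2
  have hcand : Cand M mate G X L cnt (k, y) ↔ Arc M mate X (L k) y :=
    ⟨fun h => h.2.2.2.2, fun h => ⟨hk, hyG, hyX, hyL, h⟩⟩
  refine WP.cond (fun hc => ?_) (fun hc => ?_)
  · have harc : Arc M mate X (L k) y := by
      by_contra h
      rw [if_neg h] at h19
      exact hc h19
    have hC : ∀ p, P' p ∧ Cand M mate G X L cnt p ↔
        (P p ∧ Cand M mate G X L cnt p) ∨ p = (k, y) := by
      intro p
      rw [hP']
      constructor
      · rintro ⟨h | h, h'⟩
        · exact Or.inl ⟨h, h'⟩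
        · exact Or.inr h
      · rintro (⟨h, h'⟩ | rfl)
        · exact ⟨Or.inl h, h'⟩
        · exact ⟨Or.inr rfl, hcand.2 harc⟩
    have hev : (Exp.get 14 (var 22) + (Exp.get 12 (var 23) - Exp.get 12 (node (var 22)) +
        Exp.get 8 (.get 9 (var 23)) - Exp.get 8 (var 23))).eval τ =
        candVal mate W u L dl (k, y) := by
      simp only [eval_add, eval_sub, eval_get, eval_const, hf 14 (by decide), hf 22 (by decide),
        hf 12 (by decide), hf 23 (by decide), hf 13 (by decide), hf 8 (by decide),
        hf 9 (by decide), hk', hy, hR.dist k hk, hR.node k hk, hu, hI.weights, hI.mates,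
        arrayOf_apply, candVal, len]
    refine WP.seq (WP.assign (by rw [hev]; exact hval) ?_)
    rw [hev]
    set v := candVal mate W u L dl (k, y) with hv
    have hb : better.eval (τ.set 34 0 v) ≠ 0 ↔ τ 24 0 = 0 ∨ v < τ 25 0 := hS'.2.better_iff v
    refine WP.cond (fun hc' => ?_) (fun hc' => ?_)
    · have hb' := hb.1 hc'
      have ev : (var 34).eval (((τ.set 34 0 v).set 24 0 1)) = v := rfl
      refine WP.seq (WP.assign (by simpa [eval_const] using hZ1) (WP.seq (WP.assign ?_ (WP.seq
        (WP.assign ?_ (WP.assign ?_ ⟨h11, ?_⟩))))))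
      · exact hval
      · change |τ 22 0| ≤ Z
        rw [hf 22 (by decide), hk', abs_of_nonneg (by omega)]
        omega
      · change |τ 23 0| ≤ Z
        rw [hf 23 (by decide), hy, abs_of_nonneg (by omega)]
        omega
      · refine hS'.2.replace (i₀ := (k, y)) hb' ⟨?_, ?_⟩ hC
        · change τ 22 0 = _
          rw [hf 22 (by decide), hk']
        · change τ 23 0 = _
          rw [hf 23 (by decide), hy]
    · have hb' : ¬ (τ 24 0 = 0 ∨ v < τ 25 0) := fun h => hb.2 h hc'
      exact WP.skip ⟨h11, hS'.2.keep hb' (fun p hp => hPk p hp.1) hC⟩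
  · have harc : ¬ Arc M mate X (L k) y := by
      intro h
      rw [if_pos h] at h19
      rw [eval_get, eval_const, h19] at hc
      exact one_ne_zero hc
    refine WP.skip (hS'.congr fun p hp => ?_)
    rw [hP']
    constructor
    · rintro (h | rfl)
      · exact h
      · exact absurd (hcand.1 hp) harc
    · exact Or.inl

lemma mem_nodes {y : Fin n} :
    y ∈ (Finset.range cnt).image L ↔ ¬ ∀ i < cnt, L i ≠ y := by
  simp

lemma scanNode_spec (hO : ∀ Y : Finset (Fin n), O 1 Y ↔ M.Indep (Y : Set (Fin n)))
    (hZ : (n : ℤ) ≤ Z) (hr : Ready M mate W u G X a)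
    (hT : Tree M mate W u G X a L dl pr cnt)
    (hI : Inst mate W σ) (hG : σ 10 = ind G) (hu : σ 12 = arrayOf u) (hR : TreeRep L dl pr cnt σ)
    {k : ℕ} (hk : k < cnt) (hkn : k < n) (hk' : σ 22 0 = k)
    (hval : ∀ y ∈ G, |candVal mate W u L dl (k, y)| ≤ Z)
    (hS : ScanInv M mate W u G X L dl cnt (fun p => p.1 < k) σ) :
    WP O Z progScanNode (ScanInv M mate W u G X L dl cnt (fun p => p.1 < k + 1)) σ := by
  unfold progScanNode
  refine WP.mono (WP.forN (fun j σ' => ScanInv M mate W u G X L dl cnt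
    (fun p => p.1 < k ∨ (p.1 = k ∧ (p.2 : ℕ) < j)) σ') (by decide) (by decide) (by decide) hI.size
    hZ (fun _ _ _ h => h) (hS.congr fun p _ => by simp) ?_) ?_
  · intro j hj τ hf hj' hS'
    have h16 : τ 16 = ind ((Finset.range cnt).image L) := by rw [hf 16 (by decide), hR.nodes]
    have h10 : τ 10 = ind G := by rw [hf 10 (by decide), hG]
    have hev : (Exp.get 10 (var 23) - .get 11 (var 23) - .get 16 (var 23)).eval τ =
        (if (⟨j, hj⟩ : Fin n) ∈ G then 1 else 0) - (if (⟨j, hj⟩ : Fin n) ∈ X then 1 else 0) -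
        (if (⟨j, hj⟩ : Fin n) ∈ (Finset.range cnt).image L then 1 else 0) := by
      simp only [eval_sub, eval_get, eval_const, hj', h10, hS'.1, h16]
      have := ind_apply G ⟨j, hj⟩
      have h2 := ind_apply X ⟨j, hj⟩
      have h3 := ind_apply ((Finset.range cnt).image L) ⟨j, hj⟩
      simp only at this h2 h3
      rw [this, h2, h3]
    -- Both `X` and the set of nodes lie in `G` and they are disjoint, so the difference of the
    -- indicators is `0` or `1`.
    have hiff : (Exp.get 10 (var 23) - .get 11 (var 23) - .get 16 (var 23)).eval τ ≠ 0 ↔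
        (⟨j, hj⟩ : Fin n) ∈ G ∧ (⟨j, hj⟩ : Fin n) ∉ X ∧ ∀ i < cnt, L i ≠ ⟨j, hj⟩ := by
      rw [hev]
      have hXG : (⟨j, hj⟩ : Fin n) ∈ X → (⟨j, hj⟩ : Fin n) ∈ G := fun h => hr.sub h
      have hNG : (⟨j, hj⟩ : Fin n) ∈ (Finset.range cnt).image L →
          (⟨j, hj⟩ : Fin n) ∈ G ∧ (⟨j, hj⟩ : Fin n) ∉ X := by
        intro h
        obtain ⟨i, hi, hi'⟩ := Finset.mem_image.1 h
        rw [← hi']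
        exact hT.mem i (Finset.mem_range.1 hi)
      have hN := not_iff_not.2 (mem_nodes (L := L) (cnt := cnt) (y := ⟨j, hj⟩))
      rw [not_not] at hN
      rw [← hN]
      by_cases h1 : (⟨j, hj⟩ : Fin n) ∈ G <;> by_cases h2 : (⟨j, hj⟩ : Fin n) ∈ X <;>
        by_cases h3 : (⟨j, hj⟩ : Fin n) ∈ (Finset.range cnt).image L <;>
        simp only [h1, h2, h3, if_true, if_false] <;> first | decide | tauto
    refine WP.cond (fun hc => ?_) (fun hc => ?_)
    · obtain ⟨hyG, hyX, hyL⟩ := hiff.1 hc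
      have h2 := hT.two_le
      have hne1 : (⟨j, hj⟩ : Fin n) ≠ a := by
        rw [← hT.L_zero]; exact (hyL 0 (by omega)).symm
      have hne2 : (⟨j, hj⟩ : Fin n) ≠ mate a := by
        rw [← hT.L_one]; exact (hyL 1 (by omega)).symm
      have hmy : mate ⟨j, hj⟩ ∈ X := by
        by_contra h
        exact hyX ((hr.trans _ hyG hne1 hne2).2 h)
      refine testArc_spec hO hZ (hI.frame (hf 0 (by decide)) (hf 8 (by decide))
        (hf 9 (by decide))) (by rw [hf 12 (by decide), hu]) (hR.frame (hf 13 (by decide))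
        (hf 14 (by decide)) (hf 15 (by decide)) (hf 16 (by decide)) (hf 18 (by decide))) hk hkn
        (by rw [hf 22 (by decide), hk']) hj' (hT.mem k hk).2 hyG hyX hyL hmy (hval _ hyG) hS'
        (fun p hp => by omega) fun p => ?_
      rw [Prod.ext_iff, Fin.ext_iff]
      simp only
      omega
    · refine WP.skip (hS'.congr fun p hp => ?_)
      have hno : ¬ (p.2 : ℕ) = j := by
        intro h
        have hp2 : p.2 = ⟨j, hj⟩ := Fin.ext h
        refine hiff.2 ?_ hc
        rw [← hp2]
        exact ⟨hp.2.1, hp.2.2.1, hp.2.2.2.1⟩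
      omega
  · intro σ' _ h
    refine h.congr fun p _ => ?_
    have := p.2.isLt
    omega

lemma scan_spec (hO : ∀ Y : Finset (Fin n), O 1 Y ↔ M.Indep (Y : Set (Fin n)))
    (hZ : (n : ℤ) ≤ Z) (hr : Ready M mate W u G X a)
    (hT : Tree M mate W u G X a L dl pr cnt)
    (hI : Inst mate W σ) (hC : Cur G X u σ) (hR : TreeRep L dl pr cnt σ)
    (hval : ∀ k < cnt, ∀ y ∈ G, |candVal mate W u L dl (k, y)| ≤ Z) :
    WP O Z progScan (ScanInv M mate W u G X L dl cnt (fun _ => True)) σ := by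
  have hcn : cnt ≤ n := by simpa using hT.cnt_le
  refine WP.seq (WP.assign (by simp [eval_const]; omega) ?_)
  refine WP.mono (WP.forN (fun k σ' => ScanInv M mate W u G X L dl cnt (fun p => p.1 < k) σ')
    (by decide) (by decide) (by decide) hI.size hZ (fun _ _ _ h => h)
    ⟨hC.cur, Or.inl ⟨rfl, fun p hp => by simp at hp⟩⟩ ?_) ?_
  · intro k hk τ hf hk' hS
    have hev : (Exp.op .le (var 22 + .const 1) (var 18)).eval τ = if k + 1 ≤ cnt then 1 else 0 := by
      simp only [eval_le, eval_add, eval_get, eval_const, hk', hf 18 (by decide)]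
      change (if (k : ℤ) + 1 ≤ σ 18 0 then (1 : ℤ) else 0) = _
      rw [hR.size]
      exact if_congr (by omega) rfl rfl
    refine WP.cond (fun hc => ?_) (fun hc => ?_)
    · have hkc : k < cnt := by
        by_contra h
        rw [hev, if_neg (by omega)] at hc
        exact hc rfl
      exact scanNode_spec hO hZ hr hT (hI.frame (hf 0 (by decide)) (hf 8 (by decide))
        (hf 9 (by decide))) ((hf 10 (by decide)).trans hC.ground)
        ((hf 12 (by decide)).trans hC.pot) (hR.frame (hf 13 (by decide))
        (hf 14 (by decide)) (hf 15 (by decide)) (hf 16 (by decide)) (hf 18 (by decide))) hkc hk hk'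
        (hval k hkc) hS
    · have hkc : ¬ k < cnt := by
        intro h
        rw [hev, if_pos (by omega)] at hc
        exact one_ne_zero hc
      refine WP.skip (hS.congr fun p hp => ?_)
      have := hp.1
      omega
  · intro σ' _ h
    refine h.congr fun p hp => ?_
    have := hp.1
    simp only [true_iff]
    omega

end Search

end OracleRAM

namespace OracleRAM

open Pricing

/-! ### Size of the distances, and correctness of the search -/

section Grow

variable {n : ℕ} {O : Fin 2 → Finset (Fin n) → Prop} {Z B : ℤ} {σ : Store} {M : Matroid (Fin n)}
  {mate : Fin n → Fin n} {W u : Fin n → ℤ} {G X : Finset (Fin n)} {a : Fin n} {L : ℕ → Fin n}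
  {dl : ℕ → ℤ} {pr : ℕ → ℕ} {cnt : ℕ}

lemma image_update_range (z : Fin n) :
    (Finset.range (cnt + 1)).image (Function.update L cnt z) =
      insert z ((Finset.range cnt).image L) := by
  rw [Finset.range_add_one, Finset.image_insert, Function.update_self]
  congr 1
  refine Finset.image_congr fun k hk => ?_
  have : k ≠ cnt := by
    have := Finset.mem_range.1 hk
    omega
  simp [this]

lemma append_spec (hR : TreeRep L dl pr cnt σ) (hX : σ 11 = ind X) {j : ℕ} {z : Fin n} {v : ℤ}
    (hv : |v| ≤ Z) (hZ : (n : ℤ) ≤ Z) (hcn : cnt + 1 ≤ n) (hj : j < cnt)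
    (h25 : σ 25 0 = v) (h26 : σ 26 0 = j) (h27 : σ 27 0 = ((z : ℕ) : ℤ)) :
    WP O Z progAppend (fun σ' => σ' 11 = ind X ∧ TreeRep (Function.update L cnt z)
      (Function.update dl cnt v) (Function.update pr cnt j) (cnt + 1) σ') σ := by
  have hz := z.isLt
  have e18 : (var 18).eval σ = (cnt : ℤ) := by simp only [eval_get, eval_const, hR.size]
  refine WP.seq (WP.assign ?_ (WP.seq (WP.assign ?_ (WP.seq (WP.assign ?_ (WP.seq (WP.assign ?_
    (WP.assign ?_ ⟨hX, ?_⟩))))))))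
  · change |σ 27 0| ≤ Z
    rw [h27, abs_of_nonneg (by omega)]; omega
  · change |σ 25 0| ≤ Z
    rwa [h25]
  · change |σ 26 0| ≤ Z
    rw [h26, abs_of_nonneg (by omega)]; omega
  · simp only [eval_const, abs_one]; omega
  · change |σ 18 0 + 1| ≤ Z
    rw [hR.size, abs_of_nonneg (by omega)]; omega
  · refine ⟨?_, ?_, ?_, ?_, ?_⟩
    · change σ 18 0 + 1 = _
      rw [hR.size]; push_cast; ring
    · intro k hk
      change Function.update (σ 13) (σ 18 0) (σ 27 0) k = _
      rw [hR.size, h27]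
      rcases Nat.lt_succ_iff_lt_or_eq.1 hk with hk | rfl
      · rw [Function.update_of_ne (by omega), Function.update_of_ne (by omega), hR.node k hk]
      · rw [Function.update_self, Function.update_self]
    · intro k hk
      change Function.update (σ 14) (σ 18 0) (σ 25 0) k = _
      rw [hR.size, h25]
      rcases Nat.lt_succ_iff_lt_or_eq.1 hk with hk | rfl
      · rw [Function.update_of_ne (by omega), Function.update_of_ne (by omega), hR.dist k hk]
      · rw [Function.update_self, Function.update_self]
    · intro k hk2 hk
      change Function.update (σ 15) (σ 18 0) (σ 26 0) k = _
      rw [hR.size, h26]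
      rcases Nat.lt_succ_iff_lt_or_eq.1 hk with hk | rfl
      · rw [Function.update_of_ne (by omega), Function.update_of_ne (by omega), hR.pred k hk2 hk]
      · rw [Function.update_self, Function.update_self]
    · change Function.update (σ 16) (σ 27 0) 1 = _
      rw [hR.nodes, h27, update_ind_one, image_update_range]

/-- Bounds on the weights and the potential during the search. -/
structure PotBound (W u : Fin n → ℤ) (G : Finset (Fin n)) (B : ℤ) : Prop where
  weight : ∀ e, |W e| ≤ B
  le : ∀ e ∈ G, u e ≤ B
  ge : ∀ e ∈ G, -(3 * B) ≤ u e

lemma PotBound.nonneg (h : PotBound W u G B) (e : Fin n) : 0 ≤ B :=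
  (abs_nonneg _).trans (h.weight e)

/-- The potentials differ by at most `4 * B` and the weights by at most `2 * B`; the constant is
generous. -/
lemma PotBound.abs_len_le (h : PotBound W u G B) {y z : Fin n} (hy : y ∈ G) (hz : z ∈ G) :
    |len mate W u y z| ≤ 8 * B := by
  have h1 := abs_le.1 (h.weight z)
  have h2 := abs_le.1 (h.weight (mate z))
  have h3 := h.le y hy
  have h4 := h.ge y hy
  have h5 := h.le z hz
  have h6 := h.ge z hz
  unfold len
  rw [abs_le]
  constructor <;> linarith

lemma PotBound.dl_le (h : PotBound W u G B) (hT : Tree M mate W u G X a L dl pr cnt) (k : ℕ)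
    (hk : k < cnt) : dl k ≤ 8 * B * k := by
  have hB := h.nonneg a
  induction k using Nat.strong_induction_on with
  | _ k ih =>
    rcases lt_or_ge k 2 with h2 | h2
    · interval_cases k
      · simp [hT.dl_zero]
      · simp only [hT.dl_one]; push_cast; linarith
    · have hp := hT.pr_lt k h2 hk
      have h1 := ih (pr k) hp (by omega)
      have h3 := (abs_le.1 (h.abs_len_le (mate := mate) (hT.mem (pr k) (by omega)).1
        (hT.mem k hk).1)).2
      rw [hT.pr_eq k h2 hk]
      have : (pr k : ℤ) + 1 ≤ k := by omega
      nlinarith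

lemma PotBound.dl_nonneg (hr : Ready M mate W u G X a) (hm : Function.Involutive mate)
    (hT : Tree M mate W u G X a L dl pr cnt) {k : ℕ} (hk : k < cnt) : 0 ≤ dl k := by
  rw [← hT.dl_zero]
  exact hT.dl_mono hr hm (Nat.zero_le _) hk

lemma PotBound.abs_candVal_le (h : PotBound W u G B) (hr : Ready M mate W u G X a)
    (hm : Function.Involutive mate) (hT : Tree M mate W u G X a L dl pr cnt) {k : ℕ}
    (hk : k < cnt) {y : Fin n} (hy : y ∈ G) : |candVal mate W u L dl (k, y)| ≤ 8 * B * n := by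
  have hB := h.nonneg a
  have hcn : cnt ≤ n := by simpa using hT.cnt_le
  have h1 := h.dl_le hT k hk
  have h2 := PotBound.dl_nonneg hr hm hT hk
  have h3 := abs_le.1 (h.abs_len_le (mate := mate) (hT.mem k hk).1 hy)
  have h4 : (k : ℤ) + 1 ≤ n := by omega
  have h5 : 8 * B * ((k : ℤ) + 1) ≤ 8 * B * n := by gcongr
  have h6 : 0 ≤ B * k := by positivity
  simp only [candVal, abs_le]
  constructor <;> linarith

lemma search_spec (hO : ∀ Y : Finset (Fin n), O 1 Y ↔ M.Indep (Y : Set (Fin n)))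
    (hm : Function.Involutive mate) (hZ : (n : ℤ) ≤ Z) (hB : PotBound W u G B)
    (hBZ : 8 * B * n ≤ Z) (hr : Ready M mate W u G X a)
    (hT : Tree M mate W u G X a L dl pr 2) (hI : Inst mate W σ) (hC : Cur G X u σ)
    (hR : TreeRep L dl pr 2 σ) :
    WP O Z progSearch (fun σ' => σ' 11 = ind X ∧ ∃ L dl pr cnt,
      Tree M mate W u G X a L dl pr cnt ∧ Closed M mate G X L cnt ∧ TreeRep L dl pr cnt σ') σ := by
  unfold progSearch
  -- Every round adds a node unless the tree is closed. A tree has at most `n` nodes, so after `n`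
  -- rounds the second alternative of the invariant is impossible.
  refine WP.mono (WP.forN (fun r σ' => σ' 11 = ind X ∧ ∃ L dl pr cnt,
      Tree M mate W u G X a L dl pr cnt ∧ TreeRep L dl pr cnt σ' ∧
      (Closed M mate G X L cnt ∨ r + 2 ≤ cnt)) (by decide) (by decide) (by decide) hI.size
    hZ (fun k τ v h => ?_) ⟨hC.cur, L, dl, pr, 2, hT, hR, Or.inr le_rfl⟩ ?_) ?_
  · obtain ⟨h1, L, dl, pr, cnt, hT, hR, h2⟩ := h
    exact ⟨h1, L, dl, pr, cnt, hT, hR.frame rfl rfl rfl rfl rfl, h2⟩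
  · rintro r hr' τ hf _ ⟨h11, L, dl, pr, cnt, hT, hR, hcl⟩
    have hI' := hI.frame (hf 0 (by decide)) (hf 8 (by decide)) (hf 9 (by decide))
    have hC' : Cur G X u τ :=
      ⟨(hf 10 (by decide)).trans hC.ground, h11, (hf 12 (by decide)).trans hC.pot⟩
    refine WP.seq (WP.mono (scan_spec hO hZ hr hT hI' hC' hR fun k hk y hy =>
      (hB.abs_candVal_le hr hm hT hk hy).trans hBZ) ?_)
    intro σ₁ hf₁ hS
    have hR₁ := hR.frame (hf₁ 13 (by decide)) (hf₁ 14 (by decide)) (hf₁ 15 (by decide))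
      (hf₁ 16 (by decide)) (hf₁ 18 (by decide))
    rcases hS.2 with ⟨h24, hno⟩ | ⟨h24, ⟨j, z⟩, ⟨_, hj, hzG, hzX, hzL, harc⟩, h25, ⟨h26, h27⟩, hmin⟩
    · refine WP.cond (fun hc => absurd h24 hc) fun _ => WP.skip ⟨hS.1, L, dl, pr, cnt, hT, hR₁,
        Or.inl ?_⟩
      intro j hj z hzG hzX harc
      by_contra hcon
      push Not at hcon
      exact hno (j, z) ⟨trivial, hj, hzG, hzX, hcon, harc⟩
    · refine WP.cond (fun _ => ?_) fun hc => ?_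
      · have hT' := hT.step hj hzG hzX hzL harc
          (fun j' hj' z' h1 h2 h3 h4 => (hmin (j', z') ⟨trivial, hj', h1, h2, h3, h4⟩).1)
          (fun j' hj' h4 => (hmin (j', z) ⟨trivial, hj'.trans hj, hzG, hzX, hzL, h4⟩).2 hj')
        have hcn : cnt + 1 ≤ n := by simpa using hT'.cnt_le
        refine WP.mono (append_spec hR₁ hS.1 ((hB.abs_candVal_le hr hm hT hj hzG).trans hBZ) hZ hcn
          hj h25 h26 h27) ?_
        rintro σ₂ _ ⟨h11', hR₂⟩
        refine ⟨h11', _, _, _, _, hT', hR₂, Or.inr ?_⟩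
        rcases hcl with hcl | hcl
        · obtain ⟨k, hk, hkz⟩ := hcl j hj z hzG hzX harc
          exact absurd hkz (hzL k hk)
        · omega
      · rw [eval_get, eval_const, h24] at hc
        exact absurd hc one_ne_zero
  · rintro σ' _ ⟨h11, L, dl, pr, cnt, hT, hR, hcl⟩
    refine ⟨h11, L, dl, pr, cnt, hT, ?_, hR⟩
    rcases hcl with h | h
    · exact h
    · have : cnt ≤ n := by simpa using hT.cnt_le
      omega

/-! ### Choosing the terminal, raising the potential, exchanging -/

open Classical in
lemma probeTerminal_spec (hO : ∀ Y : Finset (Fin n), O 1 Y ↔ M.Indep (Y : Set (Fin n)))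
    (hZ : 1 ≤ Z) (hX : σ 11 = ind X) (hT : TreeRep L dl pr cnt σ) {k : ℕ}
    (hk : k < cnt) (hk' : σ 22 0 = k) (hLk : L k ∉ X) :
    WP O Z progProbeTerminal (fun σ' => σ' 11 = ind X ∧
      σ' 19 0 = if M.Indep (insert (L k) X : Finset (Fin n)) then 1 else 0) σ := by
  have e2 : (node (var 22)).eval σ = ((L k : ℕ) : ℤ) := by
    simp only [eval_get, eval_const, hk', hT.node k hk]
  have hz : |(0 : ℤ)| ≤ Z := by simp; omega
  have h1 : |(1 : ℤ)| ≤ Z := by simpa using hZ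
  refine WP.seq (WP.assign h1 (WP.seq (WP.query hZ (WP.assign hz ?_))))
  set σ₂ := σ.set 11 ((node (var 22)).eval σ) 1 with hσ₂
  have h11 : σ₂ 11 = ind (insert (L k) X) := by
    rw [hσ₂, Store.set_self, hX, e2, update_ind_one]
  constructor
  · change Function.update (σ₂ 11) ((node (var 22)).eval σ) 0 = _
    rw [h11, e2, update_ind_zero, Finset.erase_insert hLk]
  · change (if O 1 (σ₂.subset n 11) then (1 : ℤ) else 0) = _
    rw [subset_eq h11]
    exact if_congr (hO _) rfl rfl

/-- The registers hold the best of the first `k` terminals. -/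
def TermInv (M : Matroid (Fin n)) (u : Fin n → ℤ) (X : Finset (Fin n))
    (L : ℕ → Fin n) (dl : ℕ → ℤ) (cnt : ℕ) (k : ℕ) (σ : Store) : Prop :=
  σ 11 = ind X ∧ Argmin (fun j => j < k ∧ j < cnt ∧ M.Indep (insert (L j) X : Finset (Fin n)))
    (fun j => dl j - u (L j)) id (σ 24 0) (σ 25 0) fun j => σ 26 0 = j

lemma testTerminal_spec (hO : ∀ Y : Finset (Fin n), O 1 Y ↔ M.Indep (Y : Set (Fin n)))
    (hZ : (n : ℤ) ≤ Z) (hu : σ 12 = arrayOf u) (hR : TreeRep L dl pr cnt σ)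
    {k : ℕ} (hk : k < cnt) (hkn : k < n) (hk' : σ 22 0 = k) (hLk : L k ∉ X)
    (hval : |dl k - u (L k)| ≤ Z) (hS : TermInv M u X L dl cnt k σ) :
    WP O Z progTestTerminal (TermInv M u X L dl cnt (k + 1)) σ := by
  have hZ1 : 1 ≤ Z := by omega
  refine WP.seq ((probeTerminal_spec hO hZ1 hS.1 hR hk hk' hLk).mono ?_)
  rintro τ hf ⟨h11, h19⟩
  have hS' : TermInv M u X L dl cnt k τ := by
    refine ⟨h11, ?_⟩
    rw [hf 24 (by decide), hf 25 (by decide), hf 26 (by decide)]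
    exact hS.2
  refine WP.cond (fun hc => ?_) (fun hc => ?_)
  · have hind : M.Indep (insert (L k) X : Finset (Fin n)) := by
      by_contra h
      rw [if_neg h] at h19
      exact hc h19
    have hC : ∀ j, (j < k + 1 ∧ j < cnt ∧ M.Indep (insert (L j) X : Finset (Fin n))) ↔
        (j < k ∧ j < cnt ∧ M.Indep (insert (L j) X : Finset (Fin n))) ∨ j = k := by
      intro j
      constructor
      · rintro ⟨h1, h2⟩
        rcases Nat.lt_succ_iff_lt_or_eq.1 h1 with h | h
        · exact Or.inl ⟨h, h2⟩
        · exact Or.inr h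
      · rintro (⟨h1, h2⟩ | rfl)
        · exact ⟨by omega, h2⟩
        · exact ⟨by omega, hk, hind⟩
    have hev : (Exp.get 14 (var 22) - Exp.get 12 (node (var 22))).eval τ = dl k - u (L k) := by
      simp only [eval_sub, eval_get, eval_const, hf 14 (by decide), hf 22 (by decide),
        hf 12 (by decide), hf 13 (by decide), hk', hR.dist k hk, hR.node k hk, hu, arrayOf_apply]
    refine WP.seq (WP.assign (by rw [hev]; exact hval) ?_)
    rw [hev]
    set v := dl k - u (L k) with hv
    have hb : better.eval (τ.set 34 0 v) ≠ 0 ↔ τ 24 0 = 0 ∨ v < τ 25 0 := hS'.2.better_iff v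
    refine WP.cond (fun hc' => ?_) (fun hc' => ?_)
    · have hb' := hb.1 hc'
      refine WP.seq (WP.assign (by simpa [eval_const] using hZ1) (WP.seq (WP.assign ?_
        (WP.assign ?_ ⟨h11, ?_⟩))))
      · exact hval
      · change |τ 22 0| ≤ Z
        rw [hf 22 (by decide), hk', abs_of_nonneg (by omega)]
        omega
      · refine hS'.2.replace (i₀ := k) hb' ?_ hC
        change τ 22 0 = _
        rw [hf 22 (by decide), hk']
    · have hb' : ¬ (τ 24 0 = 0 ∨ v < τ 25 0) := fun h => hb.2 h hc'
      exact WP.skip ⟨h11, hS'.2.keep hb' (fun p hp => hp.1.le) hC⟩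
  · have hind : ¬ M.Indep (insert (L k) X : Finset (Fin n)) := by
      intro h
      rw [if_pos h] at h19
      rw [eval_get, eval_const, h19] at hc
      exact one_ne_zero hc
    refine WP.skip ⟨h11, hS'.2.congr fun j => ?_⟩
    constructor
    · rintro ⟨h1, h2⟩
      refine ⟨?_, h2⟩
      rcases Nat.lt_succ_iff_lt_or_eq.1 h1 with h | rfl
      · exact h
      · exact absurd h2.2 hind
    · rintro ⟨h1, h2⟩
      exact ⟨by omega, h2⟩

lemma eval_lt_cnt {τ : Store} {k : ℕ} (hk' : τ 22 0 = k) (h18 : τ 18 0 = cnt) :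
    (Exp.op .le (var 22 + .const 1) (var 18)).eval τ ≠ 0 ↔ k < cnt := by
  simp only [eval_le, eval_add, eval_get, eval_const, hk', h18]
  split_ifs <;> simp <;> omega

lemma terminal_spec (hO : ∀ Y : Finset (Fin n), O 1 Y ↔ M.Indep (Y : Set (Fin n)))
    (hm : Function.Involutive mate) (hZ : (n : ℤ) ≤ Z) (hB : PotBound W u G B)
    (hBZ : B * (8 * n + 4) ≤ Z) (hr : Ready M mate W u G X a)
    (hT : Tree M mate W u G X a L dl pr cnt) (hI : Inst mate W σ) (hu : σ 12 = arrayOf u)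
    (hX : σ 11 = ind X) (hR : TreeRep L dl pr cnt σ) (h17 : σ 17 0 = B)
    (hex : ∃ k < cnt, M.Indep (insert (L k) X : Finset (Fin n))) :
    WP O Z progTerminal (fun σ' => σ' 11 = ind X ∧ ∃ k₀, Best M u X L dl cnt k₀ ∧
      σ' 26 0 = k₀ ∧ σ' 28 0 = dl k₀ - u (L k₀) + B) σ := by
  have hB0 := hB.nonneg a
  have hcn : cnt ≤ n := by simpa using hT.cnt_le
  have hbd : ∀ k < cnt, |dl k - u (L k)| ≤ B * (8 * n + 3) ∧
      |dl k - u (L k) + B| ≤ B * (8 * n + 4) := by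
    intro k hk
    have h1 := hB.dl_le hT k hk
    have h2 := PotBound.dl_nonneg hr hm hT hk
    have h3 := hB.le _ (hT.mem k hk).1
    have h4 := hB.ge _ (hT.mem k hk).1
    have h5 : (k : ℤ) ≤ n := by omega
    have h6 : 8 * B * (k : ℤ) ≤ 8 * B * n := by gcongr
    have h7 : 0 ≤ B * n := by positivity
    rw [abs_le, abs_le]
    refine ⟨⟨?_, ?_⟩, ?_, ?_⟩ <;> nlinarith
  refine WP.seq (WP.assign (by simp [eval_const]; omega) (WP.seq ?_))
  refine WP.mono (WP.forN (TermInv M u X L dl cnt) (by decide) (by decide) (by decide) hI.size hZ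
    (fun _ _ _ h => h) ⟨hX, Or.inl ⟨rfl, fun j hj => by simp at hj⟩⟩ ?_) ?_
  · intro k hk τ hf hk' hS
    have hR' : TreeRep L dl pr cnt τ := hR.frame (hf 13 (by decide)) (hf 14 (by decide))
      (hf 15 (by decide)) (hf 16 (by decide)) (hf 18 (by decide))
    refine WP.cond (fun hc => ?_) (fun hc => ?_)
    · have hkc := (eval_lt_cnt hk' hR'.size).1 hc
      exact testTerminal_spec hO hZ ((hf 12 (by decide)).trans hu) hR' hkc hk hk' (hT.mem k hkc).2
        ((hbd k hkc).1.trans (by nlinarith)) hS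
    · have hkc : ¬ k < cnt := fun h => (eval_lt_cnt hk' hR'.size).2 h hc
      refine WP.skip ⟨hS.1, hS.2.congr fun j => ?_⟩
      constructor
      · rintro ⟨h1, h2⟩; exact ⟨by omega, h2⟩
      · rintro ⟨h1, h2⟩; exact ⟨by omega, h2⟩
  · rintro τ hf ⟨h11, hS⟩
    rcases hS with ⟨_, hno⟩ | ⟨_, k₀, ⟨_, hk₀, hI₀⟩, h25, h26, hmin⟩
    · obtain ⟨k, hk, hkI⟩ := hex
      exact absurd ⟨by omega, hk, hkI⟩ (hno k)
    · have h17' : τ 17 0 = B := by rw [hf 17 (by decide)]; exact h17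
      have hev : (var 25 + var 17).eval τ = dl k₀ - u (L k₀) + B := by
        simp only [eval_add, eval_get, eval_const, h25, h17']
      refine WP.assign (by rw [hev]; exact ((hbd k₀ hk₀).2.trans hBZ)) ?_
      rw [hev]
      exact ⟨h11, k₀, ⟨hk₀, hI₀, fun k hk hkI => (hmin k ⟨by omega, hk, hkI⟩).1,
        fun k hk hkI => (hmin k ⟨by omega, by omega, hkI⟩).2 hk⟩, h26, rfl⟩

end Grow

end OracleRAM

namespace OracleRAM

open Pricing

section Stage

variable {n : ℕ} {O : Fin 2 → Finset (Fin n) → Prop} {Z B K : ℤ} {σ : Store} {M : Matroid (Fin n)}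
  {mate : Fin n → Fin n} {W u : Fin n → ℤ} {G X : Finset (Fin n)} {a : Fin n} {L : ℕ → Fin n}
  {dl : ℕ → ℤ} {pr : ℕ → ℕ} {cnt : ℕ}

/-- The potential `v` has been raised at the first `k` nodes and their mates. -/
structure RaisedTo (mate : Fin n → Fin n) (W u : Fin n → ℤ) (L : ℕ → Fin n) (dl : ℕ → ℤ)
    (cnt : ℕ) (K : ℤ) (k : ℕ) (v : Fin n → ℤ) : Prop where
  node : ∀ j < k, j < cnt → v (L j) = u (L j) + max (K - dl j) 0
  partner : ∀ j < k, 2 ≤ j → j < cnt → v (mate (L j)) = u (mate (L j)) +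
    max (K - dl j + (W (mate (L j)) - W (L j) - u (mate (L j)) + u (L j))) 0
  rest : ∀ e, (∀ j < k, j < cnt → L j ≠ e) →
    (∀ j < k, 2 ≤ j → j < cnt → mate (L j) ≠ e) → v e = u e

/-- Nodes are outside `X` and their partners inside, so the step for node `k` leaves the values of
all other nodes and partners alone. -/
lemma RaisedTo.step {k : ℕ} {v v' : Fin n → ℤ} (hr : Ready M mate W u G X a)
    (hm : Function.Involutive mate) (hT : Tree M mate W u G X a L dl pr cnt) (hk : k < cnt)
    (h : RaisedTo mate W u L dl cnt K k v)
    (hnode : v' (L k) = u (L k) + max (K - dl k) 0)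
    (hpart : 2 ≤ k → v' (mate (L k)) = u (mate (L k)) +
      max (K - dl k + (W (mate (L k)) - W (L k) - u (mate (L k)) + u (L k))) 0)
    (hrest : ∀ e, L k ≠ e → (2 ≤ k → mate (L k) ≠ e) → v' e = v e) :
    RaisedTo mate W u L dl cnt K (k + 1) v' := by
  have hX : ∀ j, 2 ≤ j → j < cnt → mate (L j) ∈ X := fun j h2 hj => hT.mate_mem hr hm h2 hj
  have hL : ∀ j < cnt, L j ∉ X := fun j hj => (hT.mem j hj).2
  refine ⟨fun j hj hjc => ?_, fun j hj h2 hjc => ?_, fun e h1 h2 => ?_⟩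
  · rcases Nat.lt_succ_iff_lt_or_eq.1 hj with hj | rfl
    · rw [hrest, h.node j hj hjc]
      · intro h
        have := hT.inj _ hk _ hjc h
        omega
      · intro h2 h
        exact hL j hjc (h ▸ hX k h2 hk)
    · exact hnode
  · rcases Nat.lt_succ_iff_lt_or_eq.1 hj with hj | rfl
    · rw [hrest, h.partner j hj h2 hjc]
      · intro h
        exact hL k hk (h ▸ hX j h2 hjc)
      · intro _ h
        have := hT.inj _ hk _ hjc (hm.injective h)
        omega
    · exact hpart h2
  · rw [hrest e (h1 k (by omega) hk) fun h => h2 k (by omega) h hk]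
    exact h.rest e (fun j hj => h1 j (by omega)) fun j hj => h2 j (by omega)

/-- `u'` is obtained from `u` by raising at most `C`. -/
lemma RaisedTo.bounds {k : ℕ} {v : Fin n → ℤ} {C : ℤ} (h : RaisedTo mate W u L dl cnt K k v)
    (hC : 0 ≤ C) (h1 : ∀ j < cnt, K - dl j ≤ C)
    (h2 : ∀ j, 2 ≤ j → j < cnt →
      K - dl j + (W (mate (L j)) - W (L j) - u (mate (L j)) + u (L j)) ≤ C) (e : Fin n) :
    u e ≤ v e ∧ v e ≤ u e + C := by
  by_cases hL : ∃ j < k, j < cnt ∧ L j = e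
  · obtain ⟨j, hj, hjc, rfl⟩ := hL
    rw [h.node j hj hjc]
    have := h1 j hjc
    have := le_max_right (K - dl j) 0
    exact ⟨by omega, by gcongr; exact max_le (h1 j hjc) hC⟩
  · by_cases hP : ∃ j < k, 2 ≤ j ∧ j < cnt ∧ mate (L j) = e
    · obtain ⟨j, hj, hj2, hjc, rfl⟩ := hP
      rw [h.partner j hj hj2 hjc]
      refine ⟨?_, by gcongr; exact max_le (h2 j hj2 hjc) hC⟩
      have := le_max_right (K - dl j + (W (mate (L j)) - W (L j) - u (mate (L j)) + u (L j))) 0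
      omega
    · push Not at hL hP
      rw [h.rest e hL hP]
      exact ⟨le_rfl, by omega⟩

lemma raiseNode_spec (hr : Ready M mate W u G X a)
    (hm : Function.Involutive mate) (hT : Tree M mate W u G X a L dl pr cnt)
    (hI : Inst mate W σ) (hR : TreeRep L dl pr cnt σ) (h28 : σ 28 0 = K) {k : ℕ} (hk : k < cnt)
    (hk' : σ 22 0 = k) {C : ℤ} (hCZ : C ≤ Z)
    (h1 : |u (L k) + max (K - dl k) 0| ≤ C)
    (h2 : 2 ≤ k → |u (mate (L k)) +
      max (K - dl k + (W (mate (L k)) - W (L k) - u (mate (L k)) + u (L k))) 0| ≤ C)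
    (h3 : 2 ≤ k → |K - dl k + (W (mate (L k)) - W (L k) - u (mate (L k)) + u (L k))| ≤ C)
    (h : ∃ v, σ 12 = arrayOf v ∧ RaisedTo mate W u L dl cnt K k v) :
    WP O Z progRaiseNode
      (fun σ' => ∃ v, σ' 12 = arrayOf v ∧ RaisedTo mate W u L dl cnt K (k + 1) v) σ := by
  obtain ⟨v, h12, hv⟩ := h
  have hX : ∀ j, 2 ≤ j → j < cnt → mate (L j) ∈ X := fun j h2 hj => hT.mate_mem hr hm h2 hj
  have hL : ∀ j < cnt, L j ∉ X := fun j hj => (hT.mem j hj).2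
  have hvL : v (L k) = u (L k) := by
    refine hv.rest _ (fun j hj hjc h => ?_) fun j hj hj2 hjc h => ?_
    · have := hT.inj _ hjc _ hk h
      omega
    · exact hL k hk (h ▸ hX j hj2 hjc)
  have hvm : 2 ≤ k → v (mate (L k)) = u (mate (L k)) := by
    intro hk2
    refine hv.rest _ (fun j hj hjc h => ?_) fun j hj hj2 hjc h => ?_
    · exact hL j hjc (h ▸ hX k hk2 hk)
    · have := hT.inj _ hjc _ hk (hm.injective h)
      omega
  set s := K - dl k + (W (mate (L k)) - W (L k) - u (mate (L k)) + u (L k)) with hs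
  have en : (node (var 22)).eval σ = ((L k : ℕ) : ℤ) := by
    simp only [eval_get, eval_const, hk', hR.node k hk]
  have em : (Exp.get 9 (node (var 22))).eval σ = ((mate (L k) : ℕ) : ℤ) := by
    rw [eval_get, en, hI.mates, arrayOf_apply]
  have e14 : σ 14 k = dl k := hR.dist k hk
  -- In the intermediate potential `v₁` the partner has been raised and the node has not.
  refine WP.seq (WP.mono (Q := fun σ' => ∃ v₁, σ' 12 = arrayOf v₁ ∧ v₁ (L k) = u (L k) ∧
    (2 ≤ k → v₁ (mate (L k)) = u (mate (L k)) + max s 0) ∧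
    ∀ e, (2 ≤ k → mate (L k) ≠ e) → v₁ e = v e) ?_ ?_)
  · refine WP.cond (fun hc => ?_) (fun hc => ?_)
    · have hk2 : 2 ≤ k := by
        by_contra hlt
        rw [eval_le, eval_const, eval_get, eval_const, hk', if_neg (by omega)] at hc
        exact hc rfl
      have hne : mate (L k) ≠ L k := fun h => hL k hk (h ▸ hX k hk2 hk)
      have es : (var 28 - .get 14 (var 22) + (.get 8 (.get 9 (node (var 22))) -
          .get 8 (node (var 22)) - .get 12 (.get 9 (node (var 22))) +
          .get 12 (node (var 22)))).eval σ = s := by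
        rw [eval_add, eval_sub, eval_add, eval_sub, eval_sub, eval_get σ 28, eval_get σ 14,
          eval_get σ 8, eval_get σ 8, eval_get σ 12, eval_get σ 12, em, en, hI.weights, h12]
        simp only [arrayOf_apply, eval_get, eval_const, h28, hk', e14, hvL, hvm hk2, hs]
      refine WP.seq (WP.assign (by rw [es]; exact (h3 hk2).trans hCZ) ?_)
      rw [es]
      refine WP.cond (fun hc' => ?_) (fun hc' => ?_)
      · have hs1 : 1 ≤ s := by
          by_contra hlt
          apply hc'
          change (if 1 ≤ s then (1 : ℤ) else 0) = 0
          rw [if_neg hlt]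
        have ev : (Exp.get 12 (.get 9 (node (var 22))) + var 34).eval (σ.set 34 0 s) =
            u (mate (L k)) + s := by
          change σ 12 ((Exp.get 9 (node (var 22))).eval σ) + s = _
          rw [em, h12, arrayOf_apply, hvm hk2]
        have hmax : max s 0 = s := max_eq_left (by omega)
        refine WP.assign ?_ ⟨Function.update v (mate (L k)) (u (mate (L k)) + s), ?_, ?_, ?_, ?_⟩
        · change |Exp.eval (σ.set 34 0 s) _| ≤ Z
          rw [ev]
          have := h2 hk2
          rw [hmax] at this
          exact this.trans hCZ
        · change Function.update (σ 12) ((Exp.get 9 (node (var 22))).eval σ)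
            (Exp.eval (σ.set 34 0 s) _) = _
          rw [ev, em, h12, update_arrayOf]
        · rw [Function.update_of_ne hne.symm, hvL]
        · intro _
          rw [Function.update_self, hmax]
        · intro e he
          rw [Function.update_of_ne (he hk2).symm]
      · have hs1 : ¬ 1 ≤ s := by
          intro h
          change (if 1 ≤ s then (1 : ℤ) else 0) = 0 at hc'
          rw [if_pos h] at hc'
          exact one_ne_zero hc'
        refine WP.skip ⟨v, h12, hvL, fun _ => ?_, fun _ _ => rfl⟩
        rw [hvm hk2, max_eq_right (by omega), add_zero]
    · have hk2 : ¬ 2 ≤ k := by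
        intro h
        rw [eval_le, eval_const, eval_get, eval_const, hk', if_pos (by omega)] at hc
        exact one_ne_zero hc
      exact WP.skip ⟨v, h12, hvL, fun h => absurd h hk2, fun _ _ => rfl⟩
  · rintro τ hf ⟨v₁, h12', hv₁, hv₂, hv₃⟩
    have f22 : τ 22 0 = k := by rw [hf 22 (by decide), hk']
    have f28 : τ 28 0 = K := by rw [hf 28 (by decide), h28]
    have f14 : τ 14 k = dl k := by rw [hf 14 (by decide), e14]
    have f13 : (node (var 22)).eval τ = ((L k : ℕ) : ℤ) := by
      rw [← en]
      simp only [eval_get, eval_const, hf 13 (by decide), hf 22 (by decide)]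
    have hc0 : (Exp.op .le (.get 14 (var 22) + .const 1) (var 28)).eval τ =
        if 1 ≤ K - dl k then 1 else 0 := by
      simp only [eval_le, eval_add, eval_get, eval_const, f22, f28, f14]
      exact if_congr (by omega) rfl rfl
    have hm2 : 2 ≤ k → mate (L k) ≠ L k := fun hk2 h => hL k hk (h ▸ hX k hk2 hk)
    refine WP.cond (fun hc => ?_) (fun hc => ?_)
    · have hs1 : 1 ≤ K - dl k := by
        by_contra hlt
        rw [hc0, if_neg hlt] at hc
        exact hc rfl
      have ev : (Exp.get 12 (node (var 22)) + (var 28 - .get 14 (var 22))).eval τ =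
          u (L k) + (K - dl k) := by
        rw [eval_add, eval_get, f13, h12', arrayOf_apply, hv₁, eval_sub]
        simp only [eval_get, eval_const, f22, f28, f14]
      have hmax : max (K - dl k) 0 = K - dl k := max_eq_left (by omega)
      refine WP.assign ?_ ⟨Function.update v₁ (L k) (u (L k) + (K - dl k)), ?_, ?_⟩
      · rw [ev]
        rw [hmax] at h1
        exact h1.trans hCZ
      · rw [Store.set_self, ev, f13, h12', update_arrayOf]
      · refine hv.step hr hm hT hk ?_ (fun hk2 => ?_) fun e he1 he2 => ?_
        · rw [Function.update_self, hmax]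
        · rw [Function.update_of_ne (hm2 hk2), hv₂ hk2]
        · rw [Function.update_of_ne he1.symm, hv₃ e he2]
    · have hs1 : ¬ 1 ≤ K - dl k := by
        intro h
        rw [hc0, if_pos h] at hc
        exact one_ne_zero hc
      refine WP.skip ⟨v₁, h12', hv.step hr hm hT hk ?_ hv₂ fun e _ he2 => hv₃ e he2⟩
      rw [hv₁, max_eq_right (by omega), add_zero]

lemma raise_spec (hZ : (n : ℤ) ≤ Z) (hB : PotBound W u G B) (hBZ : B * (8 * n + 16) ≤ Z)
    (hr : Ready M mate W u G X a)
    (hm : Function.Involutive mate) (hT : Tree M mate W u G X a L dl pr cnt)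
    (hI : Inst mate W σ) (hR : TreeRep L dl pr cnt σ) (h12 : σ 12 = arrayOf u) (h28 : σ 28 0 = K)
    {k₀ : ℕ} (hk₀ : k₀ < cnt) (hK : K = dl k₀ - u (L k₀) + B) :
    WP O Z progRaise (fun σ' => ∃ u', σ' 12 = arrayOf u' ∧ Raised mate W u G L dl cnt K u' ∧
      ∀ e ∈ G, |u' e| ≤ B * (8 * n + 16)) σ := by
  have hB0 := hB.nonneg a
  have hcn : cnt ≤ n := by simpa using hT.cnt_le
  have hK1 : K ≤ B * (8 * n + 4) := by
    have h1 := hB.dl_le hT k₀ hk₀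
    have h2 := hB.ge _ (hT.mem k₀ hk₀).1
    have h3 : (k₀ : ℤ) ≤ n := by omega
    have h4 : 8 * B * (k₀ : ℤ) ≤ 8 * B * n := by gcongr
    rw [hK]; nlinarith
  have hK0 : 0 ≤ K := by
    have h1 := PotBound.dl_nonneg hr hm hT hk₀
    have h2 := hB.le _ (hT.mem k₀ hk₀).1
    rw [hK]; linarith
  have hslack : ∀ j < cnt, |W (mate (L j)) - W (L j) - u (mate (L j)) + u (L j)| ≤ 8 * B := by
    intro j hj
    have hj1 := (hT.mem j hj).1
    have hj2 := hr.mate_mem _ hj1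
    have h1 := abs_le.1 (hB.weight (L j))
    have h2 := abs_le.1 (hB.weight (mate (L j)))
    have h3 := hB.le _ hj1
    have h4 := hB.ge _ hj1
    have h5 := hB.le _ hj2
    have h6 := hB.ge _ hj2
    rw [abs_le]
    constructor <;> linarith
  have hn0 : 0 ≤ B * n := by positivity
  have hd : ∀ j < cnt, 0 ≤ dl j ∧ dl j ≤ 8 * B * n := by
    intro j hj
    refine ⟨PotBound.dl_nonneg hr hm hT hj, (hB.dl_le hT j hj).trans ?_⟩
    have h3 : (j : ℤ) ≤ n := by omega
    gcongr
  -- A raise is at most `K` plus a slack of at most `8 * B`, that is, at most `B * (8 * n + 12)`;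
  -- the old value lies between `-(3 * B)` and `B`.
  have hmaxb : ∀ x y : ℤ, -(3 * B) ≤ x → x ≤ B → y ≤ B * (8 * n + 12) →
      |x + max y 0| ≤ B * (8 * n + 16) := by
    intro x y h1 h2 h3
    have h4 := le_max_right y 0
    have h5 : max y 0 ≤ B * (8 * n + 12) := max_le h3 (by nlinarith)
    rw [abs_le]
    constructor <;> nlinarith
  unfold progRaise
  refine WP.mono (WP.forN (fun k σ' => ∃ v, σ' 12 = arrayOf v ∧
    RaisedTo mate W u L dl cnt K k v) (by decide) (by decide) (by decide) hI.size hZ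
    (fun _ _ _ h => h) ⟨u, h12, by simp, by simp, fun _ _ _ => rfl⟩ ?_) ?_
  · intro k hk τ hf hk' hS
    have hR' : TreeRep L dl pr cnt τ := hR.frame (hf 13 (by decide)) (hf 14 (by decide))
      (hf 15 (by decide)) (hf 16 (by decide)) (hf 18 (by decide))
    refine WP.cond (fun hc => ?_) (fun hc => ?_)
    · have hkc := (eval_lt_cnt hk' hR'.size).1 hc
      have hj1 := (hT.mem k hkc).1
      have hj2 := hr.mate_mem _ hj1
      have h1 := abs_le.1 (hslack k hkc)
      have h2 := hd k hkc
      refine raiseNode_spec hr hm hT (hI.frame (hf 0 (by decide)) (hf 8 (by decide))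
        (hf 9 (by decide))) hR' ((congrFun (hf 28 (by decide)) 0).trans h28) hkc hk' hBZ ?_ ?_ ?_ hS
      · exact hmaxb _ _ (hB.ge _ hj1) (hB.le _ hj1) (by linarith)
      · exact fun _ => hmaxb _ _ (hB.ge _ hj2) (hB.le _ hj2) (by linarith)
      · intro _
        rw [abs_le]
        constructor <;> linarith
    · have hkc : ¬ k < cnt := fun h => (eval_lt_cnt hk' hR'.size).2 h hc
      obtain ⟨v, hv12, hv⟩ := hS
      refine WP.skip ⟨v, hv12, fun j hj hjc => hv.node j (by omega) hjc,
        fun j hj h2 hjc => hv.partner j (by omega) h2 hjc,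
        fun e h1 h2 => hv.rest e (fun j hj => h1 j (by omega)) fun j hj => h2 j (by omega)⟩
  · rintro τ _ ⟨v, hv12, hv⟩
    refine ⟨v, hv12, ⟨fun k hk => hv.node k (by omega) hk, fun k h2 hk => hv.partner k (by omega) h2
      hk, fun e _ h1 h2 => hv.rest e (fun j _ hj => h1 j hj) fun j _ hj2 hj => h2 j hj2 hj⟩,
      fun e he => ?_⟩
    have hb := hv.bounds (C := B * (8 * n + 12)) (by nlinarith)
      (fun j hj => by have := hd j hj; linarith)
      (fun j _ hj => by
        have := hd j hj
        have := abs_le.1 (hslack j hj)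
        linarith) e
    have h1 := hB.ge e he
    have h2 := hB.le e he
    rw [abs_le]
    constructor <;> linarith

/-- The first `j` exchanges along a path. -/
def exchanged (mate : Fin n → Fin n) (X : Finset (Fin n)) (L : ℕ → Fin n) (q : ℕ → ℕ) (j : ℕ) :
    Finset (Fin n) :=
  (X \ (Finset.range j).image fun i => mate (L (q i))) ∪ (Finset.range j).image fun i => L (q i)

/-- The entered nodes lie outside `X` and the erased partner inside, so erasing it removes no node
entered so far. -/
lemma exchanged_succ {q : ℕ → ℕ} {j : ℕ} (hY : ∀ i ≤ j, L (q i) ∉ X)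
    (hx : mate (L (q j)) ∈ X) :
    (insert (L (q j)) (exchanged mate X L q j)).erase (mate (L (q j))) =
      exchanged mate X L q (j + 1) := by
  unfold exchanged
  rw [Finset.range_add_one, Finset.image_insert, Finset.image_insert]
  ext e
  simp only [Finset.mem_erase, Finset.mem_insert, Finset.mem_union, Finset.mem_sdiff]
  constructor
  · rintro ⟨h1, h2 | h2 | h2⟩
    · exact Or.inr (Or.inl h2)
    · exact Or.inl ⟨h2.1, by tauto⟩
    · exact Or.inr (Or.inr h2)
  · rintro (⟨h1, h2⟩ | h2 | h2)
    · exact ⟨by tauto, Or.inr (Or.inl ⟨h1, by tauto⟩)⟩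
    · refine ⟨?_, Or.inl h2⟩
      rintro rfl
      exact hY j le_rfl (h2 ▸ hx)
    · refine ⟨?_, Or.inr (Or.inr h2)⟩
      rintro rfl
      obtain ⟨i, hi, hi'⟩ := Finset.mem_image.1 h2
      exact hY i (Finset.mem_range.1 hi).le (hi' ▸ hx)

lemma insert_exchanged {q : ℕ → ℕ} {m : ℕ} :
    insert (L (q m)) (exchanged mate X L q m) = augmented mate X L q m := by
  unfold exchanged augmented
  rw [Finset.range_add_one, Finset.image_insert, Finset.union_insert]

lemma flip_spec (hZ : (n : ℤ) ≤ Z) (hr : Ready M mate W u G X a)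
    (hm : Function.Involutive mate) (hT : Tree M mate W u G X a L dl pr cnt)
    (hI : Inst mate W σ) (hR : TreeRep L dl pr cnt σ) (h11 : σ 11 = ind X)
    {k₀ m : ℕ} {q : ℕ → ℕ} (hk₀ : k₀ < cnt) (h26 : σ 26 0 = k₀) (hP : BackPath pr k₀ q m) :
    WP O Z progFlip (fun σ' => σ' 11 = ind (augmented mate X L q m)) σ := by
  have hcn : cnt ≤ n := by simpa using hT.cnt_le
  have hmc := hP.length_lt hT.pr_lt hk₀
  have hq := hP.lt hT hk₀
  have hqX : ∀ j ≤ m, L (q j) ∉ X := fun j hj => (hT.mem _ (hq j hj)).2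
  have hxX : ∀ j < m, mate (L (q j)) ∈ X := fun j hj =>
    hT.mate_mem hr hm (hP.two_le j hj) (hq j hj.le)
  have hZ1 : 1 ≤ Z := by omega
  refine WP.seq (WP.assign ?_ ?_)
  · rw [eval_get, eval_const, h26, abs_of_nonneg (by omega)]; omega
  rw [eval_get, eval_const, h26]
  -- Up to round `m` register `29` points to node `j` of the path, afterwards it holds `-1`. Since
  -- `m < cnt ≤ n`, the `n` rounds suffice.
  refine WP.mono (WP.forN (fun j σ' =>
    (j ≤ m → σ' 29 0 = q j ∧ σ' 11 = ind (exchanged mate X L q j)) ∧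
    (m < j → σ' 29 0 = -1 ∧ σ' 11 = ind (augmented mate X L q m))) (by decide) (by decide)
    (by decide) hI.size hZ (fun _ _ _ h => h) ⟨fun _ => ⟨?_, ?_⟩, by simp⟩ ?_) ?_
  · change (k₀ : ℤ) = _
    rw [hP.start]
  · change σ 11 = _
    rw [h11]
    simp [exchanged]
  · rintro j hj τ hf hj' ⟨hS1, hS2⟩
    refine WP.cond (fun hc => ?_) (fun hc => ?_)
    · have hjm : j ≤ m := by
        by_contra hlt
        have := (hS2 (by omega)).1
        rw [eval_le, eval_const, eval_get, eval_const, this, if_neg (by omega)] at hc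
        exact hc rfl
      obtain ⟨h29, h11'⟩ := hS1 hjm
      have hqc := hq j hjm
      have en : (node (var 29)).eval τ = ((L (q j) : ℕ) : ℤ) := by
        simp only [eval_get, eval_const, h29, hf 13 (by decide)]
        exact hR.node _ hqc
      refine WP.seq (WP.assign (by simpa [eval_const] using hZ1) ?_)
      rw [en, eval_const]
      have hτ : (τ.set 11 ((L (q j) : ℕ) : ℤ) 1) 11 =
          ind (insert (L (q j)) (exchanged mate X L q j)) := by
        rw [Store.set_self, h11', update_ind_one]
      refine WP.cond (fun hc' => ?_) (fun hc' => ?_)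
      · have hq2 : 2 ≤ q j := by
          by_contra hlt
          apply hc'
          change (if (2 : ℤ) ≤ τ 29 0 then (1 : ℤ) else 0) = 0
          rw [h29, if_neg (by omega)]
        have hjm' : j < m := by
          rcases hjm.lt_or_eq with h | rfl
          · exact h
          · have := hP.last
            omega
        have em : (Exp.get 9 (node (var 29))).eval τ = ((mate (L (q j)) : ℕ) : ℤ) := by
          rw [eval_get, en, hf 9 (by decide)]
          change σ 9 _ = _
          rw [hI.mates, arrayOf_apply]
        have ep : τ 15 (τ 29 0) = (q (j + 1) : ℤ) := by
          rw [h29, hf 15 (by decide), hP.step j hjm']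
          exact hR.pred _ hq2 hqc
        refine WP.seq (WP.assign (by simp [eval_const]; omega) (WP.assign ?_
          ⟨fun _ => ⟨ep, ?_⟩, fun h => by omega⟩))
        · change |τ 15 (τ 29 0)| ≤ Z
          have := hq (j + 1) hjm'
          rw [ep, abs_of_nonneg (by omega)]
          omega
        · change Function.update ((τ.set 11 ((L (q j) : ℕ) : ℤ) 1) 11)
            ((Exp.get 9 (node (var 29))).eval τ) 0 = _
          rw [hτ, em, update_ind_zero,
            exchanged_succ (fun i hi => hqX i (by omega)) (hxX j hjm')]
      · have hq2 : ¬ 2 ≤ q j := by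
          intro h
          change (if (2 : ℤ) ≤ τ 29 0 then (1 : ℤ) else 0) = 0 at hc'
          rw [h29, if_pos (by omega)] at hc'
          exact one_ne_zero hc'
        have hjm' : j = m := by
          rcases hjm.lt_or_eq with h | h
          · exact absurd (hP.two_le j h) hq2
          · exact h
        subst hjm'
        refine WP.assign (by simpa [eval_const] using hZ1) ⟨fun h => by omega, fun _ => ⟨rfl, ?_⟩⟩
        rw [← insert_exchanged]
        exact hτ
    · have hjm : m < j := by
        by_contra hlt
        have := (hS1 (by omega)).1
        rw [eval_le, eval_const, eval_get, eval_const, this, if_pos (by omega)] at hc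
        exact one_ne_zero hc
      exact WP.skip ⟨fun h => by omega, fun _ => hS2 hjm⟩
  · rintro τ _ ⟨_, h⟩
    exact (h (by omega)).2

end Stage

end OracleRAM

namespace OracleRAM

open Pricing

/-! ### One stage, and the whole matroid intersection -/

section Intersect

variable {n : ℕ} {O : Fin 2 → Finset (Fin n) → Prop} {Z B : ℤ} {σ : Store} {M : Matroid (Fin n)}
  {mate : Fin n → Fin n} {W u : Fin n → ℤ} {G X : Finset (Fin n)} {a : Fin n}

lemma erase_ge {N : Finset (Fin n)} {k : ℕ} (hk : k < n) (hN : ∀ e ∈ N, k ≤ (e : ℕ)) :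
    ∀ e ∈ N.erase ⟨k, hk⟩, k + 1 ≤ (e : ℕ) := by
  intro e he
  have h1 := hN e (Finset.mem_of_mem_erase he)
  have h2 : (e : ℕ) ≠ k := fun h => Finset.ne_of_mem_erase he (Fin.ext h)
  omega

lemma eq_empty_of_ge {N : Finset (Fin n)} (hN : ∀ e ∈ N, n ≤ (e : ℕ)) : N = ∅ :=
  Finset.eq_empty_of_forall_notMem fun e he => absurd (hN e he) (by omega)

/-- The old contents matter only in being an indicator array: after `k` rounds the remaining
elements have index at least `k`. `reset_spec` uses the same invariant. -/
lemma clear_nodes_spec (hZ : (n : ℤ) ≤ Z) (hn : σ 0 0 = n) {N : Finset (Fin n)}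
    (hN : σ 16 = ind N) :
    WP O Z (forN 32 (.assign 16 (var 32) (.const 0)))
      (fun σ' => σ' 16 = ind (∅ : Finset (Fin n))) σ := by
  refine WP.mono (WP.forN (fun k σ' => ∃ N : Finset (Fin n), σ' 16 = ind N ∧
    ∀ e ∈ N, k ≤ (e : ℕ)) (by decide) (by decide) (by decide) hn hZ (fun _ _ _ h => h)
    ⟨N, hN, by simp⟩ ?_) ?_
  · rintro k hk τ hf hk' ⟨N, hN, hNk⟩
    refine WP.assign (by simp only [eval_const, abs_zero]; omega)
      ⟨N.erase ⟨k, hk⟩, ?_, erase_ge hk hNk⟩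
    rw [Store.set_self, eval_get, eval_const, hk', hN]
    exact update_ind_zero N ⟨k, hk⟩
  · rintro τ _ ⟨N, hN, hNk⟩
    rw [hN, eq_empty_of_ge hNk]

lemma initPot_spec (hI : Inst mate W σ) (h12 : σ 12 = arrayOf u) (h17 : σ 17 0 = B)
    (h20 : σ 20 0 = ((a : ℕ) : ℤ)) (hW : ∀ e, |W e| ≤ B) (hB : 3 * B ≤ Z) :
    WP O Z progInitPot (fun σ' => σ' 12 = arrayOf
      (Function.update (Function.update u a (W a - 2 * B)) (mate a) (W (mate a) - 2 * B))) σ := by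
  have hWB : ∀ e, |W e - 2 * B| ≤ Z := by
    intro e
    have := abs_le.1 (hW e)
    rw [abs_le]
    constructor <;> linarith
  have ea : (var 20).eval σ = ((a : ℕ) : ℤ) := h20
  have eb : (Exp.get 9 (var 20)).eval σ = ((mate a : ℕ) : ℤ) := by
    rw [eval_get, ea, hI.mates, arrayOf_apply]
  have eWa : (Exp.get 8 (var 20) - .const 2 * var 17).eval σ = W a - 2 * B := by
    rw [eval_sub, eval_get, ea, hI.weights, arrayOf_apply, eval_mul, eval_const, eval_get,
      eval_const, h17]
  have eWb : (Exp.get 8 (.get 9 (var 20)) - .const 2 * var 17).eval σ = W (mate a) - 2 * B := by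
    rw [eval_sub, eval_get, eb, hI.weights, arrayOf_apply, eval_mul, eval_const, eval_get,
      eval_const, h17]
  refine WP.seq (WP.assign (eWa ▸ hWB a) ?_)
  rw [ea, eWa]
  refine WP.assign ?_ ?_
  · change |(Exp.get 8 (.get 9 (var 20)) - .const 2 * var 17).eval σ| ≤ Z
    rw [eWb]
    exact hWB _
  · change Function.update (Function.update (σ 12) _ _) ((Exp.get 9 (var 20)).eval σ)
      ((Exp.get 8 (.get 9 (var 20)) - .const 2 * var 17).eval σ) = _
    rw [eb, eWb, h12, update_arrayOf, update_arrayOf]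

lemma initTree_spec (hZ : (n : ℤ) ≤ Z) (hn2 : (2 : ℤ) ≤ n) (h20 : σ 20 0 = ((a : ℕ) : ℤ))
    (h9 : σ 9 ((a : ℕ) : ℤ) = ((mate a : ℕ) : ℤ)) :
    WP O Z progInitTree (fun σ' => σ' 18 0 = 2 ∧ (σ' 13 0 = ((a : ℕ) : ℤ) ∧
      σ' 13 1 = ((mate a : ℕ) : ℤ)) ∧ σ' 14 0 = 0 ∧ σ' 14 1 = 0) σ := by
  have hab' : ∀ e : Fin n, |((e : ℕ) : ℤ)| ≤ Z := by
    intro e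
    rw [abs_of_nonneg (by omega)]
    omega
  have h0 : |(0 : ℤ)| ≤ Z := by rw [abs_zero]; omega
  have ea : (var 20).eval σ = ((a : ℕ) : ℤ) := h20
  have eb : (Exp.get 9 (var 20)).eval σ = ((mate a : ℕ) : ℤ) := by rw [eval_get, ea, h9]
  refine WP.seq (WP.assign (ea ▸ hab' a) ?_)
  rw [ea]
  refine WP.seq (WP.assign ?_ ?_)
  · change |(Exp.get 9 (var 20)).eval σ| ≤ Z
    rw [eb]
    exact hab' _
  change WP O Z _ _ (Store.set _ 13 1 ((Exp.get 9 (var 20)).eval σ))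
  rw [eb]
  refine WP.seq (WP.assign h0 (WP.seq (WP.assign h0 (WP.assign ?_ ⟨rfl, ⟨rfl, rfl⟩, rfl, rfl⟩))))
  rw [eval_const, abs_of_nonneg (by norm_num)]
  exact hn2.trans hZ

lemma initMarks_spec (hZ : (n : ℤ) ≤ Z) (hI : Inst mate W σ) (h10 : σ 10 = ind G)
    (h20 : σ 20 0 = ((a : ℕ) : ℤ)) {N : Finset (Fin n)} (hN : σ 16 = ind N) :
    WP O Z progInitMarks (fun σ' => σ' 10 = ind (insert a (insert (mate a) G)) ∧
      σ' 16 = ind ({a, mate a} : Finset (Fin n))) σ := by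
  refine WP.seq (WP.mono (clear_nodes_spec hZ hI.size hN) ?_)
  intro τ hf h16
  have f20 : τ 20 = σ 20 := hf 20 (by decide)
  have f9 : τ 9 = σ 9 := hf 9 (by decide)
  have ea : (var 20).eval τ = ((a : ℕ) : ℤ) := by rw [eval_get, f20]; exact h20
  have eb : (Exp.get 9 (var 20)).eval τ = ((mate a : ℕ) : ℤ) := by
    rw [eval_get, ea, f9, hI.mates, arrayOf_apply]
  have h1 : |(1 : ℤ)| ≤ Z := by
    have := a.isLt
    rw [abs_one]
    omega
  have h10' : τ 10 = ind G := (hf 10 (by decide)).trans h10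
  refine WP.seq (WP.assign h1 (WP.seq (WP.assign h1 (WP.seq (WP.assign h1 (WP.assign h1
    ⟨?_, ?_⟩))))))
  · change Function.update (Function.update (τ 10) ((var 20).eval τ) 1)
      ((Exp.get 9 (var 20)).eval τ) 1 = _
    rw [ea, eb, h10', update_ind_one, update_ind_one, Finset.insert_comm]
  · change Function.update (Function.update (τ 16) ((var 20).eval τ) 1)
      ((Exp.get 9 (var 20)).eval τ) 1 = _
    rw [ea, eb, h16, update_ind_one, update_ind_one, Finset.insert_comm, insert_empty_eq]

lemma init_spec (hZ : (n : ℤ) ≤ Z) (hI : Inst mate W σ) (hC : Cur G X u σ) (h17 : σ 17 0 = B)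
    (h20 : σ 20 0 = ((a : ℕ) : ℤ)) (hab : mate a ≠ a) {N : Finset (Fin n)} (hN : σ 16 = ind N)
    (hW : ∀ e, |W e| ≤ B) (hB : 3 * B ≤ Z) :
    WP O Z progInit (fun σ' => Cur (insert a (insert (mate a) G)) X
      (Function.update (Function.update u a (W a - 2 * B)) (mate a) (W (mate a) - 2 * B)) σ' ∧
      TreeRep (fun k => if k = 0 then a else mate a) (fun _ => 0) (fun _ => 0) 2 σ') σ := by
  have hn2 : (2 : ℤ) ≤ n := by
    have h1 := a.isLt
    have h2 := (mate a).isLt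
    have h3 : (mate a : ℕ) ≠ a := fun h => hab (Fin.ext h)
    omega
  refine WP.seq (WP.mono (initPot_spec hI hC.pot h17 h20 hW hB) ?_)
  intro σ₁ f₁ h12₁
  have hI₁ := hI.frame (f₁ 0 (by decide)) (f₁ 8 (by decide)) (f₁ 9 (by decide))
  have h20₁ := (congrFun (f₁ 20 (by decide)) 0).trans h20
  refine WP.seq (WP.mono (initTree_spec hZ hn2 h20₁ (by rw [hI₁.mates, arrayOf_apply])) ?_)
  rintro σ₂ f₂ ⟨h18₂, h13₂, h14₂⟩
  have hI₂ := hI₁.frame (f₂ 0 (by decide)) (f₂ 8 (by decide)) (f₂ 9 (by decide))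
  have h20₂ := (congrFun (f₂ 20 (by decide)) 0).trans h20₁
  refine WP.mono (initMarks_spec hZ hI₂ (G := G) ?_ h20₂ (N := N) ?_) ?_
  · rw [f₂ 10 (by decide), f₁ 10 (by decide), hC.ground]
  · rw [f₂ 16 (by decide), f₁ 16 (by decide), hN]
  rintro σ₃ f₃ ⟨h10₃, h16₃⟩
  refine ⟨⟨h10₃, ?_, ?_⟩, ⟨?_, ?_, ?_, fun k h2 hk => by omega, ?_⟩⟩
  · rw [f₃ 11 (by decide), f₂ 11 (by decide), f₁ 11 (by decide), hC.cur]
  · rw [f₃ 12 (by decide), f₂ 12 (by decide), h12₁]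
  · rw [f₃ 18 (by decide), h18₂]
    rfl
  · intro k hk
    rw [f₃ 13 (by decide)]
    interval_cases k
    · exact h13₂.1
    · exact h13₂.2
  · intro k hk
    rw [f₃ 14 (by decide)]
    interval_cases k
    · exact h14₂.1
    · exact h14₂.2
  · rw [h16₃]
    congr 1
    ext e
    simp [Finset.range_add_one, eq_comm, or_comm]

/-- The memory holds an optimal transversal of `G` together with its splitting, bounded by `B`. -/
structure Solved (M : Matroid (Fin n)) (mate : Fin n → Fin n) (W : Fin n → ℤ)
    (G : Finset (Fin n)) (B : ℤ) (σ : Store) : Prop where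
  extreme : ∃ u X, Extreme M mate W u G X ∧ Cur G X u σ ∧ ∀ e ∈ G, |u e| ≤ B
  weight : ∀ e, |W e| ≤ B
  one_le : 1 ≤ B
  bound : σ 17 0 = B
  nodes : ∃ N : Finset (Fin n), σ 16 = ind N

/-- The set `T` is any feasible transversal; it only guarantees that the search finds a terminal.
The stored bound `B` plays the role of `Λ` in the augmentation. -/
lemma cover_spec (hE : M.E = Set.univ)
    (hO : ∀ Y : Finset (Fin n), O 1 Y ↔ M.Indep (Y : Set (Fin n)))
    (hm : Function.Involutive mate) (hZ : (n : ℤ) ≤ Z) (hBZ : B * (8 * n + 16) ≤ Z)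
    {T : Finset (Fin n)} (hTI : M.Indep (T : Set (Fin n)))
    (hTt : ∀ e, mate e ≠ e → (e ∈ T ↔ mate e ∉ T)) (hI : Inst mate W σ)
    (hS : Solved M mate W G B σ) (h20 : σ 20 0 = ((a : ℕ) : ℤ)) (hab : mate a ≠ a) (ha : a ∉ G) :
    WP O Z (progInit ⨟ progSearch ⨟ progTerminal ⨟ progRaise ⨟ progFlip ⨟
      setVar 17 (var 17 * (.const 8 * var 0 + .const 16)))
      (Solved M mate W (insert a (insert (mate a) G)) (B * (8 * n + 16))) σ := by
  obtain ⟨⟨u, X, hX, hC, hu⟩, hW, hB1, h17, N, hN⟩ := hS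
  have hB0 : 0 ≤ B := zero_le_one.trans hB1
  have hBn : 0 ≤ B * n := by positivity
  have hb : mate a ∉ G := fun h => ha (by simpa only [hm a] using hX.mate_mem _ h)
  set G' := insert a (insert (mate a) G) with hG'
  set u₁ := Function.update (Function.update u a (W a - 2 * B)) (mate a) (W (mate a) - 2 * B)
    with hu₁
  have hu₁a : u₁ a = W a - 2 * B := by
    rw [hu₁, Function.update_of_ne hab.symm, Function.update_self]
  have hu₁b : u₁ (mate a) = W (mate a) - 2 * B := by rw [hu₁, Function.update_self]
  have hu₁G : ∀ e ∈ G, u₁ e = u e := by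
    intro e he
    rw [hu₁, Function.update_of_ne (ne_of_mem_of_not_mem he hb),
      Function.update_of_ne (ne_of_mem_of_not_mem he ha)]
  -- As weights and old potentials are bounded by `B`, subtracting `2 * B` brings the new potentials
  -- to at most `-B`, hence below those on `X`.
  have hr : Ready M mate W u₁ G' X a := by
    refine hX.ready hm ha hab hu₁G hu₁a hu₁b ?_ ?_
    · intro x hx
      have := abs_le.1 (hW a)
      have := abs_le.1 (hu x (hX.sub hx))
      linarith
    · intro x hx
      have := abs_le.1 (hW (mate a))
      have := abs_le.1 (hu x (hX.sub hx))
      linarith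
  have hP : PotBound W u₁ G' B := by
    have key : ∀ e ∈ G', u₁ e ≤ B ∧ -(3 * B) ≤ u₁ e := by
      intro e he
      rcases Finset.mem_insert.1 he with rfl | he
      · have := abs_le.1 (hW e)
        rw [hu₁a]
        constructor <;> linarith
      rcases Finset.mem_insert.1 he with rfl | he
      · have := abs_le.1 (hW (mate a))
        rw [hu₁b]
        constructor <;> linarith
      · have := abs_le.1 (hu e he)
        rw [hu₁G e he]
        constructor <;> linarith
    exact ⟨hW, fun e he => (key e he).1, fun e he => (key e he).2⟩
  refine WP.seq (WP.mono (init_spec hZ hI hC h17 h20 hab hN hW (by linarith)) ?_)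
  rintro σ₁ f₁ ⟨hC₁, hR₁⟩
  have hI₁ := hI.frame (f₁ 0 (by decide)) (f₁ 8 (by decide)) (f₁ 9 (by decide))
  have h17₁ : σ₁ 17 0 = B := (congrFun (f₁ 17 (by decide)) 0).trans h17
  have hT₁ : Tree M mate W u₁ G' X a (fun k => if k = 0 then a else mate a) (fun _ => 0)
    (fun _ => 0) 2 := hr.tree hm rfl rfl rfl rfl
  refine WP.seq (WP.mono (search_spec hO hm hZ hP (by linarith) hr hT₁ hI₁ hC₁ hR₁) ?_)
  rintro σ₂ f₂ ⟨h11₂, L, dl, pr, cnt, hT, hCl, hR₂⟩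
  have hI₂ := hI₁.frame (f₂ 0 (by decide)) (f₂ 8 (by decide)) (f₂ 9 (by decide))
  have h17₂ : σ₂ 17 0 = B := (congrFun (f₂ 17 (by decide)) 0).trans h17₁
  have h12₂ : σ₂ 12 = arrayOf u₁ := (f₂ 12 (by decide)).trans hC₁.pot
  have h10₂ : σ₂ 10 = ind G' := (f₂ 10 (by decide)).trans hC₁.ground
  refine WP.seq (WP.mono (terminal_spec hO hm hZ hP (by linarith) hr hT hI₂ h12₂ h11₂ hR₂ h17₂
    (hT.exists_terminal hE hr hm hCl hTI fun e he => hTt e (hr.mate_ne e he))) ?_)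
  rintro σ₃ f₃ ⟨h11₃, k₀, hk₀, h26₃, h28₃⟩
  have hI₃ := hI₂.frame (f₃ 0 (by decide)) (f₃ 8 (by decide)) (f₃ 9 (by decide))
  have hR₃ := hR₂.frame (f₃ 13 (by decide)) (f₃ 14 (by decide)) (f₃ 15 (by decide))
    (f₃ 16 (by decide)) (f₃ 18 (by decide))
  refine WP.seq (WP.mono (raise_spec hZ hP hBZ hr hm hT hI₃ hR₃
    ((f₃ 12 (by decide)).trans h12₂) h28₃ hk₀.lt rfl) ?_)
  rintro σ₄ f₄ ⟨u', h12₄, hU, hu'⟩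
  have hI₄ := hI₃.frame (f₄ 0 (by decide)) (f₄ 8 (by decide)) (f₄ 9 (by decide))
  have hR₄ := hR₃.frame (f₄ 13 (by decide)) (f₄ 14 (by decide)) (f₄ 15 (by decide))
    (f₄ 16 (by decide)) (f₄ 18 (by decide))
  obtain ⟨q, m, hQ⟩ := exists_backPath hT.pr_lt k₀ hk₀.lt
  refine WP.seq (WP.mono (flip_spec hZ hr hm hT hI₄ hR₄ ((f₄ 11 (by decide)).trans h11₃)
    hk₀.lt ((congrFun (f₄ 26 (by decide)) 0).trans h26₃) hQ) ?_)
  intro σ₅ f₅ h11₅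
  have h0₅ : σ₅ 0 0 = n := (congrFun (f₅ 0 (by decide)) 0).trans hI₄.size
  have h17₅ : σ₅ 17 0 = B := by
    rw [f₅ 17 (by decide), f₄ 17 (by decide), f₃ 17 (by decide), h17₂]
  have h10₅ : σ₅ 10 = ind G' := by
    rw [f₅ 10 (by decide), f₄ 10 (by decide), f₃ 10 (by decide), h10₂]
  have ev : (var 17 * (.const 8 * var 0 + .const 16)).eval σ₅ = B * (8 * n + 16) := by
    simp only [eval_mul, eval_add, eval_get, eval_const, h17₅, h0₅]
  have hBB : B ≤ B * (8 * n + 16) := by linarith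
  refine WP.assign (by rw [ev, abs_of_nonneg (hB0.trans hBB)]; exact hBZ) ⟨⟨u', _,
    extreme_augmented hE hr hm hT hCl hk₀ hP.le rfl hU hQ, ⟨h10₅, h11₅, ?_⟩, hu'⟩,
    fun e => (hW e).trans hBB, hB1.trans hBB, ev, _, (f₅ 16 (by decide)).trans hR₄.nodes⟩
  exact (f₅ 12 (by decide)).trans h12₄

/-- The elements of the pairs whose first element is less than `j`. -/
def coveredBelow (mate : Fin n → Fin n) (j : ℕ) : Finset (Fin n) :=
  (paired mate).filter fun e => (e : ℕ) < j ∨ (mate e : ℕ) < j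

lemma coveredBelow_zero : coveredBelow mate 0 = ∅ := by
  simp [coveredBelow]

lemma coveredBelow_self : coveredBelow mate n = paired mate := by
  refine Finset.filter_true_of_mem fun e _ => Or.inl e.isLt

/-- A pair is covered in the stage of its smaller element; the stage of the larger one changes
nothing. -/
lemma coveredBelow_succ_of_lt (hm : Function.Involutive mate) {j : ℕ} (hj : j < n)
    (h : j < (mate ⟨j, hj⟩ : ℕ)) :
    insert ⟨j, hj⟩ (insert (mate ⟨j, hj⟩) (coveredBelow mate j)) = coveredBelow mate (j + 1) := by
  ext e
  have h1 : e = ⟨j, hj⟩ ↔ (e : ℕ) = j := Fin.ext_iff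
  have h2 : e = mate ⟨j, hj⟩ ↔ (mate e : ℕ) = j := by
    rw [eq_comm, hm.eq_iff, eq_comm, Fin.ext_iff]
  have h3 : mate e ≠ e ↔ (mate e : ℕ) ≠ e := by rw [ne_eq, Fin.ext_iff]
  have h4 : e = ⟨j, hj⟩ → mate e ≠ e := by
    rintro rfl h'
    rw [h'] at h
    exact lt_irrefl _ h
  have h5 : e = mate ⟨j, hj⟩ → mate e ≠ e := by
    rintro rfl h'
    rw [hm] at h'
    rw [← h'] at h
    exact lt_irrefl _ h
  simp only [coveredBelow, Finset.mem_insert, Finset.mem_filter, mem_paired]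
  omega

lemma coveredBelow_succ_of_ge (hm : Function.Involutive mate) {j : ℕ} (hj : j < n)
    (h : (mate ⟨j, hj⟩ : ℕ) ≤ j) : coveredBelow mate (j + 1) = coveredBelow mate j := by
  ext e
  have h1 : (e : ℕ) = j → (mate e : ℕ) ≤ j := by
    intro h'
    rwa [show e = ⟨j, hj⟩ from Fin.ext h']
  have h2 : (mate e : ℕ) = j → (e : ℕ) ≤ j := by
    intro h'
    rwa [show e = mate ⟨j, hj⟩ by rw [← show mate e = ⟨j, hj⟩ from Fin.ext h', hm]]
  have h3 : mate e ≠ e ↔ (mate e : ℕ) ≠ e := by rw [ne_eq, Fin.ext_iff]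
  simp only [coveredBelow, Finset.mem_filter, mem_paired]
  omega

lemma reset_spec (hZ : (n : ℤ) ≤ Z) (hn : σ 0 0 = n) {G X : Finset (Fin n)} (h10 : σ 10 = ind G)
    (h11 : σ 11 = ind X) :
    WP O Z progReset (fun σ' => σ' 10 = ind (∅ : Finset (Fin n)) ∧
      σ' 11 = ind (∅ : Finset (Fin n))) σ := by
  refine WP.mono (WP.forN (fun k σ' => (∃ N : Finset (Fin n), σ' 10 = ind N ∧
    ∀ e ∈ N, k ≤ (e : ℕ)) ∧ ∃ N : Finset (Fin n), σ' 11 = ind N ∧ ∀ e ∈ N, k ≤ (e : ℕ))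
    (by decide) (by decide) (by decide) hn hZ (fun _ _ _ h => h)
    ⟨⟨G, h10, by simp⟩, X, h11, by simp⟩ ?_) ?_
  · rintro k hk τ hf hk' ⟨⟨G, hG, hGk⟩, X, hX, hXk⟩
    have h0 : |(0 : ℤ)| ≤ Z := by rw [abs_zero]; omega
    refine WP.seq (WP.assign h0 (WP.assign h0
      ⟨⟨G.erase ⟨k, hk⟩, ?_, erase_ge hk hGk⟩, X.erase ⟨k, hk⟩, ?_, erase_ge hk hXk⟩))
    · change Function.update (τ 10) (τ 32 0) 0 = _
      rw [hk', hG]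
      exact update_ind_zero G ⟨k, hk⟩
    · change Function.update (τ 11) (τ 32 0) 0 = _
      rw [hk', hX]
      exact update_ind_zero X ⟨k, hk⟩
  · rintro τ _ ⟨⟨G, hG, hGk⟩, X, hX, hXk⟩
    rw [hG, hX, eq_empty_of_ge hGk, eq_empty_of_ge hXk]
    exact ⟨rfl, rfl⟩

/-- The first `k` elements. -/
def below (n k : ℕ) : Finset (Fin n) := Finset.univ.filter fun e => (e : ℕ) < k

lemma below_zero : below n 0 = ∅ := by simp [below]

lemma below_self : below n n = Finset.univ := Finset.filter_true_of_mem fun e _ => e.isLt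

lemma notMem_below {k : ℕ} (hk : k < n) : (⟨k, hk⟩ : Fin n) ∉ below n k := by simp [below]

lemma below_succ {k : ℕ} (hk : k < n) : below n (k + 1) = insert ⟨k, hk⟩ (below n k) := by
  ext e
  simp only [below, Finset.mem_filter, Finset.mem_univ, true_and, Finset.mem_insert, Fin.ext_iff]
  omega

lemma bound_spec (hZ : (n : ℤ) ≤ Z) (hBZ : 1 + ∑ e, W e * W e ≤ Z) (hn : σ 0 0 = n)
    (h8 : σ 8 = arrayOf W) :
    WP O Z progBound (fun σ' => σ' 17 0 = 1 + ∑ e, W e * W e) σ := by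
  have hle : ∀ k : ℕ, 0 ≤ 1 + ∑ e ∈ below n k, W e * W e ∧
      1 + ∑ e ∈ below n k, W e * W e ≤ Z := by
    intro k
    have h1 : 0 ≤ ∑ e ∈ below n k, W e * W e :=
      Finset.sum_nonneg fun e _ => mul_self_nonneg (W e)
    have h2 : ∑ e ∈ below n k, W e * W e ≤ ∑ e, W e * W e :=
      Finset.sum_le_sum_of_subset_of_nonneg (Finset.filter_subset _ _)
        fun e _ _ => mul_self_nonneg (W e)
    omega
  have hZ1 : 1 ≤ Z := by simpa [below_zero] using (hle 0).2
  refine WP.seq (WP.assign (by simpa [eval_const] using hZ1) (WP.mono (WP.forN (fun k σ' =>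
    σ' 17 0 = 1 + ∑ e ∈ below n k, W e * W e) (by decide) (by decide) (by decide) hn hZ
    (fun _ _ _ h => h) ?_ ?_) ?_))
  · change (1 : ℤ) = _
    simp [below_zero]
  · intro k hk τ hf hk' h17
    have ev : (var 17 + .get 8 (var 32) * .get 8 (var 32)).eval τ =
        1 + ∑ e ∈ below n (k + 1), W e * W e := by
      have : τ 8 k = W ⟨k, hk⟩ := by
        rw [hf 8 (by decide)]
        change σ 8 _ = _
        rw [h8]
        exact arrayOf_apply W ⟨k, hk⟩
      simp only [eval_add, eval_mul, eval_get, eval_const, hk', h17, this]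
      rw [below_succ hk, Finset.sum_insert (notMem_below hk)]
      ring
    refine WP.assign ?_ ev
    rw [ev, abs_of_nonneg (hle _).1]
    exact (hle _).2
  · intro τ _ h
    rw [h, below_self]

/-- Because `|x| ≤ 1 + x * x`, a sum of squares bounds all weights without any case distinction on
signs. -/
lemma abs_le_bound (W : Fin n → ℤ) (e : Fin n) : |W e| ≤ 1 + ∑ e, W e * W e := by
  have h1 : W e * W e ≤ ∑ e, W e * W e :=
    Finset.single_le_sum (f := fun e => W e * W e) (fun e _ => mul_self_nonneg (W e))
      (Finset.mem_univ e)
  have h2 : |W e| ≤ 1 + W e * W e := by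
    rw [abs_le]
    constructor <;> nlinarith
  omega

lemma extreme_empty (M : Matroid (Fin n)) (mate : Fin n → Fin n) (W u : Fin n → ℤ) :
    Extreme M mate W u ∅ ∅ := by
  constructor <;> simp

lemma intersect_spec (hE : M.E = Set.univ)
    (hO : ∀ Y : Finset (Fin n), O 1 Y ↔ M.Indep (Y : Set (Fin n)))
    (hm : Function.Involutive mate) (hZ : (n : ℤ) ≤ Z)
    (hBZ : (1 + ∑ e, W e * W e) * (8 * n + 16) ^ (n + 1) ≤ Z)
    {T : Finset (Fin n)} (hTI : M.Indep (T : Set (Fin n)))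
    (hTt : ∀ e, mate e ≠ e → (e ∈ T ↔ mate e ∉ T)) (hI : Inst mate W σ)
    {G X : Finset (Fin n)} (h10 : σ 10 = ind G) (h11 : σ 11 = ind X) (h12 : σ 12 = arrayOf u)
    {N : Finset (Fin n)} (hN : σ 16 = ind N) :
    WP O Z progIntersect (fun σ' => ∃ B ≤ (1 + ∑ e, W e * W e) * (8 * n + 16) ^ n,
      Solved M mate W (paired mate) B σ') σ := by
  have hB₀ : 1 ≤ 1 + ∑ e, W e * W e := by
    have : 0 ≤ ∑ e, W e * W e := Finset.sum_nonneg fun e _ => mul_self_nonneg (W e)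
    omega
  set B₀ := 1 + ∑ e, W e * W e with hB₀'
  have hpow : ∀ k ≤ n + 1, B₀ * (8 * n + 16) ^ k ≤ Z := by
    intro k hk
    refine le_trans ?_ hBZ
    gcongr
    omega
  refine WP.seq (WP.mono (reset_spec hZ hI.size h10 h11) ?_)
  rintro σ₁ hf₁ ⟨h10₁, h11₁⟩
  have hI₁ := hI.frame (hf₁ 0 (by decide)) (hf₁ 8 (by decide)) (hf₁ 9 (by decide))
  refine WP.seq (WP.mono (bound_spec hZ (by simpa using hpow 0 (by omega)) hI₁.size hI₁.weights) ?_)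
  intro τ hf h17
  have hI' := hI₁.frame (hf 0 (by decide)) (hf 8 (by decide)) (hf 9 (by decide))
  -- For the empty ground set every potential is a splitting, so values left over in array `12` are
  -- harmless.
  have hτ : Solved M mate W ∅ B₀ τ := by
    refine ⟨⟨u, ∅, extreme_empty M mate W u, ⟨?_, ?_, ?_⟩, by simp⟩, abs_le_bound W, hB₀,
      h17, N, ?_⟩
    · rw [hf 10 (by decide), h10₁]
    · rw [hf 11 (by decide), h11₁]
    · rw [hf 12 (by decide), hf₁ 12 (by decide), h12]
    · rw [hf 16 (by decide), hf₁ 16 (by decide), hN]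
  refine WP.mono (WP.forN (fun k σ' => ∃ B ≤ B₀ * (8 * n + 16) ^ k,
    Solved M mate W (coveredBelow mate k) B σ') (by decide) (by decide) (by decide) hI'.size hZ
    ?_ ?_ ?_) ?_
  · rintro k σ' v ⟨B, hB, h⟩
    obtain ⟨⟨u, X, hX, hC, hu⟩, hW, hB1, h17, N, hN⟩ := h
    exact ⟨B, hB, ⟨u, X, hX, ⟨hC.1, hC.2, hC.3⟩, hu⟩, hW, hB1, h17, N, hN⟩
  · exact ⟨B₀, by simp, by rwa [coveredBelow_zero]⟩
  · rintro k hk σ' hf' hk' ⟨B, hB, hS⟩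
    have hI'' := hI'.frame (hf' 0 (by decide)) (hf' 8 (by decide)) (hf' 9 (by decide))
    have hc : (Exp.op .le (var 20 + .const 1) (.get 9 (var 20))).eval σ' =
        if k < (mate ⟨k, hk⟩ : ℕ) then 1 else 0 := by
      have : σ' 9 k = ((mate ⟨k, hk⟩ : ℕ) : ℤ) := by
        rw [hI''.mates]
        exact arrayOf_apply _ ⟨k, hk⟩
      simp only [eval_le, eval_add, eval_get, eval_const, hk', this]
      exact if_congr (by omega) rfl rfl
    have hn0 : (1 : ℤ) ≤ 8 * n + 16 := by omega
    refine WP.cond (fun hc' => ?_) (fun hc' => ?_)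
    · have hlt : k < (mate ⟨k, hk⟩ : ℕ) := by
        by_contra h
        rw [hc, if_neg h] at hc'
        exact hc' rfl
      have hab : mate ⟨k, hk⟩ ≠ ⟨k, hk⟩ := fun h => by
        rw [h] at hlt
        exact lt_irrefl _ hlt
      have hBk : B * (8 * n + 16) ≤ B₀ * (8 * n + 16) ^ (k + 1) := by
        rw [pow_succ, ← mul_assoc]
        gcongr
      refine WP.mono (cover_spec hE hO hm hZ (hBk.trans (hpow _ (by omega))) hTI hTt hI'' hS hk'
        hab ?_) ?_
      · simp only [coveredBelow, Finset.mem_filter, not_and]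
        intro _
        omega
      · intro σ'' _ h
        rw [coveredBelow_succ_of_lt hm hk hlt] at h
        exact ⟨_, hBk, h⟩
    · have hge : (mate ⟨k, hk⟩ : ℕ) ≤ k := by
        by_contra h
        rw [hc, if_pos (by omega)] at hc'
        exact one_ne_zero hc'
      refine WP.skip ⟨B, hB.trans ?_, by rwa [coveredBelow_succ_of_ge hm hk hge]⟩
      gcongr
      omega
  · rintro σ' _ ⟨B, hB, h⟩
    rw [coveredBelow_self] at h
    exact ⟨B, hB, h⟩

end Intersect

end OracleRAM

namespace OracleRAM

open Pricing

section Arrays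

variable {n : ℕ}

/-- The first `k` values of `f`, continued by `g`. -/
def upto (k : ℕ) (f g : Fin n → ℤ) (e : Fin n) : ℤ := if (e : ℕ) < k then f e else g e

lemma upto_zero (f g : Fin n → ℤ) : upto 0 f g = g := by
  funext e
  simp [upto]

lemma upto_self (f g : Fin n → ℤ) : upto n f g = f := by
  funext e
  simp [upto]

lemma update_upto (f g : Fin n → ℤ) {k : ℕ} (hk : k < n) :
    Function.update (upto k f g) ⟨k, hk⟩ (f ⟨k, hk⟩) = upto (k + 1) f g := by
  funext e
  rcases eq_or_ne e ⟨k, hk⟩ with rfl | he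
  · simp [upto]
  · have : (e : ℕ) ≠ k := fun h => he (Fin.ext h)
    rw [Function.update_of_ne he]
    exact if_congr (by omega) rfl rfl

lemma update_arrayOf_upto (f g : Fin n → ℤ) {k : ℕ} (hk : k < n) {v : ℤ} (hv : v = f ⟨k, hk⟩) :
    Function.update (arrayOf (upto k f g)) (k : ℤ) v = arrayOf (upto (k + 1) f g) := by
  rw [hv, ← update_upto f g hk, ← update_arrayOf]

end Arrays

/-! ### Integral weights, mates, modified weights and output -/

section Preprocessing

variable {n : ℕ} {O : Fin 2 → Finset (Fin n) → Prop} {Z : ℤ} {σ : Store}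

lemma den_spec (hZ : (n : ℤ) ≤ Z) (hn : σ 0 0 = n) {d₁ d₂ : Fin n → ℤ} (h2 : σ 2 = arrayOf d₁)
    (h4 : σ 4 = arrayOf d₂) (hd₁ : ∀ e, 1 ≤ d₁ e) (hd₂ : ∀ e, 1 ≤ d₂ e)
    (hD : ∏ e, (d₁ e * d₂ e) ≤ Z) :
    WP O Z progDen (fun σ' => σ' 7 0 = ∏ e, (d₁ e * d₂ e)) σ := by
  have hpos : ∀ e, 1 ≤ d₁ e * d₂ e := fun e => one_le_mul_of_one_le_of_one_le (hd₁ e) (hd₂ e)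
  have hle : ∀ k : ℕ, 0 ≤ ∏ e ∈ below n k, (d₁ e * d₂ e) ∧
      ∏ e ∈ below n k, (d₁ e * d₂ e) ≤ Z := by
    intro k
    refine ⟨Finset.prod_nonneg fun e _ => zero_le_one.trans (hpos e), le_trans ?_ hD⟩
    -- A partial product divides the full product of positive integers, so it stays below `Z`.
    exact Int.le_of_dvd (Finset.prod_pos fun e _ => hpos e)
      (Finset.prod_dvd_prod_of_subset _ _ _ (Finset.filter_subset _ _))
  have hZ1 : 1 ≤ Z := by simpa [below_zero] using (hle 0).2
  refine WP.seq (WP.assign (by simpa [eval_const] using hZ1) (WP.mono (WP.forN (fun k σ' =>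
    σ' 7 0 = ∏ e ∈ below n k, (d₁ e * d₂ e)) (by decide) (by decide) (by decide) hn hZ
    (fun _ _ _ h => h) ?_ ?_) ?_))
  · change (1 : ℤ) = _
    simp [below_zero]
  · intro k hk τ hf hk' h7
    have ev : (var 7 * (.get 2 (var 32) * .get 4 (var 32))).eval τ =
        ∏ e ∈ below n (k + 1), (d₁ e * d₂ e) := by
      have f2 : τ 2 k = d₁ ⟨k, hk⟩ := by
        rw [hf 2 (by decide)]
        change σ 2 _ = _
        rw [h2]
        exact arrayOf_apply d₁ ⟨k, hk⟩
      have f4 : τ 4 k = d₂ ⟨k, hk⟩ := by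
        rw [hf 4 (by decide)]
        change σ 4 _ = _
        rw [h4]
        exact arrayOf_apply d₂ ⟨k, hk⟩
      simp only [eval_mul, eval_get, eval_const, hk', h7, f2, f4]
      rw [below_succ hk, Finset.prod_insert (notMem_below hk), mul_comm]
    refine WP.assign ?_ ev
    rw [ev, abs_of_nonneg (hle _).1]
    exact (hle _).2
  · intro τ _ h
    rw [h, below_self]

lemma weights_spec (hZ : (n : ℤ) ≤ Z) (hn : σ 0 0 = n) {a₁ a₂ d₁ d₂ g : Fin n → ℤ} {D : ℤ}
    (h1 : σ 1 = arrayOf a₁) (h2 : σ 2 = arrayOf d₁) (h3 : σ 3 = arrayOf a₂)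
    (h4 : σ 4 = arrayOf d₂) (h7 : σ 7 0 = D) (h8 : σ 8 = arrayOf g)
    (hW : ∀ e, |a₂ e * (D / d₂ e) - a₁ e * (D / d₁ e)| ≤ Z) :
    WP O Z progWeights
      (fun σ' => σ' 8 = arrayOf fun e => a₂ e * (D / d₂ e) - a₁ e * (D / d₁ e)) σ := by
  refine WP.mono (WP.forN (fun k σ' => σ' 8 = arrayOf (upto k
    (fun e => a₂ e * (D / d₂ e) - a₁ e * (D / d₁ e)) g)) (by decide) (by decide) (by decide) hn hZ
    (fun _ _ _ h => h) (by rwa [upto_zero]) ?_) ?_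
  · intro k hk τ hf hk' h
    have ev : (Exp.get 3 (var 32) * (var 7 / .get 4 (var 32)) -
        .get 1 (var 32) * (var 7 / .get 2 (var 32))).eval τ =
        a₂ ⟨k, hk⟩ * (D / d₂ ⟨k, hk⟩) - a₁ ⟨k, hk⟩ * (D / d₁ ⟨k, hk⟩) := by
      have f : ∀ g : Fin n → ℤ, arrayOf g (k : ℤ) = g ⟨k, hk⟩ := fun g => arrayOf_apply g ⟨k, hk⟩
      simp only [eval_mul, eval_sub, eval_div, eval_get, eval_const, hk', hf 1 (by decide),
        hf 2 (by decide), hf 3 (by decide), hf 4 (by decide), hf 7 (by decide), h1, h2, h3, h4, h7,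
        f]
    refine WP.assign (by rw [ev]; exact hW _) ?_
    rw [Store.set_self, ev, eval_get, eval_const, hk', h]
    exact update_arrayOf_upto _ _ hk rfl
  · intro τ _ h
    rw [h, upto_self]

open Classical in
lemma probePair_spec {M₁ : Matroid (Fin n)} {mate : Fin n → Fin n} (hM : IsMate M₁ mate)
    (hO : ∀ Y : Finset (Fin n), O 0 Y ↔ M₁.Indep (Y : Set (Fin n))) (hZ : 1 ≤ Z)
    {s t : Fin n} (hst : s ≠ t) (h32 : σ 32 0 = ((s : ℕ) : ℤ)) (h33 : σ 33 0 = ((t : ℕ) : ℤ))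
    (h31 : σ 31 = ind (∅ : Finset (Fin n))) :
    WP O Z progProbePair (fun σ' => σ' 31 = ind (∅ : Finset (Fin n)) ∧
      σ' 19 0 = if mate s = t then 0 else 1) σ := by
  have h0 : |(0 : ℤ)| ≤ Z := by rw [abs_zero]; omega
  have h1 : |(1 : ℤ)| ≤ Z := by rwa [abs_one]
  refine WP.seq (WP.assign h1 (WP.seq (WP.assign h1 (WP.seq (WP.query hZ ?_)))))
  refine WP.seq (WP.assign h0 (WP.assign h0 ?_))
  set σ₂ := (σ.set 31 ((var 32).eval σ) 1).set 31 ((var 33).eval σ) 1 with hσ₂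
  have h31' : σ₂ 31 = ind {s, t} := by
    rw [hσ₂, Store.set_self, Store.set_self, eval_get, eval_get, eval_const, h31, h32, h33,
      update_ind_one, update_ind_one, insert_empty_eq, Finset.pair_comm]
  constructor
  · change Function.update (Function.update (σ₂ 31) (σ 32 0) 0) (σ 33 0) 0 = _
    rw [h31', h32, h33, update_ind_zero, update_ind_zero]
    congr 1
    ext e
    simp only [Finset.mem_erase, Finset.mem_insert, Finset.mem_singleton, Finset.notMem_empty]
    tauto
  · change (if O 0 (σ₂.subset n 31) then (1 : ℤ) else 0) = _
    rw [subset_eq h31']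
    have hq : O 0 {s, t} ↔ mate s ≠ t := by rw [hO, hM.indep_pair_iff hst]
    by_cases h : mate s = t
    · rw [if_pos h, if_neg fun h' => hq.1 h' h]
    · rw [if_neg h, if_pos (hq.2 h)]

lemma testPair_spec {M₁ : Matroid (Fin n)} {mate : Fin n → Fin n} (hM : IsMate M₁ mate)
    (hO : ∀ Y : Finset (Fin n), O 0 Y ↔ M₁.Indep (Y : Set (Fin n))) (hZ : (n : ℤ) ≤ Z)
    {F : Fin n → ℤ} {s t : Fin n} (h32 : σ 32 0 = ((s : ℕ) : ℤ)) (h33 : σ 33 0 = ((t : ℕ) : ℤ))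
    (h31 : σ 31 = ind (∅ : Finset (Fin n))) (h9 : σ 9 = arrayOf F) :
    WP O Z progTestPair (fun σ' => σ' 31 = ind (∅ : Finset (Fin n)) ∧
      σ' 9 = arrayOf (if s ≠ t ∧ mate s = t then Function.update F s ((t : ℕ) : ℤ) else F)) σ := by
  have hZ1 : 1 ≤ Z := by
    have := s.isLt
    omega
  have hc : (Exp.op .eq (var 32) (var 33)).eval σ = if s = t then 1 else 0 := by
    simp only [eval_eq, eval_get, eval_const, h32, h33]
    exact if_congr (by rw [Fin.ext_iff]; omega) rfl rfl
  refine WP.cond (fun hc' => ?_) (fun hc' => ?_)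
  · have hst : s = t := by
      by_contra h
      rw [hc, if_neg h] at hc'
      exact hc' rfl
    exact WP.skip ⟨h31, by rw [if_neg (fun h => h.1 hst)]; exact h9⟩
  · have hst : s ≠ t := by
      intro h
      rw [hc, if_pos h] at hc'
      exact one_ne_zero hc'
    refine WP.seq (WP.mono (probePair_spec hM hO hZ1 hst h32 h33 h31) ?_)
    rintro τ hf ⟨h31', h19⟩
    have h9' : τ 9 = arrayOf F := (hf 9 (by decide)).trans h9
    have h32' : τ 32 0 = ((s : ℕ) : ℤ) := (congrFun (hf 32 (by decide)) 0).trans h32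
    have h33' : τ 33 0 = ((t : ℕ) : ℤ) := (congrFun (hf 33 (by decide)) 0).trans h33
    refine WP.cond (fun hc' => ?_) (fun hc' => ?_)
    · have hne : mate s ≠ t := by
        intro h
        rw [eval_get, eval_const, h19, if_pos h] at hc'
        exact hc' rfl
      exact WP.skip ⟨h31', by rwa [if_neg fun h => hne h.2]⟩
    · have heq : mate s = t := by
        by_contra h
        rw [eval_get, eval_const, h19, if_neg h] at hc'
        exact one_ne_zero hc'
      refine WP.assign ?_ ⟨h31', ?_⟩
      · rw [eval_get, eval_const, h33', abs_of_nonneg (by omega)]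
        omega
      · rw [Store.set_self, eval_get, eval_get, eval_const, h9', h32', h33', update_arrayOf,
          if_pos ⟨hst, heq⟩]

lemma mates_spec {M₁ : Matroid (Fin n)} {mate : Fin n → Fin n} (hM : IsMate M₁ mate)
    (hO : ∀ Y : Finset (Fin n), O 0 Y ↔ M₁.Indep (Y : Set (Fin n))) (hZ : (n : ℤ) ≤ Z)
    (hn : σ 0 0 = n) {g : Fin n → ℤ} (h31 : σ 31 = ind (∅ : Finset (Fin n)))
    (h9 : σ 9 = arrayOf g) :
    WP O Z progMates (fun σ' => σ' 9 = arrayOf fun e => ((mate e : ℕ) : ℤ)) σ := by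
  refine WP.mono (WP.forN (fun k σ' => σ' 31 = ind (∅ : Finset (Fin n)) ∧
    σ' 9 = arrayOf (upto k (fun e => ((mate e : ℕ) : ℤ)) g)) (by decide) (by decide) (by decide)
    hn hZ (fun _ _ _ h => h) ⟨h31, by rwa [upto_zero]⟩ ?_) ?_
  · rintro k hk τ hf hk' ⟨h31', h9'⟩
    set F := upto k (fun e => ((mate e : ℕ) : ℤ)) g with hF
    have hn' : τ 0 0 = n := (congrFun (hf 0 (by decide)) 0).trans hn
    -- The entry starts as the element itself, which is right for a one-element class, and is
    -- overwritten once the scan has passed the mate.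
    refine WP.seq (WP.assign ?_ (WP.mono (WP.forN (fun j σ' => σ' 31 = ind (∅ : Finset (Fin n)) ∧
      σ' 9 = arrayOf (Function.update F ⟨k, hk⟩
        (if (mate ⟨k, hk⟩ : ℕ) < j then ((mate ⟨k, hk⟩ : ℕ) : ℤ) else k))) (by decide) (by decide)
        (by decide) hn' hZ (fun _ _ _ h => h) ⟨h31', ?_⟩ ?_) ?_))
    · rw [eval_get, eval_const, hk', abs_of_nonneg (by omega)]
      omega
    · change Function.update (τ 9) (τ 32 0) (τ 32 0) = _
      rw [hk', h9', if_neg (by omega)]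
      exact update_arrayOf F ⟨k, hk⟩ k
    · rintro j hj ρ hg hj' ⟨h31'', h9''⟩
      have h32 : ρ 32 0 = k := (congrFun (hg 32 (by decide)) 0).trans hk'
      refine WP.mono (testPair_spec hM hO hZ (s := ⟨k, hk⟩) (t := ⟨j, hj⟩) h32 hj' h31'' h9'') ?_
      rintro ρ' _ ⟨h31''', h9'''⟩
      refine ⟨h31''', ?_⟩
      rw [h9''']
      congr 1
      have hm : mate ⟨k, hk⟩ = ⟨j, hj⟩ ↔ (mate ⟨k, hk⟩ : ℕ) = j := Fin.ext_iff
      by_cases hkj : k = j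
      -- The test is skipped for the element itself; if it is its own mate, both branches of the
      -- invariant give the same value.
      · subst hkj
        rw [if_neg (by simp)]
        congr 1
        split_ifs <;> omega
      · by_cases hmj : (mate ⟨k, hk⟩ : ℕ) = j
        · rw [if_pos ⟨by simpa using hkj, hm.2 hmj⟩, Function.update_idem, hmj,
            if_pos (Nat.lt_succ_self j)]
        · rw [if_neg (fun h => hmj (hm.1 h.2))]
          congr 1
          exact if_congr (by omega) rfl rfl
    · rintro ρ _ ⟨h31'', h9''⟩
      refine ⟨h31'', ?_⟩
      rw [h9'', if_pos (mate ⟨k, hk⟩).isLt, hF]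
      exact congrArg _ (update_upto (fun e => ((mate e : ℕ) : ℤ)) g hk)
  · rintro τ _ ⟨_, h⟩
    rw [h, upto_self]

lemma modify_spec (hZ : (n : ℤ) ≤ Z) (hn : σ 0 0 = n) {W g : Fin n → ℤ} {T : Finset (Fin n)}
    (h8 : σ 8 = arrayOf W) (h11 : σ 11 = ind T) (h30 : σ 30 = arrayOf g)
    (hW : ∀ e, |(n + 1) * W e + (if e ∈ T then 0 else 1)| ≤ Z) :
    WP O Z progModify (fun σ' => σ' 30 = ind T ∧
      σ' 8 = arrayOf fun e => (n + 1) * W e + (if e ∈ T then 0 else 1)) σ := by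
  refine WP.mono (WP.forN (fun k σ' =>
    σ' 30 = arrayOf (upto k (fun e => if e ∈ T then 1 else 0) g) ∧
    σ' 8 = arrayOf (upto k (fun e => (n + 1) * W e + (if e ∈ T then 0 else 1)) W)) (by decide)
    (by decide) (by decide) hn hZ (fun _ _ _ h => h)
    ⟨by rwa [upto_zero], by rwa [upto_zero]⟩ ?_) ?_
  · rintro k hk τ hf hk' ⟨h30', h8'⟩
    have f11 : τ 11 (τ 32 0) = if (⟨k, hk⟩ : Fin n) ∈ T then 1 else 0 := by
      rw [hk', hf 11 (by decide), h11]
      exact ind_apply T ⟨k, hk⟩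
    have f0 : τ 0 0 = n := (congrFun (hf 0 (by decide)) 0).trans hn
    have f8 : τ 8 (τ 32 0) = W ⟨k, hk⟩ := by
      rw [hk', h8']
      refine (arrayOf_apply _ ⟨k, hk⟩).trans ?_
      simp [upto]
    have ev : ((var 0 + .const 1) * .get 8 (var 32) + (.const 1 - .get 11 (var 32))).eval τ =
        (n + 1) * W ⟨k, hk⟩ + (if (⟨k, hk⟩ : Fin n) ∈ T then 0 else 1) := by
      change (τ 0 0 + 1) * τ 8 (τ 32 0) + (1 - τ 11 (τ 32 0)) = _
      rw [f0, f8, f11]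
      split_ifs <;> simp
    refine WP.seq (WP.assign ?_ (WP.assign ?_ ⟨?_, ?_⟩))
    · change |τ 11 (τ 32 0)| ≤ Z
      rw [f11]
      split_ifs <;> simp <;> omega
    · change |((var 0 + .const 1) * .get 8 (var 32) + (.const 1 - .get 11 (var 32))).eval τ| ≤ Z
      rw [ev]
      exact hW _
    · change Function.update (τ 30) (τ 32 0) (τ 11 (τ 32 0)) = _
      rw [f11, hk', h30']
      exact update_arrayOf_upto _ _ hk rfl
    · change Function.update (τ 8) (τ 32 0)
        (((var 0 + .const 1) * .get 8 (var 32) + (.const 1 - .get 11 (var 32))).eval τ) = _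
      rw [ev, hk', h8']
      exact update_arrayOf_upto _ _ hk rfl
  · rintro τ _ ⟨h30', h8'⟩
    rw [h30', h8', upto_self, upto_self]
    exact ⟨rfl, rfl⟩

/-- The integral version of `separated`. -/
def intSeparated (mate : Fin n → Fin n) (T Y : Finset (Fin n)) (u : Fin n → ℤ) (c : ℤ)
    (e : Fin n) : ℤ :=
  if e ∈ Y then 2 * u e else if mate e = e then 0 - c else if e ∈ T then 2 * u e - c
    else 2 * u e - 1

lemma separate_spec {mate : Fin n → Fin n} {u : Fin n → ℤ} {T Y : Finset (Fin n)} {B : ℤ}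
    {e : Fin n} (h9 : σ 9 ((e : ℕ) : ℤ) = ((mate e : ℕ) : ℤ))
    (h11 : σ 11 ((e : ℕ) : ℤ) = if e ∈ Y then 1 else 0) (h12 : σ 12 ((e : ℕ) : ℤ) = u e)
    (h17 : σ 17 0 = B) (h30 : σ 30 ((e : ℕ) : ℤ) = if e ∈ T then 1 else 0)
    (h32 : σ 32 0 = ((e : ℕ) : ℤ)) (hZ : |intSeparated mate T Y u (16 * B) e| ≤ Z) :
    WP O Z progSeparate (fun σ' => σ' 34 0 = intSeparated mate T Y u (16 * B) e) σ := by
  have e12 : (Exp.const 2 * .get 12 (var 32)).eval σ = 2 * u e := by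
    simp only [eval_mul, eval_get, eval_const, h32, h12]
  have e17 : (Exp.const 16 * var 17).eval σ = 16 * B := by
    simp only [eval_mul, eval_get, eval_const, h17]
  have fin : ∀ x : Exp, x.eval σ = intSeparated mate T Y u (16 * B) e →
      WP O Z (setVar 34 x) (fun σ' => σ' 34 0 = intSeparated mate T Y u (16 * B) e) σ :=
    fun x hx => WP.assign (by rwa [hx]) hx
  have c11 : (Exp.get 11 (var 32)).eval σ = if e ∈ Y then 1 else 0 := by
    simp only [eval_get, eval_const, h32, h11]
  have c9 : (Exp.op .eq (.get 9 (var 32)) (var 32)).eval σ = if mate e = e then 1 else 0 := by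
    simp only [eval_eq, eval_get, eval_const, h32, h9]
    exact if_congr (by rw [Fin.ext_iff]; omega) rfl rfl
  have c30 : (Exp.get 30 (var 32)).eval σ = if e ∈ T then 1 else 0 := by
    simp only [eval_get, eval_const, h32, h30]
  rw [progSeparate]
  unfold intSeparated at *
  by_cases hY : e ∈ Y
  · rw [if_pos hY] at *
    exact WP.cond (fun _ => fin _ e12) fun hc => absurd (c11.symm.trans hc) one_ne_zero
  rw [if_neg hY] at *
  refine WP.cond (fun hc => absurd c11 hc) fun _ => ?_
  by_cases hm : mate e = e
  · rw [if_pos hm] at *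
    exact WP.cond (fun _ => fin _ (by rw [eval_sub, e17, eval_const]))
      fun hc => absurd (c9.symm.trans hc) one_ne_zero
  rw [if_neg hm] at *
  refine WP.cond (fun hc => absurd c9 hc) fun _ => ?_
  by_cases hT : e ∈ T
  · rw [if_pos hT] at *
    exact WP.cond (fun _ => fin _ (by rw [eval_sub, e17, e12]))
      fun hc => absurd (c30.symm.trans hc) one_ne_zero
  rw [if_neg hT] at *
  exact WP.cond (fun hc => absurd c30 hc) fun _ => fin _ (by rw [eval_sub, e12, eval_const])

lemma output_spec (hZ : (n : ℤ) ≤ Z) (hn : σ 0 0 = n) {mate : Fin n → Fin n} {a d u : Fin n → ℤ}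
    {T Y : Finset (Fin n)} {B D : ℤ} (h3 : σ 3 = arrayOf a) (h4 : σ 4 = arrayOf d)
    (h7 : σ 7 0 = D) (h9 : σ 9 = arrayOf fun e => ((mate e : ℕ) : ℤ)) (h11 : σ 11 = ind Y)
    (h12 : σ 12 = arrayOf u) (h17 : σ 17 0 = B) (h30 : σ 30 = ind T)
    (hs : ∀ e, |intSeparated mate T Y u (16 * B) e| ≤ Z)
    (ha : ∀ e, |a e * (D / d e) * (2 * (n + 1)) - intSeparated mate T Y u (16 * B) e| ≤ Z)
    (hD : |D * (2 * (n + 1))| ≤ Z) :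
    WP O Z progOutput (fun σ' => ∀ e : Fin n,
      σ' 5 ((e : ℕ) : ℤ) = a e * (D / d e) * (2 * (n + 1)) - intSeparated mate T Y u (16 * B) e ∧
      σ' 6 ((e : ℕ) : ℤ) = D * (2 * (n + 1))) σ := by
  refine WP.mono (WP.forN (fun k σ' => ∀ e : Fin n, (e : ℕ) < k →
      σ' 5 ((e : ℕ) : ℤ) = a e * (D / d e) * (2 * (n + 1)) - intSeparated mate T Y u (16 * B) e ∧
      σ' 6 ((e : ℕ) : ℤ) = D * (2 * (n + 1))) (by decide) (by decide) (by decide) hn hZ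
      (fun _ _ _ h => h) (by simp) ?_) fun σ' _ h e => h e e.isLt
  intro k hk τ hf hk' h
  refine WP.seq (WP.mono (separate_spec (e := ⟨k, hk⟩) (mate := mate) (Y := Y) (T := T) (u := u)
    ?_ ?_ ?_ ((congrFun (hf 17 (by decide)) 0).trans h17) ?_ hk' (hs _)) ?_)
  · rw [hf 9 (by decide), h9, arrayOf_apply]
  · rw [hf 11 (by decide), h11, ind_apply]
  · rw [hf 12 (by decide), h12, arrayOf_apply]
  · rw [hf 30 (by decide), h30, ind_apply]
  intro ρ hg h34
  have g : ∀ b, b ∉ progSeparate.mods → b ∉ (32 :: (progSeparate ⨟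
    .assign 5 (var 32) (.get 3 (var 32) * (var 7 / .get 4 (var 32)) *
      (.const 2 * (var 0 + .const 1)) - var 34) ⨟
    .assign 6 (var 32) (var 7 * (.const 2 * (var 0 + .const 1)))).mods) → ρ b = σ b :=
    fun b hb hb' => (hg b hb).trans (hf b hb')
  have g32 : ρ 32 0 = k := (congrFun (hg 32 (by decide)) 0).trans hk'
  have g0 : ρ 0 0 = n := by rw [g 0 (by decide) (by decide), hn]
  have g7 : ρ 7 0 = D := by rw [g 7 (by decide) (by decide), h7]
  have g3 : ρ 3 k = a ⟨k, hk⟩ := by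
    rw [g 3 (by decide) (by decide), h3]
    exact arrayOf_apply a ⟨k, hk⟩
  have g4 : ρ 4 k = d ⟨k, hk⟩ := by
    rw [g 4 (by decide) (by decide), h4]
    exact arrayOf_apply d ⟨k, hk⟩
  have e5 : (.get 3 (var 32) * (var 7 / .get 4 (var 32)) *
      (.const 2 * (var 0 + .const 1)) - var 34).eval ρ = a ⟨k, hk⟩ * (D / d ⟨k, hk⟩) *
      (2 * (n + 1)) - intSeparated mate T Y u (16 * B) ⟨k, hk⟩ := by
    simp only [eval_sub, eval_mul, eval_div, eval_add, eval_get, eval_const, g32, g0, g7, g3, g4,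
      h34]
  have e6 : (var 7 * (.const 2 * (var 0 + .const 1))).eval ρ = D * (2 * (n + 1)) := by
    simp only [eval_mul, eval_add, eval_get, eval_const, g0, g7]
  refine WP.seq (WP.assign (by rw [e5]; exact ha _) (WP.assign ?_ ?_))
  · change |(var 7 * (.const 2 * (var 0 + .const 1))).eval ρ| ≤ Z
    rw [e6]
    exact hD
  intro e he
  change Function.update (ρ 5) (ρ 32 0) (Exp.eval ρ _) _ = _ ∧
    Function.update (ρ 6) (ρ 32 0) ((var 7 * (.const 2 * (var 0 + .const 1))).eval ρ) _ = _
  rw [e5, e6, g32]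
  rcases eq_or_ne e ⟨k, hk⟩ with rfl | hne
  · exact ⟨Function.update_self .., Function.update_self ..⟩
  · have hne' : (e : ℕ) ≠ k := fun h => hne (Fin.ext h)
    rw [Function.update_of_ne (by omega), Function.update_of_ne (by omega), hg 5 (by decide),
      hg 6 (by decide)]
    exact h e (by omega)

end Preprocessing

end OracleRAM

namespace Pricing

/-- The program computes over the integers, the theorem on prices is about real potentials. -/
lemma Extreme.intCast {α : Type*} [DecidableEq α] {M : Matroid α} {mate : α → α} {W u : α → ℤ}
    {G X : Finset α} (h : Extreme M mate W u G X) :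
    Extreme M mate (fun e => (W e : ℝ)) (fun e => (u e : ℝ)) G X where
  mate_mem := h.mate_mem
  mate_ne := h.mate_ne
  sub := h.sub
  trans := h.trans
  indep := h.indep
  exch x hx y hy hyX hI := Int.cast_le.2 (h.exch x hx y hy hyX hI)
  pair x hx := by exact_mod_cast h.pair x hx

end Pricing

namespace OracleRAM

open Pricing

/-! ### From the integral splitting to rational prices -/

section Correctness

variable {n : ℕ} {M₁ M₂ : Matroid (Fin n)} {mate : Fin n → Fin n}

lemma abs_intSeparated_le {T Y : Finset (Fin n)} {u : Fin n → ℤ} {B : ℤ} (hY : Y ⊆ paired mate)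
    (hB : 1 ≤ B) (hu : ∀ e ∈ paired mate, |u e| ≤ B) (e : Fin n) :
    |intSeparated mate T Y u (16 * B) e| ≤ 18 * B := by
  unfold intSeparated
  rw [abs_le]
  split_ifs with h1 h2 h3
  · have := abs_le.1 (hu e (hY h1))
    omega
  · omega
  all_goals
    have := abs_le.1 (hu e (mem_paired.2 h2))
    omega

/-- Integral weights of different sets differ by at least `1`, hence by at least `n + 1` after
scaling, while the total bonus is at most `n`. So `N = (n + 1) * D` is admissible. -/
theorem isPriceVector_of_intExtreme (h : IsMate M₁ mate) (hE : M₂.E = Set.univ)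
    {w₁ w₂ : Fin n → ℚ} {D : ℤ} (hD : 0 < D) {W u₀ u : Fin n → ℤ}
    (hW : ∀ e, (W e : ℚ) = D * (w₂ e - w₁ e)) {T Y Z₀ : Finset (Fin n)} (hZ1 : Z₀ᶜ ∈ bases M₁)
    (hZ2 : Z₀ ∈ bases M₂) (hT : Extreme M₂ mate W u₀ (paired mate) T)
    (hY : Extreme M₂ mate (fun e => (n + 1) * W e + if e ∈ T then 0 else 1) u (paired mate) Y)
    {B : ℤ} (hB : 1 ≤ B) (hu : ∀ e ∈ paired mate, |u e| ≤ B)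
    (hWB : ∀ e, |(n + 1) * W e + (if e ∈ T then 0 else 1)| ≤ B) :
    IsPriceVector M₁ M₂ (fun e => (w₁ e : ℝ)) (fun e => (w₂ e : ℝ)) (fun e =>
      ((w₂ e - intSeparated mate T Y u (16 * B) e / (D * (2 * (n + 1))) : ℚ) : ℝ)) := by
  have hW' : ∀ e, (W e : ℝ) = D * ((w₂ e : ℝ) - w₁ e) := fun e => by exact_mod_cast hW e
  have hDR : (0 : ℝ) < D := by exact_mod_cast hD
  have hsum : ∀ X : Finset (Fin n),
      (D : ℝ) * ∑ e ∈ X, ((w₂ e : ℝ) - w₁ e) = ((∑ e ∈ X, W e : ℤ) : ℝ) := by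
    intro X
    rw [Finset.mul_sum, Int.cast_sum]
    exact Finset.sum_congr rfl fun e _ => (hW' e).symm
  have hopt : IsOptimal M₁ M₂ (fun e => (w₂ e : ℝ) - w₁ e) T := by
    obtain ⟨h1, h2, _⟩ := hT.mem_bases h hE hZ1 hZ2
    refine ⟨h1, h2, fun Z h3 h4 => ?_⟩
    refine le_of_mul_le_mul_left ?_ hDR
    rw [hsum, hsum, Int.cast_le]
    exact (hT.mem_bases h hE h3 h4).2.2
  have hNW : ∀ e, ((n : ℝ) + 1) * D * ((w₂ e : ℝ) - w₁ e) = ((n + 1) * W e : ℤ) := by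
    intro e
    push_cast
    rw [hW', mul_assoc]
  have key := isPriceVector_of_extreme (N := (n + 1) * D) (c := 16 * B) h hE hopt (by positivity)
    (u := fun e => (u e : ℝ)) (Y := Y) ?_ ?_ ?_ ?_
  · convert key using 2 with e
    push_cast
    congr 1
    rw [show (D : ℝ) * (2 * (n + 1)) = 2 * ((n + 1) * D) by ring]
    congr 1
    unfold intSeparated separated
    split_ifs <;> push_cast <;> ring
  · intro Z hlt
    have h1 : ∑ e ∈ Z, W e < ∑ e ∈ T, W e := by
      have := mul_lt_mul_of_pos_left hlt hDR
      rw [hsum, hsum] at this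
      exact_mod_cast this
    rw [mul_assoc, mul_sub, hsum, hsum, Fintype.card_fin]
    have h2 : (1 : ℝ) ≤ ((∑ e ∈ T, W e : ℤ) : ℝ) - ((∑ e ∈ Z, W e : ℤ) : ℝ) := by
      rw [← Int.cast_sub]
      exact_mod_cast (by omega : 1 ≤ ∑ e ∈ T, W e - ∑ e ∈ Z, W e)
    have hn0 : (0 : ℝ) ≤ n := Nat.cast_nonneg n
    nlinarith
  · convert hY.intCast using 2 with e
    rw [hNW]
    push_cast
    rfl
  · intro e he
    have := abs_le.1 (hu e he)
    exact_mod_cast (by omega : -(16 * B) < 2 * u e)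
  · intro e he
    have h1 := abs_le.1 (hu e he)
    have h2 := abs_le.1 (hu _ (h.mate_mem_paired he))
    have h3 := abs_le.1 (hWB e)
    have h4 := abs_le.1 (hWB (mate e))
    have h5 : ∀ e, (0 : ℤ) ≤ (if e ∈ T then 0 else 1) ∧ (if e ∈ T then (0 : ℤ) else 1) ≤ 1 := by
      intro e
      split_ifs <;> simp
    have h6 := h5 e
    have h7 := h5 (mate e)
    rw [hNW, hNW]
    -- The potentials contribute at most `4 * B` and the scaled weights, each at most `B + 1` in
    -- absolute value, at most `4 * (B + 1)`. As `B ≥ 1`, the constant `16 * B` exceeds the sum.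
    exact_mod_cast (by omega : 2 * u e - 2 * u (mate e) -
      2 * ((n + 1) * W e - (n + 1) * W (mate e)) < 16 * B)

end Correctness

/-! ### Bit-length bounds in terms of the input size -/

section Bounds

variable {n : ℕ} {w₁ w₂ : Fin n → ℚ}

lemma bits_le_inputSize (e : Fin n) : bits (w₁ e).num + bits (w₁ e).den + bits (w₂ e).num +
    bits (w₂ e).den ≤ inputSize w₁ w₂ := by
  have := Finset.single_le_sum (f := fun s => bits (w₁ s).num + bits (w₁ s).den +
    bits (w₂ s).num + bits (w₂ s).den) (fun _ _ => Nat.zero_le _) (Finset.mem_univ e)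
  unfold inputSize
  omega

lemma le_inputSize : n ≤ inputSize w₁ w₂ := Nat.le_add_right _ _

/-- A common denominator of all weights. -/
def commonDen (w₁ w₂ : Fin n → ℚ) : ℤ := ∏ e, (((w₁ e).den : ℤ) * ((w₂ e).den : ℤ))

lemma commonDen_pos : 0 < commonDen w₁ w₂ :=
  Finset.prod_pos fun e _ => mul_pos (by exact_mod_cast (w₁ e).pos) (by exact_mod_cast (w₂ e).pos)

lemma dvd_commonDen (e : Fin n) :
    ((w₁ e).den : ℤ) ∣ commonDen w₁ w₂ ∧ ((w₂ e).den : ℤ) ∣ commonDen w₁ w₂ := by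
  have := Finset.dvd_prod_of_mem (fun e => ((w₁ e).den : ℤ) * ((w₂ e).den : ℤ))
    (Finset.mem_univ e)
  exact ⟨(dvd_mul_right _ _).trans this, (dvd_mul_left _ _).trans this⟩

/-- Bit lengths add up under multiplication, and those of the denominators are part of the input
size. -/
lemma commonDen_le : commonDen w₁ w₂ ≤ 2 ^ inputSize w₁ w₂ := by
  calc commonDen w₁ w₂ ≤ ∏ e, (2 : ℤ) ^ (bits (w₁ e).num + bits (w₁ e).den + bits (w₂ e).num +
        bits (w₂ e).den) := by
        refine Finset.prod_le_prod (fun e _ => by positivity) fun e _ => ?_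
        have h1 := (le_abs_self _).trans (abs_lt_two_pow_bits ((w₁ e).den : ℤ)).le
        have h2 := (le_abs_self _).trans (abs_lt_two_pow_bits ((w₂ e).den : ℤ)).le
        calc ((w₁ e).den : ℤ) * ((w₂ e).den : ℤ) ≤ 2 ^ bits (w₁ e).den * 2 ^ bits (w₂ e).den := by
              gcongr
          _ = 2 ^ (bits (w₁ e).den + bits (w₂ e).den) := by rw [pow_add]
          _ ≤ _ := by
              gcongr
              · norm_num
              · omega
    _ = 2 ^ ∑ e, (bits (w₁ e).num + bits (w₁ e).den + bits (w₂ e).num + bits (w₂ e).den) := by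
        rw [Finset.prod_pow_eq_pow_sum]
    _ ≤ 2 ^ inputSize w₁ w₂ := by
        gcongr
        · norm_num
        · exact Nat.le_add_left _ _

/-- The integral weights. -/
def intWeight (w₁ w₂ : Fin n → ℚ) (e : Fin n) : ℤ :=
  (w₂ e).num * (commonDen w₁ w₂ / (w₂ e).den) - (w₁ e).num * (commonDen w₁ w₂ / (w₁ e).den)

lemma num_mul_div_den {q : ℚ} {D : ℤ} (h : (q.den : ℤ) ∣ D) :
    ((q.num * (D / q.den) : ℤ) : ℚ) = D * q := by
  obtain ⟨c, rfl⟩ := h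
  have hd : (q.den : ℤ) ≠ 0 := by exact_mod_cast q.den_nz
  have hd' : (q.den : ℚ) ≠ 0 := by exact_mod_cast q.den_nz
  rw [Int.mul_ediv_cancel_left _ hd]
  push_cast
  nth_rewrite 3 [← Rat.num_div_den q]
  field_simp

lemma intWeight_cast (e : Fin n) :
    (intWeight w₁ w₂ e : ℚ) = commonDen w₁ w₂ * (w₂ e - w₁ e) := by
  have h := dvd_commonDen (w₁ := w₁) (w₂ := w₂) e
  rw [intWeight, Int.cast_sub, num_mul_div_den h.1, num_mul_div_den h.2, mul_sub]

lemma abs_mul_commonDen_le {a d : ℤ} (ha : |a| ≤ 2 ^ inputSize w₁ w₂) :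
    |a * (commonDen w₁ w₂ / d)| ≤ 2 ^ (2 * inputSize w₁ w₂) := by
  have h1 : |commonDen w₁ w₂ / d| ≤ 2 ^ inputSize w₁ w₂ :=
    (Int.abs_ediv_le_abs _ _).trans (by rw [abs_of_pos commonDen_pos]; exact commonDen_le)
  rw [abs_mul, two_mul, pow_add]
  gcongr

lemma abs_num_le (e : Fin n) :
    |(w₁ e).num| ≤ 2 ^ inputSize w₁ w₂ ∧ |(w₂ e).num| ≤ 2 ^ inputSize w₁ w₂ := by
  have h := bits_le_inputSize (w₁ := w₁) (w₂ := w₂) e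
  exact ⟨(bits_le_iff.1 (by omega)).le, (bits_le_iff.1 (by omega)).le⟩

lemma den_le (e : Fin n) :
    |((w₁ e).den : ℤ)| ≤ 2 ^ inputSize w₁ w₂ ∧ |((w₂ e).den : ℤ)| ≤ 2 ^ inputSize w₁ w₂ := by
  have h := bits_le_inputSize (w₁ := w₁) (w₂ := w₂) e
  exact ⟨(bits_le_iff.1 (by omega)).le, (bits_le_iff.1 (by omega)).le⟩

lemma add_one_le_two_pow (m : ℕ) : (m : ℤ) + 1 ≤ 2 ^ m := by
  exact_mod_cast Nat.lt_two_pow_self (n := m)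

lemma abs_intWeight_le (e : Fin n) : |intWeight w₁ w₂ e| ≤ 2 ^ (2 * inputSize w₁ w₂ + 1) := by
  have h := abs_num_le (w₁ := w₁) (w₂ := w₂) e
  refine (abs_sub _ _).trans ?_
  rw [pow_succ, mul_two]
  exact add_le_add (abs_mul_commonDen_le h.2) (abs_mul_commonDen_le h.1)

lemma abs_modWeight_le (T : Finset (Fin n)) (e : Fin n) :
    |(n + 1) * intWeight w₁ w₂ e + (if e ∈ T then 0 else 1)| ≤ 2 ^ (3 * inputSize w₁ w₂ + 2) := by
  set m := inputSize w₁ w₂ with hm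
  have h1 := abs_intWeight_le (w₁ := w₁) (w₂ := w₂) e
  have h2 : (n : ℤ) + 1 ≤ 2 ^ m := by
    have := add_one_le_two_pow m
    have : n ≤ m := le_inputSize
    omega
  have h3 : |(n + 1) * intWeight w₁ w₂ e| ≤ 2 ^ m * 2 ^ (2 * m + 1) := by
    rw [abs_mul, abs_of_nonneg (by positivity)]
    gcongr
  have h4 : |if e ∈ T then (0 : ℤ) else 1| ≤ 1 := by split_ifs <;> simp
  have h5 : (1 : ℤ) ≤ 2 ^ m * 2 ^ (2 * m + 1) := by
    rw [← pow_add]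
    exact one_le_pow₀ (by norm_num)
  calc _ ≤ _ := abs_add_le _ _
    _ ≤ 2 ^ m * 2 ^ (2 * m + 1) + 2 ^ m * 2 ^ (2 * m + 1) := add_le_add h3 (h4.trans h5)
    _ = _ := by ring

/-- Bounds the bit length of the potentials. -/
def potBits (m : ℕ) : ℕ := 7 * m + 4 + (m + 4) * (m + 1)

/-- The factors are bounded by `2 ^ m * 2 ^ (6 * m + 4)` and, since `8 * n + 16 ≤ 2 ^ (m + 4)`, by
`2 ^ ((m + 4) * (m + 1))`. The exponents sum to `potBits m`. -/
lemma bound_le {m : ℕ} (hm : n ≤ m) {V : Fin n → ℤ} (hV : ∀ e, |V e| ≤ 2 ^ (3 * m + 2)) :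
    (1 + ∑ e, V e * V e) * (8 * n + 16) ^ (n + 1) ≤ 2 ^ potBits m := by
  have h1 : ∑ e, V e * V e ≤ n * 2 ^ (6 * m + 4) := by
    calc _ ≤ ∑ _e : Fin n, (2 : ℤ) ^ (6 * m + 4) := by
          refine Finset.sum_le_sum fun e _ => ?_
          rw [← abs_mul_abs_self, show 6 * m + 4 = (3 * m + 2) + (3 * m + 2) by ring, pow_add]
          exact mul_le_mul (hV e) (hV e) (abs_nonneg _) (by positivity)
      _ = _ := by simp
  have h2 : (1 : ℤ) ≤ 2 ^ (6 * m + 4) := one_le_pow₀ (by norm_num)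
  have h3 := add_one_le_two_pow m
  have h4 : (8 * n + 16 : ℤ) ≤ 2 ^ (m + 4) := by
    rw [pow_add]
    omega
  have h5 : (1 + ∑ e, V e * V e) ≤ 2 ^ m * 2 ^ (6 * m + 4) := by
    calc 1 + ∑ e, V e * V e ≤ 2 ^ (6 * m + 4) + n * 2 ^ (6 * m + 4) := add_le_add h2 h1
      _ = (n + 1) * 2 ^ (6 * m + 4) := by ring
      _ ≤ _ := by
          gcongr
          omega
  calc (1 + ∑ e, V e * V e) * (8 * n + 16) ^ (n + 1)
      ≤ (2 ^ m * 2 ^ (6 * m + 4)) * (2 ^ (m + 4)) ^ (m + 1) := by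
        refine mul_le_mul h5 ?_ (by positivity) (by positivity)
        calc (8 * n + 16 : ℤ) ^ (n + 1) ≤ (2 ^ (m + 4)) ^ (n + 1) := by gcongr
          _ ≤ _ := pow_le_pow_right₀ (one_le_pow₀ (by norm_num)) (by omega)
    _ = 2 ^ potBits m := by
        rw [← pow_mul, ← pow_add, ← pow_add, potBits]
        congr 1
        ring

lemma arrayOf_zero : arrayOf (fun _ : Fin n => 0) = fun _ => 0 := by
  funext i
  simp [arrayOf]

lemma ind_empty : ind (∅ : Finset (Fin n)) = fun _ => 0 := by
  simp [ind, arrayOf_zero]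

lemma abs_arrayOf_le {f : Fin n → ℤ} {Z : ℤ} (hZ : 0 ≤ Z) (h : ∀ e, |f e| ≤ Z) (i : ℤ) :
    |arrayOf f i| ≤ Z := by
  unfold arrayOf
  split_ifs
  · exact h _
  · simpa using hZ

lemma bdd_input {Z : ℤ} (hZ : 2 ^ inputSize w₁ w₂ ≤ Z) : Bdd Z (input w₁ w₂) := by
  have h0 : 0 ≤ Z := le_trans (by positivity) hZ
  intro a i
  match a with
  | 0 =>
    change |if i = 0 then (n : ℤ) else 0| ≤ Z
    have h1 := add_one_le_two_pow (inputSize w₁ w₂)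
    have h2 : n ≤ inputSize w₁ w₂ := le_inputSize
    split_ifs
    · rw [abs_of_nonneg (by omega)]
      omega
    · simpa using h0
  | 1 => exact abs_arrayOf_le h0 (fun e => (abs_num_le e).1.trans hZ) i
  | 2 => exact abs_arrayOf_le h0 (fun e => (den_le e).1.trans hZ) i
  | 3 => exact abs_arrayOf_le h0 (fun e => (abs_num_le e).2.trans hZ) i
  | 4 => exact abs_arrayOf_le h0 (fun e => (den_le e).2.trans hZ) i
  | _ + 5 => simpa [input] using h0

end Bounds

/-! ### The complete algorithm -/

section Pricing

variable {n : ℕ} {M₁ M₂ : Matroid (Fin n)} {w₁ w₂ : Fin n → ℚ}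

lemma prepare_spec {mate : Fin n → Fin n} (hmate : IsMate M₁ mate) {Z : ℤ}
    (hZ : 2 ^ (2 * inputSize w₁ w₂ + 1) ≤ Z) :
    WP (indepOracle M₁ M₂) Z progPrepare
      (fun σ => Inst mate (intWeight w₁ w₂) σ ∧ σ 7 0 = commonDen w₁ w₂) (input w₁ w₂) := by
  have hO : ∀ Y : Finset (Fin n), indepOracle M₁ M₂ 0 Y ↔ M₁.Indep (Y : Set (Fin n)) :=
    fun Y => by simp [indepOracle]
  set m := inputSize w₁ w₂ with hm
  have hmZ : (2 : ℤ) ^ m ≤ Z := (pow_le_pow_right₀ (by norm_num) (by omega)).trans hZ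
  have hZn : (n : ℤ) ≤ Z := by
    have h1 := add_one_le_two_pow m
    have h2 : n ≤ m := le_inputSize
    omega
  refine WP.seq (WP.mono (den_spec hZn rfl (d₁ := fun e => ((w₁ e).den : ℤ))
    (d₂ := fun e => ((w₂ e).den : ℤ)) rfl rfl (fun e => by exact_mod_cast (w₁ e).pos)
    (fun e => by exact_mod_cast (w₂ e).pos) (commonDen_le.trans hmZ)) ?_)
  intro σ₁ f₁ h7₁
  have h0₁ : σ₁ 0 0 = n := by rw [f₁ 0 (by decide)]; rfl
  refine WP.seq (WP.mono (weights_spec hZn h0₁ (a₁ := fun e => (w₁ e).num)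
    (a₂ := fun e => (w₂ e).num) (d₁ := fun e => ((w₁ e).den : ℤ))
    (d₂ := fun e => ((w₂ e).den : ℤ)) (g := fun _ => 0) (f₁ 1 (by decide)) (f₁ 2 (by decide))
    (f₁ 3 (by decide)) (f₁ 4 (by decide)) h7₁ ?_ (fun e => (abs_intWeight_le e).trans hZ)) ?_)
  · rw [f₁ 8 (by decide), arrayOf_zero]
    rfl
  intro σ₂ f₂ h8₂
  have h0₂ : σ₂ 0 0 = n := by rw [f₂ 0 (by decide), h0₁]
  refine WP.mono (mates_spec hmate hO hZn h0₂ (g := fun _ => 0) ?_ ?_) ?_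
  · rw [f₂ 31 (by decide), f₁ 31 (by decide), ind_empty]
    rfl
  · rw [f₂ 9 (by decide), f₁ 9 (by decide), arrayOf_zero]
    rfl
  intro σ₃ f₃ h9₃
  refine ⟨⟨by rw [f₃ 0 (by decide), h0₂], (f₃ 8 (by decide)).trans h8₂, h9₃⟩, ?_⟩
  rw [f₃ 7 (by decide), f₂ 7 (by decide), h7₁]
  rfl

/-- The second run starts from whatever the first one left behind: only the shape of the arrays
matters. A copy of the first optimum is kept in array `30`, which the second run does not touch. -/
lemma solve_spec (hE : M₂.E = Set.univ) {O : Fin 2 → Finset (Fin n) → Prop}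
    (hO : ∀ Y : Finset (Fin n), O 1 Y ↔ M₂.Indep (Y : Set (Fin n))) {mate : Fin n → Fin n}
    (hm : Function.Involutive mate) {Z C : ℤ} (hZ : (n : ℤ) ≤ Z) (hCZ : C ≤ Z)
    {W : Fin n → ℤ} (hWC : (1 + ∑ e, W e * W e) * (8 * n + 16) ^ (n + 1) ≤ C)
    (hVZ : ∀ T : Finset (Fin n), ∀ e, |(n + 1) * W e + (if e ∈ T then 0 else 1)| ≤ Z)
    (hVC : ∀ T : Finset (Fin n), (1 + ∑ e, ((n + 1) * W e + (if e ∈ T then 0 else 1)) *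
      ((n + 1) * W e + (if e ∈ T then 0 else 1))) * (8 * n + 16) ^ (n + 1) ≤ C)
    {Z₀ : Finset (Fin n)} (hTI : M₂.Indep (Z₀ : Set (Fin n)))
    (hTt : ∀ e, mate e ≠ e → (e ∈ Z₀ ↔ mate e ∉ Z₀)) {σ : Store} (hI : Inst mate W σ)
    (h0 : ∀ a ∈ [10, 11, 12, 16, 30], σ a = fun _ => 0) :
    WP O Z progSolve (fun σ' => ∃ T u₀ B, B ≤ C ∧ Extreme M₂ mate W u₀ (paired mate) T ∧
      σ' 30 = ind T ∧ Solved M₂ mate (fun e => (n + 1) * W e + (if e ∈ T then 0 else 1))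
        (paired mate) B σ') σ := by
  have hz : ∀ a ∈ [10, 11, 12, 16, 30], σ a = ind (∅ : Finset (Fin n)) := fun a ha => by
    rw [h0 a ha, ind_empty]
  refine WP.seq (WP.mono (intersect_spec hE hO hm hZ (hWC.trans hCZ) hTI hTt hI
    (hz 10 (by decide)) (hz 11 (by decide)) (hz 12 (by decide)) (hz 16 (by decide))) ?_)
  rintro σ₄ f₄ ⟨_, _, hS₄⟩
  obtain ⟨u₀, T, hT, hC₄, _⟩ := hS₄.extreme
  obtain ⟨N₄, hN₄⟩ := hS₄.nodes
  have hI₄ := hI.frame (f₄ 0 (by decide)) (f₄ 8 (by decide)) (f₄ 9 (by decide))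
  refine WP.seq (WP.mono (modify_spec hZ hI₄.size hI₄.weights hC₄.cur (g := fun _ => 0) ?_
    (hVZ T)) ?_)
  · rw [f₄ 30 (by decide), h0 30 (by decide), arrayOf_zero]
  rintro σ₅ f₅ ⟨h30₅, h8₅⟩
  have hI₅ : Inst mate (fun e => (n + 1) * W e + (if e ∈ T then 0 else 1)) σ₅ :=
    ⟨by rw [f₅ 0 (by decide), hI₄.size], h8₅, (f₅ 9 (by decide)).trans hI₄.mates⟩
  refine WP.mono (intersect_spec hE hO hm hZ
    ((hVC T).trans hCZ) hTI hTt hI₅ ((f₅ 10 (by decide)).trans hC₄.ground)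
    ((f₅ 11 (by decide)).trans hC₄.cur) ((f₅ 12 (by decide)).trans hC₄.pot)
    ((f₅ 16 (by decide)).trans hN₄)) ?_
  rintro σ₆ f₆ ⟨B, hB, hS₆⟩
  refine ⟨T, u₀, B, hB.trans (le_trans ?_ (hVC T)), hT, (f₆ 30 (by decide)).trans h30₅, hS₆⟩
  have h1 : 0 ≤ ∑ e, ((n + 1) * W e + (if e ∈ T then 0 else 1)) *
      ((n + 1) * W e + (if e ∈ T then 0 else 1)) := Finset.sum_nonneg fun e _ => mul_self_nonneg _
  exact mul_le_mul_of_nonneg_left (pow_le_pow_right₀ (by omega) (by omega)) (by omega)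

lemma outputs_of_eq {σ : Store} {mate : Fin n → Fin n} {T Y : Finset (Fin n)} {u : Fin n → ℤ}
    {B : ℤ} (h : ∀ e : Fin n,
      σ 5 ((e : ℕ) : ℤ) = (w₂ e).num * (commonDen w₁ w₂ / (w₂ e).den) * (2 * (n + 1)) -
        intSeparated mate T Y u (16 * B) e ∧
      σ 6 ((e : ℕ) : ℤ) = commonDen w₁ w₂ * (2 * (n + 1))) :
    Outputs σ fun e => w₂ e -
      intSeparated mate T Y u (16 * B) e / (commonDen w₁ w₂ * (2 * (n + 1))) := by
  intro e
  have hD := commonDen_pos (w₁ := w₁) (w₂ := w₂)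
  obtain ⟨h5, h6⟩ := h e
  rw [h5, h6]
  refine ⟨by positivity, ?_⟩
  rw [Int.cast_sub, Int.cast_mul, num_mul_div_den (dvd_commonDen e).2]
  have hD' : (commonDen w₁ w₂ : ℚ) ≠ 0 := by exact_mod_cast hD.ne'
  have hn1 : (n : ℚ) + 1 ≠ 0 := by positivity
  push_cast
  field_simp

/-- The potentials are bounded by `C`. The output needs at most `C` for the scaled values of `w₂`
and `18 * C` for the separating potential, so five more bits than for `C` are enough. -/
theorem pricing_spec (hM : IsMarket M₁ M₂) :
    WP (indepOracle M₁ M₂) (2 ^ (potBits (inputSize w₁ w₂) + 5)) progPricing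
      (fun σ => ∃ p, Outputs σ p ∧ IsPriceVector M₁ M₂ (fun s => (w₁ s : ℝ))
        (fun s => (w₂ s : ℝ)) (fun s => (p s : ℝ))) (input w₁ w₂) := by
  obtain ⟨P, hP, hPM⟩ := hM.partition
  obtain ⟨mate, hmate⟩ := exists_isMate hP hPM
  obtain ⟨B₁, hB₁, B₂, hB₂, hdis, huni⟩ := hM.disjoint_bases
  have hE := hM.ground
  have hB₂c : B₂ᶜ ∈ bases M₁ := by
    rwa [← (isCompl_iff.2 ⟨hdis, codisjoint_iff.2 huni⟩).eq_compl]
  have hTt : ∀ e, mate e ≠ e → (e ∈ B₂ ↔ mate e ∉ B₂) := fun e he =>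
    (hmate.compl_mem_bases.1 hB₂c).2 e (mem_paired.2 he)
  have hO : ∀ Y : Finset (Fin n), indepOracle M₁ M₂ 1 Y ↔ M₂.Indep (Y : Set (Fin n)) :=
    fun Y => by simp [indepOracle]
  have hnm : n ≤ inputSize w₁ w₂ := le_inputSize
  generalize hZdef : (2 : ℤ) ^ (potBits (inputSize w₁ w₂) + 5) = Z
  generalize hCdef : (2 : ℤ) ^ potBits (inputSize w₁ w₂) = C
  have hpot : 3 * inputSize w₁ w₂ + 2 ≤ potBits (inputSize w₁ w₂) := by
    unfold potBits
    nlinarith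
  have hpow : ∀ k ≤ potBits (inputSize w₁ w₂), (2 : ℤ) ^ k ≤ C := fun k hk =>
    hCdef ▸ pow_le_pow_right₀ (by norm_num) hk
  have hC1 : 1 ≤ C := by simpa using hpow 0 (by omega)
  have hCZ : C * 32 = Z := by
    rw [← hZdef, ← hCdef, pow_add]
    norm_num
  have hZn : (n : ℤ) ≤ Z := by
    have h1 := add_one_le_two_pow (inputSize w₁ w₂)
    have h2 := hpow (inputSize w₁ w₂) (by omega)
    omega
  have hVle := abs_modWeight_le (w₁ := w₁) (w₂ := w₂)
  refine WP.seq (WP.mono (prepare_spec (w₁ := w₁) (w₂ := w₂) hmate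
    ((hpow _ (by omega)).trans (by omega))) ?_)
  rintro σ₁ f₁ ⟨hI₁, h7₁⟩
  refine WP.seq (WP.mono (solve_spec hE hO hmate.invol hZn (by omega : C ≤ Z)
    (hCdef ▸ bound_le hnm fun e => (abs_intWeight_le e).trans
      (pow_le_pow_right₀ (by norm_num) (by omega)))
    (fun T e => ((hVle T e).trans (hpow _ hpot)).trans (by omega))
    (fun T => hCdef ▸ bound_le hnm (hVle T)) hB₂.indep hTt hI₁ ?_) ?_)
  · intro a ha
    fin_cases ha <;> exact f₁ _ (by decide)
  rintro σ₂ f₂ ⟨T, u₀, B, hBC, hT, h30, hS⟩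
  obtain ⟨u, Y, hY, hC, hu⟩ := hS.extreme
  have hs := abs_intSeparated_le (T := T) hY.sub hS.one_le hu
  have h2n : |(2 * (n + 1) : ℤ)| ≤ 2 ^ (inputSize w₁ w₂ + 1) := by
    have := add_one_le_two_pow (inputSize w₁ w₂)
    rw [abs_of_nonneg (by positivity), pow_succ]
    omega
  have hnum : ∀ e, |(w₂ e).num * (commonDen w₁ w₂ / (w₂ e).den) * (2 * (n + 1))| ≤ C := by
    intro e
    rw [abs_mul]
    refine (mul_le_mul (abs_mul_commonDen_le (abs_num_le e).2) h2n (abs_nonneg _)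
      (by positivity)).trans ?_
    rw [← pow_add]
    exact hpow _ (by omega)
  refine WP.mono (output_spec hZn (mate := mate) (a := fun e => (w₂ e).num)
    (d := fun e => ((w₂ e).den : ℤ)) (D := commonDen w₁ w₂) (T := T) ?_ ?_ ?_ ?_ ?_ hC.cur
    hC.pot hS.bound h30 ?_ ?_ ?_) ?_
  · rw [f₂ 0 (by decide), hI₁.size]
  · rw [f₂ 3 (by decide), f₁ 3 (by decide)]
    rfl
  · rw [f₂ 4 (by decide), f₁ 4 (by decide)]
    rfl
  · rw [f₂ 7 (by decide), h7₁]
  · rw [f₂ 9 (by decide), hI₁.mates]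
  · intro e
    have := hs e
    omega
  · intro e
    have h1 := hs e
    have h2 := abs_sub ((w₂ e).num * (commonDen w₁ w₂ / (w₂ e).den) * (2 * (n + 1)))
      (intSeparated mate T Y u (16 * B) e)
    have h3 := hnum e
    exact h2.trans (by omega)
  · rw [abs_mul, abs_of_pos commonDen_pos]
    refine (mul_le_mul commonDen_le h2n (abs_nonneg _) (by positivity)).trans ?_
    rw [← pow_add]
    exact (hpow _ (by omega)).trans (by omega)
  · exact fun σ₃ _ hout => ⟨_, outputs_of_eq hout, isPriceVector_of_intExtreme hmate hE
      commonDen_pos intWeight_cast hB₂c hB₂ hT hY hS.one_le hu hS.weight⟩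

end Pricing

/-! ### The running time -/

/-- The running time as a polynomial. -/
noncomputable def Prog.tmPoly : Prog → Polynomial ℕ
  | skip => 1
  | assign _ i e => Polynomial.C (i.tm + e.tm + 1)
  | query _ _ _ => Polynomial.X + 1
  | seq c₁ c₂ => c₁.tmPoly + c₂.tmPoly + 1
  | cond e c₁ c₂ => Polynomial.C e.tm + c₁.tmPoly + c₂.tmPoly + 1
  | loop e c => (Polynomial.X + 1) * (Polynomial.C e.tm + c.tmPoly + 1)

lemma Prog.eval_tmPoly (c : Prog) (m : ℕ) : c.tmPoly.eval m = c.tm m := by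
  induction c with
  | skip => simp [tmPoly, tm]
  | assign _ i e => simp [tmPoly, tm]
  | query _ _ _ => simp [tmPoly, tm]
  | seq c₁ c₂ h₁ h₂ => simp [tmPoly, tm, h₁, h₂]
  | cond e c₁ c₂ h₁ h₂ => simp [tmPoly, tm, h₁, h₂]
  | loop e c h => simp [tmPoly, tm, h]

lemma Prog.tm_mono (c : Prog) {n m : ℕ} (h : n ≤ m) : c.tm n ≤ c.tm m := by
  induction c with
  | skip => exact le_rfl
  | assign _ i e => exact le_rfl
  | query _ _ _ => simpa [tm] using h
  | seq c₁ c₂ h₁ h₂ => simp only [tm]; omega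
  | cond e c₁ c₂ h₁ h₂ => simp only [tm]; omega
  | loop e c h' => simp only [tm]; gcongr

/-- The bound on the bit length of the numbers as a polynomial. -/
noncomputable def bitsPoly : Polynomial ℕ :=
  7 * Polynomial.X + 4 + (Polynomial.X + 4) * (Polynomial.X + 1) + 7

lemma eval_bitsPoly (m : ℕ) : bitsPoly.eval m = potBits m + 7 := by
  simp [bitsPoly, potBits]

theorem exists_polynomial_pricing :
    ∃ (c : Prog) (T : Polynomial ℕ),
      ∀ (n : ℕ) (M₁ M₂ : Matroid (Fin n)) (w₁ w₂ : Fin n → ℚ), IsMarket M₁ M₂ →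
        ∃ (t : ℕ) (σ : Store) (p : Fin n → ℚ),
          Exec (indepOracle M₁ M₂) c (input w₁ w₂) t σ ∧ t ≤ T.eval (inputSize w₁ w₂) ∧
          Outputs σ p ∧
          IsPriceVector M₁ M₂ (fun s => (w₁ s : ℝ)) (fun s => (w₂ s : ℝ)) (fun s => (p s : ℝ)) := by
  refine ⟨progPricing, progPricing.tmPoly * bitsPoly, fun n M₁ M₂ w₁ w₂ hM => ?_⟩
  have hpot : inputSize w₁ w₂ ≤ potBits (inputSize w₁ w₂) + 5 := by
    unfold potBits
    nlinarith
  obtain ⟨t, σ, hE, ht, -, p, hp, hprice⟩ := pricing_spec (w₁ := w₁) (w₂ := w₂) hM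
    (bdd_input (pow_le_pow_right₀ (by norm_num) hpot))
  refine ⟨t, σ, p, hE, ht.trans ?_, hp, hprice⟩
  rw [Polynomial.eval_mul, Prog.eval_tmPoly, eval_bitsPoly]
  -- The cell bound is a power of two with exponent `potBits + 5`, so it has one bit more than this
  -- exponent; the remaining unit comes from the factor `bits Z + 1` in the time bound.
  refine Nat.mul_le_mul (Prog.tm_mono _ le_inputSize) (Nat.succ_le_succ ?_)
  rw [bits_le_iff, abs_of_nonneg (by positivity)]
  exact pow_lt_pow_right₀ (by norm_num) (by omega)

end OracleRAM

theorem corollary1 :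
    (∀ (S : Type*) [Fintype S] [DecidableEq S] (M₁ M₂ : Matroid S) (w₁ w₂ : S → ℝ),
      Pricing.IsMarket M₁ M₂ → ∃ p : S → ℝ, Pricing.IsPriceVector M₁ M₂ w₁ w₂ p) ∧
    (∃ (c : OracleRAM.Prog) (T : Polynomial ℕ),
      ∀ (n : ℕ) (M₁ M₂ : Matroid (Fin n)) (w₁ w₂ : Fin n → ℚ), Pricing.IsMarket M₁ M₂ →
        ∃ (t : ℕ) (σ : OracleRAM.Store) (p : Fin n → ℚ),
          OracleRAM.Exec (OracleRAM.indepOracle M₁ M₂) c (OracleRAM.input w₁ w₂) t σ ∧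
          t ≤ T.eval (OracleRAM.inputSize w₁ w₂) ∧
          OracleRAM.Outputs σ p ∧
          Pricing.IsPriceVector M₁ M₂ (fun s => (w₁ s : ℝ)) (fun s => (w₂ s : ℝ))
            (fun s => (p s : ℝ))) :=
  ⟨fun _ _ _ _ _ w₁ w₂ hM => Pricing.exists_isPriceVector w₁ w₂ hM,
    OracleRAM.exists_polynomial_pricing⟩
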